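/- Let $G$ be a finite group. For a subset $S\subseteq G$ and weights $w:S\to\mathbb{R}_{\ge 0}$, the (potentially directed) Cayley graph $\mathrm{Cay}(G,S,w)$ has vertex set $G$ and, for all $u,v\in G$ with $u^{-1}v\in S$, a directed edge $(u,v)$ of weight $w(u^{-1}v)$. For a weighted directed graph $H$ on $G$ and $T\subseteq G$, let $w_H(\delta(T))$ be the total weight of the edges of $H$ going from $T$ to $G\setminus T$. For $\varepsilon\in(0,1)$, a graph $\widetilde H$ is a $(1\pm\varepsilon)$ cut sparsifier of $H$ if $(1-\varepsilon)\,w_H(\delta(T))\le w_{\widetilde H}(\delta(T))\le(1+\varepsilon)\,w_H(\delta(T))$ for all $T\subseteq G$. The weights $w$ are polynomially bounded with exponent $d$ if $w(s)\le |G|^d\,w(t)$ for all $s,t\in S$ with $w(t)>0$. Theorem. For all $d,c\in\mathbb{N}$ there are a constant $C>0$, a polynomial $p$ and a randomized algorithm, depending only on $d$ and $c$, such that the following holds for every finite group $G$, every $S\subseteq G$ (not necessarily closed under inverses), all weights $w:S\to\mathbb{R}_{\ge0}$ that are polynomially bounded with exponent $d$, and every $\varepsilon\in(0,1)$. 1.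 There are a subset $\widetilde S\subseteq S$ and weights $\widetilde w:\widetilde S\to\mathbb{R}_{\ge 0}$ such that $|\widetilde S|\le C\log^5|G|/\varepsilon^2$ and $\mathrm{Cay}(G,\widetilde S,\widetilde w)$ is a $(1\pm\varepsilon)$ cut sparsifier of $\mathrm{Cay}(G,S,w)$. 2. Given the multiplication table of $G$ (with the elements listed in any order), $S$, $w$ and $\varepsilon$, the algorithm always halts within $p(|G|)$ steps, and with probability at least $1-|G|^{-c}$ over its coin flips it outputs a pair $(\widetilde S,\widetilde w)$ with the properties in part 1. Here an algorithm is a program for the real RAM: unit-cost field operations and comparisons on real numbers (no rounding; the only real constants are natural numbers), unit-cost addition, truncated subtraction and comparison of the natural numbers that are used as indices, conversion of natural numbers to reals, and fair coin flips. -/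

import Mathlib

/-! ## Weighted directed graphs, cuts and Cayley graphs -/

/-- A weighted directed graph on the vertex set `V`: `weight u v` is the weight of the edge
`(u, v)`, and is used only when `(u, v)` is an edge. -/
structure WeightedDigraph (V : Type*) where
  Adj : V → V → Prop
  weight : V → V → ℝ

/-- The size of the cut `T`: the total weight of the edges that go from `T` to its complement.
For a symmetric graph this counts every undirected edge between `T` and its complement once. -/
noncomputable def WeightedDigraph.cutSize {V : Type*} [Fintype V] (H : WeightedDigraph V)
    (T : Set V) : ℝ :=
  open Classical in
  ∑ p ∈ Finset.univ.filter (fun p : V × V => p.1 ∈ T ∧ p.2 ∉ T ∧ H.Adj p.1 p.2),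
    H.weight p.1 p.2

/-- `H'` is a `(1 ± ε)` cut sparsifier of `H`: all cuts agree up to a factor in `[1 - ε, 1 + ε]`.
-/
def WeightedDigraph.IsCutSparsifier {V : Type*} [Fintype V] (ε : ℝ) (H' H : WeightedDigraph V) :
    Prop :=
  ∀ T : Set V, (1 - ε) * H.cutSize T ≤ H'.cutSize T ∧ H'.cutSize T ≤ (1 + ε) * H.cutSize T

/-- The (potentially directed) weighted Cayley graph `Cay(G, S, w)`. There is an edge from `u` to
`v` if and only if `u⁻¹ * v ∈ S`, and its weight is `w (u⁻¹ * v)`. Only the values of `w` on `S`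
play a role. -/
def Cay {G : Type*} [Group G] (S : Finset G) (w : G → ℝ) : WeightedDigraph G where
  Adj u v := u⁻¹ * v ∈ S
  weight u v := w (u⁻¹ * v)

/-- The weights are nonnegative and polynomially bounded with exponent `d`: the ratio of any
weight to any positive weight is at most `|G| ^ d`. -/
def PolyBoundedWeights {G : Type*} [Fintype G] (d : ℕ) (S : Finset G) (w : G → ℝ) : Prop :=
  (∀ s ∈ S, 0 ≤ w s) ∧
    ∀ s ∈ S, ∀ t ∈ S, 0 < w t → w s ≤ (Fintype.card G : ℝ) ^ d * w t

/-- `(S', w')` is a re-weighted subset of the generators `S` with `|S'| ≤ C log⁵|G| / ε²`, the new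
weights are nonnegative, and `Cay(G, S', w')` is a `(1 ± ε)` cut sparsifier of `Cay(G, S, w)`. -/
def IsSmallCayleyCutSparsifier {G : Type*} [Group G] [Fintype G] (C ε : ℝ) (S : Finset G)
    (w : G → ℝ) (S' : Finset G) (w' : G → ℝ) : Prop :=
  S' ⊆ S ∧ (∀ s ∈ S', 0 ≤ w' s) ∧
    (S'.card : ℝ) ≤ C * Real.log (Fintype.card G) ^ 5 / ε ^ 2 ∧
    WeightedDigraph.IsCutSparsifier ε (Cay S' w') (Cay S w)

/-! ## A randomized real RAM

Programs are finite syntax trees over finitely many arrays of natural numbers (used for indices and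
combinatorial data) and finitely many arrays of real numbers. Reals are handled only by the four
field operations and by comparisons; there is no rounding and the only real constants are natural
numbers. Natural numbers are handled by addition and truncated subtraction only. Randomness
consists of fair coin flips. Every operation takes unit time. -/
namespace RealRAM

/-- A memory: `nat a i j` and `real a i j` are the cells `(i, j)` of the arrays with the name `a`,
and `coins` is the stream of the coin flips that have not been used yet. -/
structure Memory where
  nat : ℕ → ℕ → ℕ → ℕ
  real : ℕ → ℕ → ℕ → ℝ
  coins : ℕ → Bool

/-- Write `x` into the cell `(i, j)` of the natural-number array `a`. -/
def Memory.setNat (m : Memory) (a i j x : ℕ) : Memory :=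
  { m with nat := fun a' i' j' => if a' = a ∧ i' = i ∧ j' = j then x else m.nat a' i' j' }

/-- Write `x` into the cell `(i, j)` of the real array `a`. -/
noncomputable def Memory.setReal (m : Memory) (a i j : ℕ) (x : ℝ) : Memory :=
  { m with real := fun a' i' j' => if a' = a ∧ i' = i ∧ j' = j then x else m.real a' i' j' }

/-- Remove the first coin flip from the stream. -/
def Memory.dropCoin (m : Memory) : Memory :=
  { m with coins := fun i => m.coins (i + 1) }

/-- Expressions for natural numbers. -/
inductive NatExpr where
  | lit (k : ℕ)
  | get (a : ℕ) (i j : NatExpr)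
  | add (x y : NatExpr)
  | sub (x y : NatExpr)

/-- Expressions for real numbers. -/
inductive RealExpr where
  | ofNat (x : NatExpr)
  | get (a : ℕ) (i j : NatExpr)
  | add (x y : RealExpr)
  | sub (x y : RealExpr)
  | mul (x y : RealExpr)
  | div (x y : RealExpr)

/-- Tests. -/
inductive Test where
  | natEq (x y : NatExpr)
  | natLt (x y : NatExpr)
  | realEq (x y : RealExpr)
  | realLt (x y : RealExpr)
  | not (b : Test)
  | and (b c : Test)

/-- Programs. -/
inductive Prog where
  | skip
  | setNat (a : ℕ) (i j x : NatExpr)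
  | setReal (a : ℕ) (i j : NatExpr) (x : RealExpr)
  | flip (a : ℕ) (i j : NatExpr)
  | seq (P Q : Prog)
  | ite (b : Test) (P Q : Prog)
  | while (b : Test) (P : Prog)

/-- The value of an expression. -/
def NatExpr.eval (m : Memory) : NatExpr → ℕ
  | lit k => k
  | get a i j => m.nat a (i.eval m) (j.eval m)
  | add x y => x.eval m + y.eval m
  | sub x y => x.eval m - y.eval m

/-- The number of operations in an expression. -/
def NatExpr.cost : NatExpr → ℕ
  | lit _ => 1
  | get _ i j => i.cost + j.cost + 1
  | add x y => x.cost + y.cost + 1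
  | sub x y => x.cost + y.cost + 1

/-- The value of an expression. Division by zero returns zero. -/
noncomputable def RealExpr.eval (m : Memory) : RealExpr → ℝ
  | ofNat x => (x.eval m : ℝ)
  | get a i j => m.real a (i.eval m) (j.eval m)
  | add x y => x.eval m + y.eval m
  | sub x y => x.eval m - y.eval m
  | mul x y => x.eval m * y.eval m
  | div x y => x.eval m / y.eval m

/-- The number of operations in an expression. -/
def RealExpr.cost : RealExpr → ℕ
  | ofNat x => x.cost + 1
  | get _ i j => i.cost + j.cost + 1
  | add x y => x.cost + y.cost + 1
  | sub x y => x.cost + y.cost + 1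
  | mul x y => x.cost + y.cost + 1
  | div x y => x.cost + y.cost + 1

/-- The truth value of a test. -/
def Test.Holds (m : Memory) : Test → Prop
  | natEq x y => x.eval m = y.eval m
  | natLt x y => x.eval m < y.eval m
  | realEq x y => x.eval m = y.eval m
  | realLt x y => x.eval m < y.eval m
  | not b => ¬ b.Holds m
  | and b c => b.Holds m ∧ c.Holds m

/-- The number of operations in a test. -/
def Test.cost : Test → ℕ
  | natEq x y => x.cost + y.cost + 1
  | natLt x y => x.cost + y.cost + 1
  | realEq x y => x.cost + y.cost + 1
  | realLt x y => x.cost + y.cost + 1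
  | not b => b.cost + 1
  | and b c => b.cost + c.cost + 1

/-- `Exec P m t m'`: started in the memory `m`, the program `P` halts after exactly `t` steps, and
leaves the memory `m'`. -/
inductive Exec : Prog → Memory → ℕ → Memory → Prop where
  | skip (m : Memory) : Exec .skip m 1 m
  | setNat (m : Memory) (a : ℕ) (i j x : NatExpr) :
      Exec (.setNat a i j x) m (i.cost + j.cost + x.cost + 1)
        (m.setNat a (i.eval m) (j.eval m) (x.eval m))
  | setReal (m : Memory) (a : ℕ) (i j : NatExpr) (x : RealExpr) :
      Exec (.setReal a i j x) m (i.cost + j.cost + x.cost + 1)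
        (m.setReal a (i.eval m) (j.eval m) (x.eval m))
  | flip (m : Memory) (a : ℕ) (i j : NatExpr) :
      Exec (.flip a i j) m (i.cost + j.cost + 1)
        (m.dropCoin.setNat a (i.eval m) (j.eval m) (m.coins 0).toNat)
  | seq {P Q : Prog} {m₁ m₂ m₃ : Memory} {s t : ℕ} :
      Exec P m₁ s m₂ → Exec Q m₂ t m₃ → Exec (.seq P Q) m₁ (s + t) m₃
  | iteTrue {b : Test} {P Q : Prog} {m m' : Memory} {t : ℕ} :
      b.Holds m → Exec P m t m' → Exec (.ite b P Q) m (b.cost + 1 + t) m'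
  | iteFalse {b : Test} {P Q : Prog} {m m' : Memory} {t : ℕ} :
      ¬ b.Holds m → Exec Q m t m' → Exec (.ite b P Q) m (b.cost + 1 + t) m'
  | whileTrue {b : Test} {P : Prog} {m₁ m₂ m₃ : Memory} {s t : ℕ} :
      b.Holds m₁ → Exec P m₁ s m₂ → Exec (.while b P) m₂ t m₃ →
        Exec (.while b P) m₁ (b.cost + 1 + s + t) m₃
  | whileFalse {b : Test} {P : Prog} {m : Memory} :
      ¬ b.Holds m → Exec (.while b P) m (b.cost + 1) m

/-- The machine is deterministic once the coin flips are fixed. -/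
theorem Exec.deterministic {P : Prog} {m m₁ m₂ : Memory} {t₁ t₂ : ℕ} (h₁ : Exec P m t₁ m₁)
    (h₂ : Exec P m t₂ m₂) : t₁ = t₂ ∧ m₁ = m₂ := by
  induction h₁ generalizing t₂ m₂ with
  | skip | setNat | setReal | flip => cases h₂; exact ⟨rfl, rfl⟩
  | seq _ _ ih₁ ih₂ =>
    cases h₂ with
    | seq a b =>
      obtain ⟨rfl, rfl⟩ := ih₁ a
      obtain ⟨rfl, rfl⟩ := ih₂ b
      exact ⟨rfl, rfl⟩
  | iteTrue hb _ ih =>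
    cases h₂ with
    | iteTrue _ a => obtain ⟨rfl, rfl⟩ := ih a; exact ⟨rfl, rfl⟩
    | iteFalse hb' _ => exact absurd hb hb'
  | iteFalse hb _ ih =>
    cases h₂ with
    | iteTrue hb' _ => exact absurd hb' hb
    | iteFalse _ a => obtain ⟨rfl, rfl⟩ := ih a; exact ⟨rfl, rfl⟩
  | whileTrue hb _ _ ih₁ ih₂ =>
    cases h₂ with
    | whileTrue _ a b =>
      obtain ⟨rfl, rfl⟩ := ih₁ a
      obtain ⟨rfl, rfl⟩ := ih₂ b
      exact ⟨rfl, rfl⟩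
    | whileFalse hb' => exact absurd hb hb'
  | whileFalse hb =>
    cases h₂ with
    | whileTrue hb' _ _ => exact absurd hb' hb
    | whileFalse _ => exact ⟨rfl, rfl⟩

/-- The probability of the event `E` over `N` independent fair coin flips. (A program that runs for
at most `N` steps never looks at the later entries of the stream, which are set to `false`.) -/
noncomputable def coinProb (N : ℕ) (E : (ℕ → Bool) → Prop) : ℝ :=
  open Classical in
  ((Finset.univ.filter (fun r : Fin N → Bool =>
    E (fun i => if h : i < N then r ⟨i, h⟩ else false))).card : ℝ) / 2 ^ N

end RealRAM

/-! ## Input and output of Cayley graph sparsification -/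

/-- The input memory for the group `G`, listed in the order `e`, and for `S`, `w`, `ε`.
Natural-number array `0` holds `|G|` in the cell `(0, 0)`, array `1` holds the multiplication table
of `G`, and array `2` the indicator of `S`; real array `0` holds the weights on `S`, and array `1`
holds `ε` in the cell `(0, 0)`. All other cells are zero. -/
noncomputable def sparsifyInput {G : Type*} [Group G] [Fintype G] (e : G ≃ Fin (Fintype.card G))
    (S : Finset G) (w : G → ℝ) (ε : ℝ) (coins : ℕ → Bool) : RealRAM.Memory :=
  open Classical in
  { nat := fun a i j =>
      if a = 0 ∧ i = 0 ∧ j = 0 then Fintype.card G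
      else if a = 1 then
        if h : i < Fintype.card G ∧ j < Fintype.card G then
          (e (e.symm ⟨i, h.1⟩ * e.symm ⟨j, h.2⟩) : ℕ) else 0
      else if a = 2 ∧ j = 0 then
        if h : i < Fintype.card G then (if e.symm ⟨i, h⟩ ∈ S then 1 else 0) else 0
      else 0
    real := fun a i j =>
      if a = 0 ∧ j = 0 then
        if h : i < Fintype.card G then
          (if e.symm ⟨i, h⟩ ∈ S then w (e.symm ⟨i, h⟩) else 0) else 0
      else if a = 1 ∧ i = 0 ∧ j = 0 then ε
      else 0
    coins := coins }

/-- The output set of generators: its indicator is read off the natural-number array `3`. -/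
noncomputable def outputGens {G : Type*} [Fintype G] (e : G ≃ Fin (Fintype.card G))
    (m : RealRAM.Memory) : Finset G :=
  open Classical in Finset.univ.filter (fun g => m.nat 3 (e g) 0 = 1)

/-- The output weights are read off the real array `2`. -/
def outputWeight {G : Type*} [Fintype G] (e : G ≃ Fin (Fintype.card G)) (m : RealRAM.Memory)
    (g : G) : ℝ :=
  m.real 2 (e g) 0

/-! For `x : G → ℝ` put ℓ(g) = ‖x − x(· g)‖₂. This is a length function on the group, and when `x`
is the indicator of `T` the cut is half of ∑ w(s) ℓ(s)² (`cutSize_Cay`). The sparsifier keeps every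
generator s independently with probability 2^(−a(s)) and multiplies the weight of a kept one by
2^a(s). This works if the share of each s in ∑ w ℓ² is small compared to its probability, uniformly
in ℓ.

Such bounds come from greedy levels. To fill a level, start from a one-point set P, repeatedly take
the heaviest remaining generator s for which P s is disjoint from P, and replace P by P ∪ P s. As P
doubles, a level has at most K = ⌈log₂|G|⌉ members. In the end every remaining s is p⁻¹p' with p, p'
in P. At the moment when this first happens, all members b of the level are at least as heavy as s
and ℓ(s) ≤ 2 ∑ ℓ(b), so Cauchy–Schwarz gives w(s) ℓ(s)² ≤ 4K ∑ w(b) ℓ(b)² (`LevelFilling.step`). A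
generator of level i is dominated in this way by i − 1 disjoint levels, so its share is at most
4K/(i − 1) (`LevelsFilled.sub_one_mul_le`). Probabilities of order K²/(ε² i) then suffice. With K
generators per level their sum is harmonic, of order log⁴|G|/ε² (`LevelsFilled.sum_half_pow_le`).

Concentration is a matrix statement. After the regularized Laplacian is normalized to the identity,
the sampling error is a sum of independent centred matrices. Its trace moments are bounded by
exchangeable pairs and a mean value inequality for traces (`trace_sub_mul_pow_sub_pow_le`,
`sum_trace_pow_le`), which controls all quadratic forms, hence all cuts, at once
(`card_not_isCutSparsifier_le`). An exponential moment bounds the number of kept generators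
(`card_sampledGens_gt_le`).

The levels are computed in polynomial time without coins, and fair coins realize the dyadic
probabilities exactly. So the success probability is a count of bit strings (`exists_exec_sparsify`,
`le_coinProb`). -/

open Matrix Finset

/-! ### A mean value inequality for traces of odd powers. -/

/-- Joint traces of powers of two symmetric matrices are mixed moments of a nonnegative weight on
the pairs of their eigenvalues. -/
theorem exists_mixedMoments_trace {n : Type*} [Fintype n] [DecidableEq n] {A B : Matrix n n ℝ}
    (hA : A.IsHermitian) (hB : B.IsHermitian) :
    ∃ (x y : n → ℝ) (o : n → n → ℝ), (∀ i j, 0 ≤ o i j) ∧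
      ∀ a b : ℕ, (A ^ a * B ^ b).trace = ∑ i, ∑ j, o i j * (x i ^ a * y j ^ b) := by
  have key : ∀ {M : Matrix n n ℝ} (hM : M.IsHermitian), ∃ (U : Matrix n n ℝ) (x : n → ℝ),
      ∀ a : ℕ, M ^ a = U * diagonal (fun i => x i ^ a) * Uᵀ := by
    intro M hM
    refine ⟨hM.eigenvectorUnitary, hM.eigenvalues, fun a => ?_⟩
    conv_lhs => rw [hM.spectral_theorem, ← map_pow, Unitary.conjStarAlgAut_apply, diagonal_pow]
    rfl
  obtain ⟨U, x, hU⟩ := key hA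
  obtain ⟨V, y, hV⟩ := key hB
  -- The weight of a pair of eigenvalues is the squared inner product of their eigenvectors.
  refine ⟨x, y, fun i j => ((Vᵀ * U) j i) ^ 2, fun i j => sq_nonneg _, fun a b => ?_⟩
  rw [hU, hV]
  have : (U * diagonal (fun i => x i ^ a) * Uᵀ * (V * diagonal (fun i => y i ^ b) * Vᵀ)).trace
      = (diagonal (fun i => x i ^ a) * (Vᵀ * U)ᵀ * (diagonal (fun i => y i ^ b) * (Vᵀ * U))).trace := by
    rw [show U * diagonal (fun i => x i ^ a) * Uᵀ * (V * diagonal (fun i => y i ^ b) * Vᵀ)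
      = U * (diagonal (fun i => x i ^ a) * Uᵀ * (V * diagonal (fun i => y i ^ b) * Vᵀ)) by
        simp only [Matrix.mul_assoc], trace_mul_comm]
    simp only [transpose_mul, transpose_transpose, Matrix.mul_assoc]
  rw [this, trace]
  refine Finset.sum_congr rfl fun i _ => ?_
  rw [diag_apply, mul_apply]
  refine Finset.sum_congr rfl fun j _ => ?_
  rw [diagonal_mul, diagonal_mul, transpose_apply]
  ring

/-- Factor x^m − y^m by the geometric sum and pair the exponent q with m − 1 − q. Each pair is at
most x^(m−1) + y^(m−1), because |x|^q − |y|^q and |x|^(m−1−q) − |y|^(m−1−q) have the same sign. -/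
theorem Odd.sub_mul_pow_sub_pow_le {m : ℕ} (hm : Odd m) (x y : ℝ) :
    (x - y) * (x ^ m - y ^ m) ≤ m / 2 * ((x - y) ^ 2 * (x ^ (m - 1) + y ^ (m - 1))) := by
  obtain ⟨r, rfl⟩ := hm
  have hpair : ∀ q ∈ range (2 * r + 1), x ^ q * y ^ (2 * r - q) + x ^ (2 * r - q) * y ^ q
      ≤ x ^ (2 * r) + y ^ (2 * r) := by
    intro q hq
    have hq' : q ≤ 2 * r := by have := mem_range.1 hq; omega
    have h1 : ∀ z : ℝ, z ^ (2 * r) = |z| ^ (2 * r) := fun z => by rw [pow_mul, pow_mul, sq_abs]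
    have h2 : x ^ q * y ^ (2 * r - q) + x ^ (2 * r - q) * y ^ q
        ≤ |x| ^ q * |y| ^ (2 * r - q) + |x| ^ (2 * r - q) * |y| ^ q := by
      refine (le_abs_self _).trans ((abs_add_le _ _).trans (le_of_eq ?_))
      simp [abs_mul, abs_pow]
    have h3 : 0 ≤ (|x| ^ q - |y| ^ q) * (|x| ^ (2 * r - q) - |y| ^ (2 * r - q)) := by
      rcases le_total |x| |y| with h | h
      · exact mul_nonneg_of_nonpos_of_nonpos
          (sub_nonpos.2 (pow_le_pow_left₀ (abs_nonneg _) h _))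
          (sub_nonpos.2 (pow_le_pow_left₀ (abs_nonneg _) h _))
      · exact mul_nonneg (sub_nonneg.2 (pow_le_pow_left₀ (abs_nonneg _) h _))
          (sub_nonneg.2 (pow_le_pow_left₀ (abs_nonneg _) h _))
    have h4 : ∀ z : ℝ, |z| ^ q * |z| ^ (2 * r - q) = |z| ^ (2 * r) := fun z => by
      rw [← pow_add]; congr 1; omega
    rw [h1 x, h1 y]
    nlinarith [h4 x, h4 y]
  have hgeom : (∑ q ∈ range (2 * r + 1), x ^ q * y ^ (2 * r - q)) * (x - y)
      = x ^ (2 * r + 1) - y ^ (2 * r + 1) := by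
    have := (Commute.all x y).geom_sum₂_mul (2 * r + 1)
    simpa using this
  have hrefl : ∑ q ∈ range (2 * r + 1), x ^ (2 * r - q) * y ^ q
      = ∑ q ∈ range (2 * r + 1), x ^ q * y ^ (2 * r - q) := by
    rw [← sum_range_reflect]
    refine sum_congr rfl fun q hq => ?_
    have := mem_range.1 hq
    rw [show 2 * r - (2 * r + 1 - 1 - q) = q by omega,
      show 2 * r + 1 - 1 - q = 2 * r - q by omega]
  have hsum := sum_le_sum hpair
  rw [sum_add_distrib, hrefl, sum_const, card_range, nsmul_eq_mul] at hsum
  rw [← hgeom]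
  simp only [add_tsub_cancel_right]
  have := mul_le_mul_of_nonneg_left hsum (sq_nonneg (x - y))
  push_cast at this ⊢
  have h2 := mul_le_mul_of_nonneg_left this (show (0 : ℝ) ≤ 1 / 2 by norm_num)
  refine le_trans (le_of_eq ?_) (h2.trans (le_of_eq ?_)) <;> ring

/-- Although A and B need not commute, every word that occurs is cyclically equivalent to some A^a
B^b. So both sides are combinations of mixed moments, and the scalar inequality can be averaged over
the pairs of eigenvalues. -/
theorem trace_sub_mul_pow_sub_pow_le {n : Type*} [Fintype n] [DecidableEq n] {A B : Matrix n n ℝ}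
    (hA : A.IsHermitian) (hB : B.IsHermitian) {m : ℕ} (hm : Odd m) :
    ((A - B) * (A ^ m - B ^ m)).trace
      ≤ m / 2 * (((A - B) ^ 2 * A ^ (m - 1)).trace + ((A - B) ^ 2 * B ^ (m - 1)).trace) := by
  obtain ⟨x, y, o, ho, h⟩ := exists_mixedMoments_trace hA hB
  obtain ⟨r, rfl⟩ := hm
  have h' : ∀ a b, (B ^ b * A ^ a).trace = ∑ i, ∑ j, o i j * (x i ^ a * y j ^ b) :=
    fun a b => by rw [trace_mul_comm, h]
  have e1 : ((A - B) * (A ^ (2 * r + 1) - B ^ (2 * r + 1))).trace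
      = (A ^ (2 * r + 2) * B ^ 0).trace - (A ^ 1 * B ^ (2 * r + 1)).trace
        - (B ^ 1 * A ^ (2 * r + 1)).trace + (A ^ 0 * B ^ (2 * r + 2)).trace := by
    rw [← trace_sub, ← trace_sub, ← trace_add]; congr 1
    simp only [pow_succ' A (2 * r + 1), pow_succ' B (2 * r + 1), pow_zero, pow_one]; noncomm_ring
  have expand : ∀ (A B : Matrix n n ℝ), ((A - B) ^ 2 * A ^ (2 * r)).trace
      = (A ^ (2 * r + 2)).trace - 2 * (B ^ 1 * A ^ (2 * r + 1)).trace
        + (B ^ 2 * A ^ (2 * r)).trace := by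
    intro A B
    have h1 : (A * (B * A ^ (2 * r))).trace = (B ^ 1 * A ^ (2 * r + 1)).trace := by
      rw [trace_mul_comm, Matrix.mul_assoc, ← pow_succ, pow_one]
    rw [two_mul (trace _)]
    nth_rw 1 [← h1]
    rw [sub_add_eq_sub_sub, ← trace_sub, ← trace_sub, ← trace_add]
    congr 1
    simp only [pow_succ' A (2 * r + 1), pow_succ' A (2 * r), pow_one]
    noncomm_ring
  have e2 := expand A B
  have e3 := expand B A
  rw [← neg_sub A B, neg_sq] at e3
  have z0 : (A ^ (2 * r + 2)).trace = (A ^ (2 * r + 2) * B ^ 0).trace := by simp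
  have z1 : (B ^ (2 * r + 2)).trace = (A ^ 0 * B ^ (2 * r + 2)).trace := by simp
  rw [z0] at e2
  rw [z1] at e3
  simp only [add_tsub_cancel_right]
  rw [e1, e2, e3]
  simp only [h, h', mul_sum, ← sum_sub_distrib, ← sum_add_distrib]
  refine sum_le_sum fun i _ => sum_le_sum fun j _ => ?_
  have key := mul_le_mul_of_nonneg_left
    (Odd.sub_mul_pow_sub_pow_le (m := 2 * r + 1) ⟨r, rfl⟩ (x i) (y j)) (ho i j)
  simp only [add_tsub_cancel_right] at key
  refine le_trans (le_of_eq ?_) (key.trans (le_of_eq ?_)) <;> ring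

/-- This allows a semidefinite inequality to be multiplied by an even power under the trace. -/
theorem trace_mul_sq_nonneg {n : Type*} [Fintype n] [DecidableEq n] {A W : Matrix n n ℝ}
    (hA : A.PosSemidef) (hW : W.IsHermitian) (p : ℕ) : 0 ≤ (A * W ^ (2 * p)).trace := by
  have h := (hA.conjTranspose_mul_mul_same (W ^ p)).trace_nonneg
  rwa [(hW.pow p).eq, trace_mul_comm, ← Matrix.mul_assoc, ← pow_add, ← two_mul,
    trace_mul_comm] at h

/-! ### Sums of independent random matrices -/

/-- Exchangeability: swapping the coordinate `ω i` with its independent copy `k` is an involution of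
the pairs (ω, k). -/
theorem sum_sum_update {ι κ M : Type*} [Fintype ι] [DecidableEq ι] [Fintype κ] [AddCommMonoid M]
    (i : ι) (g : (ι → κ) → κ → M) :
    ∑ ω : ι → κ, ∑ k, g (Function.update ω i k) (ω i) = ∑ ω : ι → κ, ∑ k, g ω k := by
  classical
  rw [← Fintype.sum_prod_type', ← Fintype.sum_prod_type']
  let e : (ι → κ) × κ → (ι → κ) × κ := fun q => (Function.update q.1 i q.2, q.1 i)
  have he : Function.Involutive e := fun q => by
    ext j <;> simp [e]
  exact Fintype.sum_bijective e he.bijective _ _ fun q => rfl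

section Concentration

variable {ι κ n : Type*} [Fintype ι] [DecidableEq ι] [Fintype κ] [Fintype n] [DecidableEq n]

/-- The exchangeable pair bound for one summand of a sum of independent centred matrices. -/
theorem sum_trace_mul_odd_pow_le {X : ι → κ → Matrix n n ℝ} (hX : ∀ i k, (X i k).IsHermitian)
    (hX0 : ∀ i, ∑ k, X i k = 0) {M : ι → Matrix n n ℝ} {ρ : ℝ}
    (hvar : ∀ i k l, (ρ • (X i k + M i + (X i l + M i)) - (X i k - X i l) ^ 2).PosSemidef)
    (i : ι) (p : ℕ) :
    2 * ∑ ω : ι → κ, (X i (ω i) * (∑ j, X j (ω j)) ^ (2 * p + 1)).trace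
      ≤ (2 * p + 1) * ρ * ∑ ω : ι → κ,
        ((X i (ω i) + (2 : ℝ) • M i) * (∑ j, X j (ω j)) ^ (2 * p)).trace := by
  set Z : (ι → κ) → Matrix n n ℝ := fun ω => ∑ j, X j (ω j) with hZ
  have hZh : ∀ ω, (Z ω).IsHermitian := fun ω => by
    rw [Matrix.IsHermitian, hZ, conjTranspose_sum]; exact sum_congr rfl fun j _ => hX j _
  rcases isEmpty_or_nonempty κ with hκ | hκ
  · have : IsEmpty (ι → κ) := ⟨fun ω => hκ.false (ω i)⟩
    simp
  have hN : (0 : ℝ) < Fintype.card κ := by exact_mod_cast Fintype.card_pos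
  have hdiff : ∀ (ω : ι → κ) k, Z ω - Z (Function.update ω i k) = X i (ω i) - X i k := by
    intro ω k
    simp only [hZ]
    rw [← sum_sub_distrib, sum_eq_single i]
    · simp
    · intro j _ hj; simp [Function.update_of_ne hj]
    · simp
  -- The copy `k` is independent of `Z ω` and `X i` has mean zero, so the average over `k` removes
  -- the second term.
  have h1 : ∑ ω : ι → κ, ∑ k, ((X i (ω i) - X i k) * Z ω ^ (2 * p + 1)).trace
      = Fintype.card κ * ∑ ω : ι → κ, (X i (ω i) * Z ω ^ (2 * p + 1)).trace := by
    rw [mul_sum]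
    refine sum_congr rfl fun ω _ => ?_
    rw [← trace_sum, ← Finset.sum_mul, sum_sub_distrib, hX0, sub_zero, sum_const, card_univ,
      smul_mul_assoc, trace_smul, nsmul_eq_mul]
  have h2 := sum_sum_update i fun (ω : ι → κ) k => ((X i (ω i) - X i k) * Z ω ^ (2 * p + 1)).trace
  have h3 := sum_sum_update i fun (ω : ι → κ) k => ((X i (ω i) - X i k) ^ 2 * Z ω ^ (2 * p)).trace
  simp only [Function.update_self] at h2 h3
  have h4 : ∀ (ω : ι → κ) k, ((X i (ω i) - X i k) * Z ω ^ (2 * p + 1)).trace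
      + ((X i k - X i (ω i)) * Z (Function.update ω i k) ^ (2 * p + 1)).trace
      ≤ (2 * p + 1) / 2 * (((X i (ω i) - X i k) ^ 2 * Z ω ^ (2 * p)).trace
        + ((X i k - X i (ω i)) ^ 2 * Z (Function.update ω i k) ^ (2 * p)).trace) := by
    intro ω k
    have := trace_sub_mul_pow_sub_pow_le (hZh ω) (hZh (Function.update ω i k))
      (m := 2 * p + 1) ⟨p, rfl⟩
    rw [hdiff, Matrix.mul_sub, trace_sub, add_tsub_cancel_right] at this
    rw [← neg_sub (X i (ω i)) (X i k), neg_sq, Matrix.neg_mul, trace_neg, ← sub_eq_add_neg]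
    exact_mod_cast this
  have h5 := sum_le_sum fun (ω : ι → κ) (_ : ω ∈ univ) => sum_le_sum fun (k : κ) (_ : k ∈ univ) =>
    h4 ω k
  simp only [sum_add_distrib, ← mul_sum] at h5
  -- By exchangeability the two terms on either side of the mean value inequality have equal sums.
  rw [h2, h3, h1] at h5
  have h6 : ∑ ω : ι → κ, ∑ k, ((X i (ω i) - X i k) ^ 2 * Z ω ^ (2 * p)).trace
      ≤ ∑ ω : ι → κ, ∑ k, (ρ • (X i (ω i) + M i + (X i k + M i)) * Z ω ^ (2 * p)).trace := by
    refine sum_le_sum fun ω _ => sum_le_sum fun k _ => ?_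
    have := trace_mul_sq_nonneg (hvar i (ω i) k) (hZh ω) p
    rw [Matrix.sub_mul, trace_sub] at this
    linarith
  have h7 : ∑ ω : ι → κ, ∑ k, (ρ • (X i (ω i) + M i + (X i k + M i)) * Z ω ^ (2 * p)).trace
      = Fintype.card κ * (ρ * ∑ ω : ι → κ, ((X i (ω i) + (2 : ℝ) • M i) * Z ω ^ (2 * p)).trace) := by
    rw [mul_sum, mul_sum]
    refine sum_congr rfl fun ω _ => ?_
    rw [← trace_sum, ← Finset.sum_mul, ← smul_sum, sum_add_distrib, sum_add_distrib (f := X i), hX0,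
      zero_add, sum_const, sum_const, card_univ, ← smul_add, smul_mul_assoc, smul_mul_assoc,
      trace_smul, trace_smul, smul_eq_mul, nsmul_eq_mul, add_assoc, ← two_smul ℝ (M i)]
    ring
  rw [h7] at h6
  have h8 : (0 : ℝ) ≤ 2 * p + 1 := by positivity
  have h9 := mul_le_mul_of_nonneg_left h6 h8
  refine le_of_mul_le_mul_left ?_ hN
  rw [← two_mul, ← two_mul, ← mul_assoc ((2 * p + 1) / 2 : ℝ), div_mul_cancel₀ _ (two_ne_zero' ℝ)] at h5
  calc _ = 2 * (Fintype.card κ * ∑ ω : ι → κ, (X i (ω i) * Z ω ^ (2 * p + 1)).trace) := by ring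
    _ ≤ _ := h5
    _ ≤ _ := h9
    _ = _ := by ring

/-- One step of the moment recursion for a sum of independent centred matrices. -/
theorem sum_trace_pow_step {X : ι → κ → Matrix n n ℝ} (hX : ∀ i k, (X i k).IsHermitian)
    (hX0 : ∀ i, ∑ k, X i k = 0) {M : ι → Matrix n n ℝ} {ρ : ℝ} (hρ : 0 ≤ ρ)
    (hvar : ∀ i k l, (ρ • (X i k + M i + (X i l + M i)) - (X i k - X i l) ^ 2).PosSemidef)
    (hM : (1 - ∑ i, M i).PosSemidef) (p : ℕ) (hp : (p + 1) * ρ ≤ 1) :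
    ∑ ω : ι → κ, ((∑ j, X j (ω j)) ^ (2 * (p + 1))).trace
      ≤ 5 * (p + 1) * ρ * ∑ ω : ι → κ, ((∑ j, X j (ω j)) ^ (2 * p)).trace := by
  have h := sum_le_sum fun i (_ : i ∈ univ) => sum_trace_mul_odd_pow_le hX hX0 hvar i p
  set Z : (ι → κ) → Matrix n n ℝ := fun ω => ∑ j, X j (ω j) with hZ
  have hZh : ∀ ω, (Z ω).IsHermitian := fun ω => by
    rw [Matrix.IsHermitian, hZ, conjTranspose_sum]; exact sum_congr rfl fun j _ => hX j _
  rw [← mul_sum, ← mul_sum, sum_comm] at h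
  nth_rw 2 [sum_comm] at h
  simp only [← trace_sum, ← Finset.sum_mul, sum_add_distrib, ← smul_sum] at h
  have e1 : ∀ ω, (∑ i, X i (ω i)) = Z ω := fun ω => rfl
  simp only [trace_sum, e1] at h ⊢
  simp only [← pow_succ', Matrix.add_mul, trace_add, smul_mul_assoc, trace_smul,
    sum_add_distrib, smul_eq_mul, ← mul_sum] at h
  have hM' : ∑ ω, ((∑ i, M i) * Z ω ^ (2 * p)).trace ≤ ∑ ω, (Z ω ^ (2 * p)).trace := by
    refine sum_le_sum fun ω _ => ?_
    have := trace_mul_sq_nonneg hM (hZh ω) p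
    rw [Matrix.sub_mul, trace_sub, Matrix.one_mul] at this
    linarith
  -- The matrix form of 2z ≤ z² + 1, multiplied by the even power z^(2p).
  have hodd : 2 * ∑ ω, (Z ω ^ (2 * p + 1)).trace
      ≤ ∑ ω, (Z ω ^ (2 * (p + 1))).trace + ∑ ω, (Z ω ^ (2 * p)).trace := by
    rw [mul_sum, ← sum_add_distrib]
    refine sum_le_sum fun ω _ => ?_
    have hh : (Z ω - 1)ᴴ = Z ω - 1 := by rw [conjTranspose_sub, (hZh ω).eq, conjTranspose_one]
    have h1 : ((Z ω - 1) ^ 2).PosSemidef := by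
      have := posSemidef_conjTranspose_mul_self (Z ω - 1)
      rwa [hh, ← sq] at this
    have := trace_mul_sq_nonneg h1 (hZh ω) p
    have e3 : (Z ω - 1) ^ 2 * Z ω ^ (2 * p) = Z ω ^ (2 * (p + 1)) - Z ω ^ (2 * p + 1)
        - Z ω ^ (2 * p + 1) + Z ω ^ (2 * p) := by
      rw [show 2 * (p + 1) = 2 * p + 1 + 1 by ring, pow_succ' _ (2 * p + 1), pow_succ' _ (2 * p)]
      noncomm_ring
    rw [e3] at this
    rw [trace_add, trace_sub, trace_sub] at this
    linarith
  have hpos : ∀ q, 0 ≤ ∑ ω, (Z ω ^ (2 * q)).trace := fun q => sum_nonneg fun ω _ => by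
    have := trace_mul_sq_nonneg PosSemidef.one (hZh ω) q
    rwa [Matrix.one_mul] at this
  have h0 := hpos p
  have h2 := hpos (p + 1)
  rw [show 2 * p + 1 + 1 = 2 * (p + 1) by ring] at h
  -- The bounds give 2(F1 + 2G) ≤ F2 + 5 F0, which is the source of the 5. Since (p + 1) ρ ≤ 1, the
  -- term with F2 is absorbed on the left.
  have arith : ∀ F0 F1 F2 G : ℝ, 0 ≤ F0 → 0 ≤ F2 → G ≤ F0 → 2 * F1 ≤ F2 + F0 →
      2 * F2 ≤ (2 * p + 1) * ρ * (F1 + 2 * G) → F2 ≤ 5 * (p + 1) * ρ * F0 := by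
    intro F0 F1 F2 G h0 h2 hG h1 h
    have hc : (2 * p + 1) * ρ ≤ 2 * ((p + 1) * ρ) := by nlinarith
    have hc0 : 0 ≤ (2 * p + 1) * ρ := by positivity
    have h3 := mul_le_mul_of_nonneg_left (show 2 * (F1 + 2 * G) ≤ F2 + 5 * F0 by linarith) hc0
    have h4 := mul_le_mul_of_nonneg_right hc (show 0 ≤ F2 + 5 * F0 by positivity)
    have h5 := mul_le_mul_of_nonneg_right hp h2
    linarith
  exact arith _ _ _ _ h0 h2 hM' hodd h

/-- The moment bound for a sum of independent centred matrices. -/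
theorem sum_trace_pow_le {X : ι → κ → Matrix n n ℝ} (hX : ∀ i k, (X i k).IsHermitian)
    (hX0 : ∀ i, ∑ k, X i k = 0) {M : ι → Matrix n n ℝ} {ρ : ℝ} (hρ : 0 ≤ ρ)
    (hvar : ∀ i k l, (ρ • (X i k + M i + (X i l + M i)) - (X i k - X i l) ^ 2).PosSemidef)
    (hM : (1 - ∑ i, M i).PosSemidef) (q : ℕ) (hq : q * ρ ≤ 1) :
    ∑ ω : ι → κ, ((∑ j, X j (ω j)) ^ (2 * q)).trace
      ≤ (5 * q * ρ) ^ q * (Fintype.card n * Fintype.card (ι → κ)) := by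
  have main : ∀ p ≤ q, ∑ ω : ι → κ, ((∑ j, X j (ω j)) ^ (2 * p)).trace
      ≤ (5 * q * ρ) ^ p * (Fintype.card n * Fintype.card (ι → κ)) := by
    intro p
    induction p with
    | zero => intro _; simp [mul_comm]
    | succ p ih =>
      intro hp
      have hpq : (p + 1 : ℝ) ≤ q := by exact_mod_cast hp
      refine (sum_trace_pow_step hX hX0 hρ hvar hM p (le_trans (by gcongr) hq)).trans ?_
      rw [pow_succ', mul_assoc ((5 : ℝ) * q * ρ)]
      have := ih (by omega)
      have h0 : 0 ≤ (5 * q * ρ) ^ p * (Fintype.card n * Fintype.card (ι → κ) : ℝ) := by positivity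
      calc _ ≤ 5 * (p + 1) * ρ * ((5 * q * ρ) ^ p * (Fintype.card n * Fintype.card (ι → κ))) := by
            gcongr
        _ ≤ _ := by gcongr
  exact main q le_rfl

/-- A quadratic form is bounded by the trace of an even power. -/
theorem abs_dotProduct_mulVec_le_of_trace_pow_le {A : Matrix n n ℝ} (hA : A.IsHermitian) {q : ℕ}
    (hq : q ≠ 0) {r : ℝ} (hr : 0 ≤ r) (h : (A ^ (2 * q)).trace ≤ r ^ (2 * q)) (x : n → ℝ) :
    |x ⬝ᵥ A *ᵥ x| ≤ r * (x ⬝ᵥ x) := by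
  have hev : ∀ i, |hA.eigenvalues i| ≤ r := by
    intro i
    have h1 : (A ^ (2 * q)).trace = ∑ j, hA.eigenvalues j ^ (2 * q) := by
      conv_lhs => rw [hA.spectral_theorem, ← map_pow, Unitary.conjStarAlgAut_apply, diagonal_pow,
        trace_mul_cycle, Unitary.coe_star_mul_self, Matrix.one_mul]
      simp [trace]
    have h2 : hA.eigenvalues i ^ (2 * q) ≤ r ^ (2 * q) := by
      refine le_trans ?_ (h1 ▸ h)
      exact single_le_sum (f := fun j => hA.eigenvalues j ^ (2 * q))
        (fun j _ => (even_two_mul q).pow_nonneg _) (mem_univ i)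
    rw [← (even_two_mul q).pow_abs] at h2
    exact le_of_pow_le_pow_left₀ (by omega) hr h2
  set U : Matrix n n ℝ := (hA.eigenvectorUnitary : Matrix n n ℝ)
  have hU : U * Uᵀ = 1 := Unitary.coe_mul_star_self hA.eigenvectorUnitary
  have hquad : ∀ d : n → ℝ, x ⬝ᵥ (U * diagonal d * Uᵀ) *ᵥ x = ∑ i, d i * ((Uᵀ *ᵥ x) i) ^ 2 := by
    intro d
    rw [← mulVec_mulVec, ← mulVec_mulVec, dotProduct_mulVec, ← mulVec_transpose]
    simp only [dotProduct, mulVec_diagonal]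
    exact sum_congr rfl fun i _ => by ring
  have e1 : x ⬝ᵥ A *ᵥ x = ∑ i, hA.eigenvalues i * ((Uᵀ *ᵥ x) i) ^ 2 := by
    rw [← hquad]
    congr 2
    conv_lhs => rw [hA.spectral_theorem, Unitary.conjStarAlgAut_apply]
    rfl
  have e2 : x ⬝ᵥ x = ∑ i, ((Uᵀ *ᵥ x) i) ^ 2 := by
    have := hquad 1
    rw [show (diagonal (1 : n → ℝ)) = 1 from diagonal_one, Matrix.mul_one, hU, one_mulVec] at this
    simpa using this
  rw [e1, e2, mul_sum]
  refine (abs_sum_le_sum_abs _ _).trans (sum_le_sum fun i _ => ?_)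
  rw [abs_mul, abs_of_nonneg (sq_nonneg ((Uᵀ *ᵥ x) i))]
  exact mul_le_mul_of_nonneg_right (hev i) (sq_nonneg _)

/-- Matrix concentration: all but a small fraction of the outcomes have small quadratic forms. -/
theorem card_exists_quadraticForm_lt_le {X : ι → κ → Matrix n n ℝ}
    (hX : ∀ i k, (X i k).IsHermitian)
    (hX0 : ∀ i, ∑ k, X i k = 0) {M : ι → Matrix n n ℝ} {ρ : ℝ} (hρ : 0 ≤ ρ)
    (hvar : ∀ i k l, (ρ • (X i k + M i + (X i l + M i)) - (X i k - X i l) ^ 2).PosSemidef)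
    (hM : (1 - ∑ i, M i).PosSemidef) {q : ℕ} (hq0 : q ≠ 0) (hq : q * ρ ≤ 1) {r : ℝ} (hr : 0 < r)
    {s : Finset (ι → κ)}
    (hs : ∀ ω ∈ s, ∃ x : n → ℝ, r * (x ⬝ᵥ x) < |x ⬝ᵥ (∑ j, X j (ω j)) *ᵥ x|) :
    (s.card : ℝ) ≤ (5 * q * ρ / r ^ 2) ^ q * (Fintype.card n * Fintype.card (ι → κ)) := by
  have hZh : ∀ ω : ι → κ, (∑ j, X j (ω j)).IsHermitian := fun ω => by
    rw [Matrix.IsHermitian, conjTranspose_sum]; exact sum_congr rfl fun j _ => hX j _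
  -- Markov's inequality for the trace of the power 2q.
  have h1 : s.card * r ^ (2 * q) ≤ ∑ ω : ι → κ, ((∑ j, X j (ω j)) ^ (2 * q)).trace := by
    calc s.card * r ^ (2 * q) = ∑ ω ∈ s, r ^ (2 * q) := by rw [sum_const, nsmul_eq_mul]
      _ ≤ ∑ ω ∈ s, ((∑ j, X j (ω j)) ^ (2 * q)).trace := by
        refine sum_le_sum fun ω hω => ?_
        by_contra hlt
        obtain ⟨x, hx⟩ := hs ω hω
        exact absurd hx (not_lt.2
          (abs_dotProduct_mulVec_le_of_trace_pow_le (hZh ω) hq0 hr.le (not_le.1 hlt).le x))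
      _ ≤ _ := by
        refine sum_le_sum_of_subset_of_nonneg (subset_univ _) fun ω _ _ => ?_
        have := trace_mul_sq_nonneg PosSemidef.one (hZh ω) q
        rwa [Matrix.one_mul] at this
  have h2 := h1.trans (sum_trace_pow_le hX hX0 hρ hvar hM q hq)
  have h3 : 0 < r ^ (2 * q) := by positivity
  rw [div_pow, ← pow_mul, div_mul_eq_mul_div, le_div_iff₀ h3]
  exact h2

end Concentration

/-! ### Length functions and cuts of Cayley graphs -/

/-- A length function on a group: nonnegative, symmetric, subadditive, and zero at the identity. -/
structure IsLengthFunction {G : Type*} [Group G] (ℓ : G → ℝ) : Prop where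
  one : ℓ 1 = 0
  nonneg : ∀ g, 0 ≤ ℓ g
  inv : ∀ g, ℓ g⁻¹ = ℓ g
  mul_le : ∀ g h, ℓ (g * h) ≤ ℓ g + ℓ h

/-- The `ℓ²`-distance between `x` and its right translate by `g`. -/
noncomputable def translationLength {G : Type*} [Group G] [Fintype G] (x : G → ℝ) (g : G) : ℝ :=
  √(∑ u, (x u - x (u * g)) ^ 2)

theorem translationLength_sq {G : Type*} [Group G] [Fintype G] (x : G → ℝ) (g : G) :
    translationLength x g ^ 2 = ∑ u, (x u - x (u * g)) ^ 2 :=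
  Real.sq_sqrt (sum_nonneg fun _ _ => sq_nonneg _)

/-- Subadditivity is the triangle inequality for x(u) − x(ugh) = (x(u) − x(ug)) + (x(ug) − x(ugh));
the shift by g does not change the norm of the second part. -/
theorem isLengthFunction_translationLength {G : Type*} [Group G] [Fintype G] (x : G → ℝ) :
    IsLengthFunction (translationLength x) where
  one := by simp [translationLength]
  nonneg g := Real.sqrt_nonneg _
  inv g := by
    unfold translationLength
    congr 1
    refine Fintype.sum_equiv (Equiv.mulRight g⁻¹) _ _ fun u => ?_
    simp only [Equiv.coe_mulRight, inv_mul_cancel_right]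
    ring
  mul_le g h := by
    have key : ∀ g, translationLength x g
        = ‖(WithLp.toLp 2 (fun u => x u - x (u * g)) : EuclideanSpace ℝ G)‖ := fun g => by
      simp [translationLength, EuclideanSpace.norm_eq]
    have hshift : translationLength x h
        = ‖(WithLp.toLp 2 (fun u => x (u * g) - x (u * g * h)) : EuclideanSpace ℝ G)‖ := by
      simp only [translationLength, EuclideanSpace.norm_eq, Real.norm_eq_abs, sq_abs]
      congr 1
      exact (Fintype.sum_equiv (Equiv.mulRight g) _ _ fun u => rfl).symm
    rw [key (g * h), key g, hshift]
    refine le_trans (le_of_eq ?_) (norm_add_le _ _)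
    congr 1
    ext u
    simp [mul_assoc]

/-- The size of a cut in a Cayley graph is half the weighted sum of the squared translation lengths
of the indicator function of the cut. -/
theorem cutSize_Cay {G : Type*} [Group G] [Fintype G] (S : Finset G) (w : G → ℝ) (T : Set G) :
    (Cay S w).cutSize T = (∑ s ∈ S, w s * translationLength (T.indicator 1) s ^ 2) / 2 := by
  classical
  -- Right multiplication by `s` is a permutation, so as many edges with the label `s` enter `T` as
  -- leave it. This explains the factor 2 for directed graphs.
  have h1 : ∀ s, translationLength (T.indicator 1) s ^ 2
      = 2 * ∑ u, if u ∈ T ∧ u * s ∉ T then (1 : ℝ) else 0 := by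
    intro s
    have h2 : ∑ u, T.indicator (1 : G → ℝ) (u * s) = ∑ u, T.indicator (1 : G → ℝ) u :=
      Fintype.sum_equiv (Equiv.mulRight s) _ _ fun u => rfl
    rw [translationLength_sq, mul_sum, ← sub_eq_zero, ← sum_sub_distrib]
    rw [← sub_eq_zero, ← sum_sub_distrib] at h2
    refine Eq.trans (sum_congr rfl fun u _ => ?_) h2
    by_cases hu : u ∈ T <;> by_cases hv : u * s ∈ T <;> norm_num [hu, hv]
  unfold WeightedDigraph.cutSize Cay
  simp only [h1, sum_filter]
  rw [Fintype.sum_prod_type]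
  have h3 : ∀ u : G, ∑ v, (if u ∈ T ∧ v ∉ T ∧ u⁻¹ * v ∈ S then w (u⁻¹ * v) else 0)
      = ∑ s ∈ S, w s * (if u ∈ T ∧ u * s ∉ T then (1 : ℝ) else 0) := by
    intro u
    rw [← Fintype.sum_equiv (Equiv.mulLeft u) (fun s => if u ∈ T ∧ u * s ∉ T ∧ s ∈ S then w s else 0)
      _ fun s => by simp]
    rw [← sum_filter_add_sum_filter_not univ (· ∈ S), add_eq_left.2, filter_mem_eq_inter,
      univ_inter]
    · exact sum_congr rfl fun s hs => by simp [hs]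
    · exact sum_eq_zero fun s hs => by simp [(mem_filter.1 hs).2]
  rw [sum_congr rfl fun u _ => h3 u, sum_comm, sum_div]
  refine sum_congr rfl fun s _ => ?_
  rw [← mul_sum]
  ring

/-- The matrix of the quadratic form `x ↦ translationLength x g ^ 2`. -/
def translationMatrix {G : Type*} [Group G] [Fintype G] [DecidableEq G] (g : G) : Matrix G G ℝ :=
  (1 - of fun u v => if v = u * g then 1 else 0)ᵀ * (1 - of fun u v => if v = u * g then 1 else 0)

theorem translationMatrix_posSemidef {G : Type*} [Group G] [Fintype G] [DecidableEq G] (g : G) :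
    (translationMatrix g).PosSemidef :=
  posSemidef_conjTranspose_mul_self _

theorem dotProduct_translationMatrix {G : Type*} [Group G] [Fintype G] [DecidableEq G] (g : G)
    (x : G → ℝ) : x ⬝ᵥ translationMatrix g *ᵥ x = translationLength x g ^ 2 := by
  rw [translationMatrix, ← mulVec_mulVec, dotProduct_mulVec, vecMul_transpose, translationLength_sq]
  simp only [dotProduct, sub_mulVec, one_mulVec]
  refine sum_congr rfl fun u _ => ?_
  rw [← sq]
  congr 2
  simp [mulVec, dotProduct]

theorem exists_pos_le_of_pos {α : Type*} [Finite α] (f : α → ℝ) :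
    ∃ δ > 0, ∀ a, 0 < f a → δ ≤ f a := by
  have h : ∀ᶠ δ in nhdsWithin (0 : ℝ) (Set.Ioi 0), ∀ a, 0 < f a → δ ≤ f a := by
    refine Filter.eventually_all.2 fun a => ?_
    by_cases ha : 0 < f a
    · filter_upwards [Ioo_mem_nhdsGT ha] with δ hδ _ using hδ.2.le
    · exact Filter.Eventually.of_forall fun δ h => absurd h ha
  obtain ⟨δ, h1, h2⟩ := (h.and self_mem_nhdsWithin).exists
  exact ⟨δ, h2, h1⟩

/-! ### Independent sampling with dyadic probabilities -/

/-- The event, of probability `2 ^ (-a)`, that the first `a` of `L` coins show `false`. -/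
def FirstCoinsFalse {L : ℕ} (a : ℕ) (k : Fin L → Bool) : Prop := ∀ l : Fin L, (l : ℕ) < a → k l = false

instance {L : ℕ} (a : ℕ) (k : Fin L → Bool) : Decidable (FirstCoinsFalse a k) :=
  inferInstanceAs (Decidable (∀ _, _))

/-- The reweighted indicator of being kept has mean 1, so the sampled Laplacian is unbiased. The
indicator is a product over the coins, and each coin contributes the factor 2. -/
theorem sum_ite_firstCoinsFalse {L a : ℕ} (ha : a ≤ L) :
    ∑ k : Fin L → Bool, (if FirstCoinsFalse a k then (2 : ℝ) ^ a else 0) = 2 ^ L := by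
  have h1 : ∀ k : Fin L → Bool, (if FirstCoinsFalse a k then (2 : ℝ) ^ a else 0)
      = ∏ l : Fin L, (if (l : ℕ) < a then (if k l then 0 else 2) else 1) := by
    intro k
    by_cases hk : FirstCoinsFalse a k
    · rw [if_pos hk]
      have : ∀ l : Fin L, (if (l : ℕ) < a then (if k l then 0 else 2) else (1 : ℝ))
          = if (l : ℕ) < a then 2 else 1 := fun l => by
        by_cases hl : (l : ℕ) < a
        · simp [hl, hk l hl]
        · simp [hl]
      rw [prod_congr rfl fun l _ => this l, prod_ite, prod_const, prod_const_one, mul_one]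
      congr 1
      rw [Fin.card_filter_val_lt, min_eq_right ha]
    · rw [if_neg hk]
      unfold FirstCoinsFalse at hk
      push Not at hk
      obtain ⟨l, hl, hkl⟩ := hk
      refine (prod_eq_zero (mem_univ l) ?_).symm
      simp [hl, hkl]
  rw [sum_congr rfl fun k _ => h1 k,
    ← Fintype.prod_sum fun (l : Fin L) (b : Bool) =>
      if (l : ℕ) < a then (if b then (0 : ℝ) else 2) else 1]
  have : ∀ l : Fin L, ∑ b : Bool, (if (l : ℕ) < a then (if b then (0 : ℝ) else 2) else 1) = 2 := by
    intro l
    by_cases hl : (l : ℕ) < a <;> norm_num [hl]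
  simp


/-! ### Sampling the generators of a Cayley graph -/

/-- For 0 ≤ B ≤ β, the identity β(βB − B²) = B(β − B)B + (β − B)B(β − B) exhibits a sum of
conjugates of positive semidefinite matrices. -/
theorem Matrix.PosSemidef.smul_sub_sq {n : Type*} [Fintype n] [DecidableEq n] {B : Matrix n n ℝ}
    (hB : B.PosSemidef) {β : ℝ} (hβ : 0 < β) (h : (β • 1 - B).PosSemidef) :
    (β • B - B ^ 2).PosSemidef := by
  have h1 := (h.conjTranspose_mul_mul_same B).add (hB.conjTranspose_mul_mul_same (β • 1 - B))
  rw [hB.1.eq, h.1.eq] at h1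
  have h2 := h1.smul (inv_nonneg.2 hβ.le)
  convert h2 using 1
  have : B * (β • 1 - B) * B + (β • 1 - B) * B * (β • 1 - B) = β • (β • B - B ^ 2) := by
    simp only [Matrix.mul_sub, Matrix.sub_mul, Matrix.smul_mul, Matrix.mul_smul, Matrix.one_mul,
      Matrix.mul_one, smul_sub, sq]
    abel
  rw [this, smul_smul, inv_mul_cancel₀ hβ.ne', one_smul]

/-- The difference of two outcomes of a dyadic sample is small compared to their sum. -/
theorem sq_sub_firstCoinsFalse_le {L a : ℕ} (k l : Fin L → Bool) :
    ((if FirstCoinsFalse a k then (2 : ℝ) ^ a else 0) - (if FirstCoinsFalse a l then 2 ^ a else 0)) ^ 2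
      ≤ 2 ^ a * ((if FirstCoinsFalse a k then (2 : ℝ) ^ a else 0)
        + (if FirstCoinsFalse a l then 2 ^ a else 0)) := by
  have : (0 : ℝ) < 2 ^ a := by positivity
  split_ifs <;> nlinarith

open scoped MatrixOrder Matrix.Norms.L2Operator in
-- Write A = C*C and take N = C⁻¹. This normalizes the Laplacian to the identity.
theorem exists_isUnit_conj_eq_one {n : Type*} [Fintype n] [DecidableEq n] {A : Matrix n n ℝ}
    (hA : A.PosDef) : ∃ N : Matrix n n ℝ, IsUnit N ∧ Nᴴ * A * N = 1 := by
  obtain ⟨C, hC, h⟩ := CStarAlgebra.isStrictlyPositive_iff_eq_star_mul_self.mp hA.isStrictlyPositive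
  have hd := (isUnit_iff_isUnit_det C).1 hC
  refine ⟨C⁻¹, isUnit_nonsing_inv_iff.2 hC, ?_⟩
  rw [h, star_eq_conjTranspose, ← Matrix.mul_assoc, ← conjTranspose_mul, mul_nonsing_inv _ hd,
    conjTranspose_one, Matrix.one_mul, mul_nonsing_inv _ hd]

theorem dotProduct_conj {n : Type*} [Fintype n] (A N : Matrix n n ℝ) (x : n → ℝ) :
    x ⬝ᵥ (Nᴴ * A * N) *ᵥ x = (N *ᵥ x) ⬝ᵥ A *ᵥ (N *ᵥ x) := by
  rw [← mulVec_mulVec, ← mulVec_mulVec, dotProduct_mulVec, conjTranspose_eq_transpose_of_trivial,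
    vecMul_transpose]

/-- The generators kept by a sample. -/
def sampledGens {G : Type*} {L : ℕ} (U : Finset G) (a : G → ℕ) (ω : G → Fin L → Bool) : Finset G :=
  U.filter fun s => FirstCoinsFalse (a s) (ω s)

/-- Matrix concentration for the normalized Laplacians `M s` of the single generators. The
hypothesis `hlev` says that 2^(a s) · `M s` is at most ρ times the identity, so no reweighted
generator dominates the sum. -/
theorem card_not_isCutSparsifier_le {G : Type*} [Group G] [Fintype G] [DecidableEq G] {L : ℕ}
    {S U : Finset G} (hUS : U ⊆ S) (hSU : ∀ s ∈ S, s ≠ 1 → s ∈ U) {w : G → ℝ}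
    (hw : ∀ s ∈ S, 0 ≤ w s) {a : G → ℕ} (haL : ∀ s ∈ U, a s ≤ L) {ρ : ℝ} (hρ : 0 < ρ)
    (hlev : ∀ s ∈ U, a s ≠ 0 → ∀ ℓ : G → ℝ, IsLengthFunction ℓ →
      2 ^ a s * (w s * ℓ s ^ 2) ≤ ρ * ∑ t ∈ S, w t * ℓ t ^ 2)
    {q : ℕ} (hq0 : q ≠ 0) (hq : q * ρ ≤ 1) {ε : ℝ} (hε : 0 < ε)
    {B : Finset (G → Fin L → Bool)}
    (hB : ∀ ω ∈ B, ¬ WeightedDigraph.IsCutSparsifier ε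
      (Cay (sampledGens U a ω) fun s => w s * 2 ^ a s) (Cay S w)) :
    (B.card : ℝ) ≤ (20 * q * ρ / ε ^ 2) ^ q
      * (Fintype.card G * Fintype.card (G → Fin L → Bool)) := by
  -- The Laplacian is singular, so δ is added to make it invertible. It is so small that for every
  -- nonzero cut the term δ‖1_T‖² is at most the Laplacian form; this costs a factor 2, and the
  -- concentration is therefore applied with ε/2.
  obtain ⟨δ, hδ, hδT⟩ := exists_pos_le_of_pos fun T : Set G =>
    (∑ s ∈ S, w s * translationLength (T.indicator 1) s ^ 2) / Fintype.card G
  set Lap : Matrix G G ℝ := ∑ s ∈ S, w s • translationMatrix s with hLap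
  have hLapPSD : Lap.PosSemidef :=
    posSemidef_sum S fun s hs => (translationMatrix_posSemidef s).smul (hw s hs)
  obtain ⟨N, hN, hN1⟩ := exists_isUnit_conj_eq_one
    (PosDef.posSemidef_add hLapPSD (PosDef.one.smul hδ))
  have hLapQ : ∀ x : G → ℝ, x ⬝ᵥ Lap *ᵥ x = ∑ s ∈ S, w s * translationLength x s ^ 2 := by
    intro x
    rw [hLap, sum_mulVec, dotProduct_sum]
    exact sum_congr rfl fun s _ => by
      rw [smul_mulVec, dotProduct_smul, dotProduct_translationMatrix, smul_eq_mul]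
  set M : G → Matrix G G ℝ := fun s => if s ∈ U then Nᴴ * (w s • translationMatrix s) * N else 0
    with hM
  have hMPSD : ∀ s, (M s).PosSemidef := fun s => by
    simp only [hM]
    split_ifs with h
    · exact ((translationMatrix_posSemidef s).smul (hw s (hUS h))).conjTranspose_mul_mul_same N
    · exact .zero
  set ζ : G → (Fin L → Bool) → ℝ := fun s k => if FirstCoinsFalse (a s) k then 2 ^ a s else 0 with hζ
  have hX : ∀ s k, ((ζ s k - 1) • M s).IsHermitian := fun s k => by
    rw [Matrix.IsHermitian, conjTranspose_smul, (hMPSD s).1.eq, star_trivial]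
  have hX0 : ∀ s, ∑ k, (ζ s k - 1) • M s = 0 := by
    intro s
    rw [← Finset.sum_smul]
    by_cases hs : s ∈ U
    · rw [sum_sub_distrib, sum_ite_firstCoinsFalse (haL s hs)]
      simp
    · simp [hM, hs]
  have hvar : ∀ s k l, (ρ • ((ζ s k - 1) • M s + M s + ((ζ s l - 1) • M s + M s))
      - ((ζ s k - 1) • M s - (ζ s l - 1) • M s) ^ 2).PosSemidef := by
    intro s k l
    have e1 : ρ • ((ζ s k - 1) • M s + M s + ((ζ s l - 1) • M s + M s))
        - ((ζ s k - 1) • M s - (ζ s l - 1) • M s) ^ 2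
        = (ρ * (ζ s k + ζ s l)) • M s - (ζ s k - ζ s l) ^ 2 • M s ^ 2 := by
      rw [← sub_smul, _root_.smul_pow, sub_sub_sub_cancel_right]
      congr 1
      module
    rw [e1]
    by_cases hs : s ∈ U
    swap
    · simp [hM, hs, PosSemidef.zero]
    -- A generator with exponent 0 is always kept, so it has no variance and needs no bound on its
    -- share.
    by_cases ha : a s = 0
    · have : ∀ k, ζ s k = 1 := fun k => by simp [hζ, ha, FirstCoinsFalse]
      simp only [this, sub_self]
      simpa using (hMPSD s).smul (show 0 ≤ ρ * (1 + 1) by positivity)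
    · have hβ : 0 < ρ / 2 ^ a s := by positivity
      have hle : ((ρ / 2 ^ a s) • 1 - M s).PosSemidef := by
        refine PosSemidef.of_dotProduct_mulVec_nonneg ?_ fun x => ?_
        · rw [Matrix.IsHermitian, conjTranspose_sub, conjTranspose_smul, conjTranspose_one,
            (hMPSD s).1.eq, star_trivial]
        · rw [star_trivial, sub_mulVec, dotProduct_sub, smul_mulVec, dotProduct_smul]
          simp only [hM, if_pos hs]
          rw [← hN1, dotProduct_conj, dotProduct_conj, add_mulVec, dotProduct_add, hLapQ,
            smul_mulVec, dotProduct_smul, smul_mulVec, dotProduct_smul,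
            dotProduct_translationMatrix, one_mulVec, smul_eq_mul, smul_eq_mul, smul_eq_mul]
          have h1 := hlev s hs ha _ (isLengthFunction_translationLength (N *ᵥ x))
          have h2 : 0 ≤ (N *ᵥ x) ⬝ᵥ (N *ᵥ x) := dotProduct_self_star_nonneg _
          have h3 : 0 ≤ δ * ((N *ᵥ x) ⬝ᵥ (N *ᵥ x)) := by positivity
          rw [sub_nonneg, div_mul_eq_mul_div, le_div_iff₀ (by positivity)]
          nlinarith
      have h1 := (hMPSD s).smul_sub_sq hβ hle
      have h2 := h1.smul (sq_nonneg (ζ s k - ζ s l))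
      -- The chain is (ζ − ζ')² M² ≤ (ζ − ζ')² (ρ/2^a) M ≤ ρ (ζ + ζ') M.
      have h3 : 0 ≤ ρ * (ζ s k + ζ s l) - (ζ s k - ζ s l) ^ 2 * (ρ / 2 ^ a s) := by
        have := sq_sub_firstCoinsFalse_le (a := a s) k l
        rw [sub_nonneg, mul_div_assoc', div_le_iff₀ (by positivity)]
        nlinarith
      have h4 := ((hMPSD s).smul h3).add h2
      convert h4 using 1
      module
  have hM1 : (1 - ∑ s, M s).PosSemidef := by
    have h1 : ∑ s, M s = Nᴴ * (∑ s ∈ U, w s • translationMatrix s) * N := by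
      rw [Matrix.mul_sum, Matrix.sum_mul, ← sum_filter, filter_mem_eq_inter, univ_inter]
    have h2 : Lap = ∑ s ∈ S \ U, w s • translationMatrix s + ∑ s ∈ U, w s • translationMatrix s :=
      (sum_sdiff hUS).symm
    rw [← hN1, h1, ← Matrix.sub_mul, ← Matrix.mul_sub, h2, add_right_comm, add_sub_cancel_right]
    refine PosSemidef.conjTranspose_mul_mul_same (PosSemidef.add ?_ (PosSemidef.one.smul hδ.le)) N
    exact posSemidef_sum _ fun s hs =>
      (translationMatrix_posSemidef s).smul (hw s (mem_sdiff.1 hs).1)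
  have hquad : ∀ (ω : G → Fin L → Bool) (x : G → ℝ),
      x ⬝ᵥ (∑ s, (ζ s (ω s) - 1) • M s) *ᵥ x
      = ∑ s ∈ sampledGens U a ω, w s * 2 ^ a s * translationLength (N *ᵥ x) s ^ 2
        - ∑ s ∈ U, w s * translationLength (N *ᵥ x) s ^ 2 := by
    intro ω x
    rw [sampledGens, sum_filter, ← sum_sub_distrib, sum_mulVec, dotProduct_sum,
      ← sum_subset (subset_univ U) fun s _ hs => by simp [hM, hs]]
    refine sum_congr rfl fun s hs => ?_
    simp only [hM, hζ, if_pos hs]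
    rw [smul_mulVec, dotProduct_smul, dotProduct_conj, smul_mulVec, dotProduct_smul,
      dotProduct_translationMatrix, smul_eq_mul, smul_eq_mul]
    split_ifs <;> ring
  have hmain := card_exists_quadraticForm_lt_le hX hX0 hρ.le hvar hM1 hq0 hq (half_pos hε) (s := B)
    fun ω hω => ?_
  · refine hmain.trans (le_of_eq ?_)
    congr 2
    field_simp
    ring
  by_contra hcon
  push Not at hcon
  refine hB ω hω fun T => ?_
  -- The test vector is chosen such that `N` maps it to the indicator of the cut.
  have hx := hcon (N⁻¹ *ᵥ T.indicator 1)
  have hNx : N *ᵥ N⁻¹ *ᵥ T.indicator 1 = T.indicator 1 := by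
    rw [mulVec_mulVec, mul_nonsing_inv _ ((isUnit_iff_isUnit_det N).1 hN), one_mulVec]
  have hself : ∀ x : G → ℝ, x ⬝ᵥ x = x ⬝ᵥ (Nᴴ * (Lap + δ • 1) * N) *ᵥ x := fun x => by
    rw [hN1, one_mulVec]
  rw [hquad, hself (N⁻¹ *ᵥ T.indicator 1), dotProduct_conj, hNx, add_mulVec, dotProduct_add, hLapQ,
    smul_mulVec, dotProduct_smul, one_mulVec, smul_eq_mul] at hx
  have hU : ∑ s ∈ U, w s * translationLength (T.indicator 1) s ^ 2
      = ∑ s ∈ S, w s * translationLength (T.indicator 1) s ^ 2 := by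
    refine sum_subset hUS fun s hs hsU => ?_
    rw [not_imp_comm.1 (hSU s hs) hsU, (isLengthFunction_translationLength _).one]
    ring
  rw [hU] at hx
  rw [cutSize_Cay, cutSize_Cay]
  have hnn : ∀ s ∈ S, 0 ≤ w s * translationLength (T.indicator 1) s ^ 2 := fun s hs =>
    mul_nonneg (hw s hs) (sq_nonneg _)
  -- For a zero cut the choice of δ gives nothing, but then every summand vanishes and the sampled
  -- cut is zero too.
  rcases (sum_nonneg hnn).eq_or_lt with h0 | hpos
  · have h1 := (sum_eq_zero_iff_of_nonneg hnn).1 h0.symm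
    have h2 : ∑ s ∈ sampledGens U a ω, w s * 2 ^ a s * translationLength (T.indicator 1) s ^ 2 = 0 :=
      sum_eq_zero fun s hs => by
        rw [mul_right_comm, h1 s (hUS (mem_filter.1 hs).1), zero_mul]
    rw [h2, ← h0]
    simp
  · have hn : (0 : ℝ) < Fintype.card G := by exact_mod_cast Fintype.card_pos
    have h1 := hδT T (div_pos hpos hn)
    have h2 : T.indicator (1 : G → ℝ) ⬝ᵥ T.indicator 1 ≤ Fintype.card G := by
      classical
      rw [dotProduct]
      refine (sum_le_card_nsmul _ _ 1 fun u _ => ?_).trans (by simp)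
      by_cases hu : u ∈ T <;> simp [hu]
    rw [le_div_iff₀ hn] at h1
    have h3 := mul_le_mul_of_nonneg_left h2 (le_of_lt hδ)
    have h4 := mul_le_mul_of_nonneg_left (h3.trans h1) (half_pos hε).le
    obtain ⟨h5, h6⟩ := abs_le.1 hx
    constructor <;> nlinarith

/-! ### The number of sampled generators -/

/-- By independence the exponential moment factors, and a generator kept with probability p
contributes 1 + p ≤ exp p. -/
theorem sum_two_pow_card_sampledGens_le {G : Type*} [Fintype G] [DecidableEq G] {L : ℕ}
    (U : Finset G) {a : G → ℕ} (haL : ∀ s ∈ U, a s ≤ L) :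
    ∑ ω : G → Fin L → Bool, (2 : ℝ) ^ (sampledGens U a ω).card
      ≤ Real.exp (∑ s ∈ U, (1 / 2 : ℝ) ^ a s) * Fintype.card (G → Fin L → Bool) := by
  have h1 : ∀ ω : G → Fin L → Bool, (2 : ℝ) ^ (sampledGens U a ω).card
      = ∏ s, if s ∈ U ∧ FirstCoinsFalse (a s) (ω s) then 2 else 1 := by
    intro ω
    rw [prod_ite, prod_const_one, mul_one, prod_const]
    congr 2
    ext s
    simp [sampledGens]
  rw [sum_congr rfl fun ω _ => h1 ω, ← Fintype.prod_sum fun s (k : Fin L → Bool) =>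
    if s ∈ U ∧ FirstCoinsFalse (a s) k then (2 : ℝ) else 1]
  have h2 : ∀ s, ∑ k : Fin L → Bool, (if s ∈ U ∧ FirstCoinsFalse (a s) k then (2 : ℝ) else 1)
      ≤ Real.exp (if s ∈ U then (1 / 2 : ℝ) ^ a s else 0) * 2 ^ L := by
    intro s
    by_cases hs : s ∈ U
    · have h3 := sum_ite_firstCoinsFalse (haL s hs)
      have h4 : ∀ k : Fin L → Bool, (if s ∈ U ∧ FirstCoinsFalse (a s) k then (2 : ℝ) else 1)
          = (1 / 2) ^ a s * (if FirstCoinsFalse (a s) k then (2 : ℝ) ^ a s else 0) + 1 := by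
        intro k
        split_ifs with h h' h'
        · rw [← mul_pow]; norm_num
        · exact absurd h.2 h'
        · exact absurd ⟨hs, h'⟩ h
        · ring
      rw [sum_congr rfl fun k _ => h4 k, sum_add_distrib, ← mul_sum, h3, if_pos hs]
      have h5 := Real.add_one_le_exp ((1 / 2 : ℝ) ^ a s)
      have h6 : (0 : ℝ) < 2 ^ L := by positivity
      simp only [sum_const, card_univ, Fintype.card_pi, Fintype.card_bool, prod_const,
        Fintype.card_fin, nsmul_eq_mul, mul_one, Nat.cast_pow, Nat.cast_ofNat]
      nlinarith
    · simp [hs]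
  refine (prod_le_prod (fun s _ => sum_nonneg fun k _ => by split_ifs <;> norm_num)
    fun s _ => h2 s).trans (le_of_eq ?_)
  rw [prod_mul_distrib, ← Real.exp_sum, ← sum_filter, filter_mem_eq_inter, univ_inter]
  simp

/-- All but a small fraction of the samples contain few generators. -/
theorem card_sampledGens_gt_le {G : Type*} [Fintype G] [DecidableEq G] {L : ℕ}
    (U : Finset G) {a : G → ℕ} (haL : ∀ s ∈ U, a s ≤ L) {μ : ℝ} (hμ : ∑ s ∈ U, (1 / 2 : ℝ) ^ a s ≤ μ)
    (b : ℕ) {B : Finset (G → Fin L → Bool)}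
    (hB : ∀ ω ∈ B, 2 * μ + b < (sampledGens U a ω).card) :
    (B.card : ℝ) ≤ (1 / 2) ^ b * Fintype.card (G → Fin L → Bool) := by
  have h1 : ∀ ω ∈ B, Real.exp μ * 2 ^ b ≤ (2 : ℝ) ^ (sampledGens U a ω).card := by
    intro ω hω
    -- The threshold 2μ absorbs exp μ because e ≤ 4.
    have h2 : Real.exp μ ≤ (2 : ℝ) ^ (2 * μ) := by
      rw [Real.rpow_def_of_pos two_pos]
      have h3 : 0 ≤ μ := le_trans (sum_nonneg fun s _ => by positivity) hμ
      have := Real.log_two_gt_d9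
      exact Real.exp_le_exp.2 (by nlinarith)
    calc _ ≤ (2 : ℝ) ^ (2 * μ) * 2 ^ b := by gcongr
      _ = (2 : ℝ) ^ (2 * μ + b) := by rw [Real.rpow_add two_pos, Real.rpow_natCast]
      _ ≤ (2 : ℝ) ^ ((sampledGens U a ω).card : ℝ) :=
        Real.rpow_le_rpow_of_exponent_le one_le_two (hB ω hω).le
      _ = _ := Real.rpow_natCast _ _
  have h2 : B.card * (Real.exp μ * 2 ^ b) ≤ Real.exp μ * Fintype.card (G → Fin L → Bool) := by
    calc _ = ∑ ω ∈ B, (Real.exp μ * 2 ^ b) := by rw [sum_const, nsmul_eq_mul]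
      _ ≤ ∑ ω ∈ B, (2 : ℝ) ^ (sampledGens U a ω).card := sum_le_sum h1
      _ ≤ ∑ ω : G → Fin L → Bool, (2 : ℝ) ^ (sampledGens U a ω).card :=
        sum_le_sum_of_subset_of_nonneg (subset_univ _) fun _ _ _ => by positivity
      _ ≤ _ := (sum_two_pow_card_sampledGens_le U haL).trans (by gcongr)
  have h3 := Real.exp_pos μ
  rw [one_div, inv_pow, inv_mul_eq_div, le_div_iff₀ (by positivity)]
  nlinarith

/-! ### Greedy levels of generators -/

section Levels

variable {G : Type*} [Group G] [Fintype G]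

/-- Right multiplication by `s` does not move the set `P` off itself. -/
def Meets (P : Finset G) (s : G) : Prop := ∃ p ∈ P, p * s ∈ P

/-- The contribution of `s` is at most `4 K` times that of the generators with the level `i`. -/
def Dominated (w : G → ℝ) (K : ℕ) (lev : G → ℕ) (i : ℕ) (s : G) : Prop :=
  ∀ ℓ : G → ℝ, IsLengthFunction ℓ → w s * ℓ s ^ 2 ≤ 4 * K * ∑ b with lev b = i, w b * ℓ b ^ 2

/-- The levels `1, …, j` have been filled; level `0` stands for generators without a level. -/
structure LevelsFilled (S : Finset G) (w : G → ℝ) (K j : ℕ) (lev : G → ℕ) : Prop where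
  mem : ∀ s, lev s ≠ 0 → s ∈ S ∧ s ≠ 1
  card_le : ∀ i, 1 ≤ i → i ≤ j → #{b | lev b = i} ≤ K
  dominated : ∀ i, 1 ≤ i → i ≤ j → ∀ s ∈ S, (lev s = 0 ∨ i < lev s) → Dominated w K lev i s
  nonempty : ∀ i, 1 ≤ i → i ≤ j → ∀ s ∈ S, s ≠ 1 → lev s = 0 → ∃ b, lev b = i

/-- After `t` rounds of filling the level `j + 1`. The products of the generators of this level are
translated to the set `P`. -/
structure LevelFilling (S : Finset G) (w : G → ℝ) (K j : ℕ) (lev : G → ℕ) (P : Finset G) (t : ℕ) :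
    Prop where
  filled : LevelsFilled S w K j lev
  lev_le : ∀ s, lev s ≤ j + 1
  base : ∃ g ∈ P, (∀ ℓ : G → ℝ, IsLengthFunction ℓ → ∀ p ∈ P,
    ℓ (g⁻¹ * p) ≤ ∑ b with lev b = j + 1, ℓ b) ∧ ((∃ b, lev b = j + 1) ∨ P = {g})
  two_pow_le : 2 ^ #{b | lev b = j + 1} ≤ #P
  of_meets : ∀ s ∈ S, lev s = 0 → Meets P s → Dominated w K lev (j + 1) s
  of_not_meets : ∀ s ∈ S, lev s = 0 → ¬ Meets P s → ∀ b, lev b = j + 1 → w s ≤ w b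
  progress : #{b | lev b = j + 1} = t ∨ ∀ s ∈ S, lev s = 0 → Meets P s

variable {S : Finset G} {w : G → ℝ} {K j t : ℕ} {lev : G → ℕ} {P : Finset G}

theorem levelsFilled_zero : LevelsFilled S w K 0 fun _ => 0 where
  mem _ h := absurd rfl h
  card_le i h1 h2 := by omega
  dominated i h1 h2 := by omega
  nonempty i h1 h2 := by omega

/-- Any starting point `g` serves, because `Meets` depends only on the quotients p⁻¹p', which left
translation preserves. So the program need not know the index of the identity. -/
theorem LevelsFilled.levelFilling (h : LevelsFilled S w K j lev) (hle : ∀ s, lev s ≤ j) (g : G) :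
    LevelFilling S w K j lev {g} 0 := by
  have he : (univ.filter fun b => lev b = j + 1) = ∅ :=
    filter_eq_empty_iff.2 fun b _ hb => by have := hle b; omega
  have hm : ∀ s, Meets {g} s → s = 1 := fun s ⟨p, hp, hps⟩ => by
    rw [mem_singleton] at hp hps
    simpa [hp] using hps
  refine ⟨h, fun s => (hle s).trans (Nat.le_succ _), ⟨g, mem_singleton_self _, fun ℓ hℓ p hp => ?_,
    Or.inr rfl⟩, by simp [he], fun s _ _ hs ℓ hℓ => ?_, fun s _ _ _ b hb => ?_, Or.inl (by simp [he])⟩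
  · rw [mem_singleton.1 hp, he]
    simp [hℓ.one]
  · rw [hm s hs, hℓ.one, he]
    simp
  · have := hle b; omega

theorem LevelFilling.not_meets_ne_one (h : LevelFilling S w K j lev P t) {s : G}
    (hs : ¬ Meets P s) : s ≠ 1 := by
  rintro rfl
  obtain ⟨g, hg, _⟩ := h.base
  exact hs ⟨g, hg, by simpa using hg⟩

theorem LevelFilling.of_finished (h : LevelFilling S w K j lev P t)
    (hm : ∀ s ∈ S, lev s = 0 → Meets P s) : LevelFilling S w K j lev P (t + 1) :=
  { h with progress := Or.inr hm }

theorem LevelFilling.card_le (h : LevelFilling S w K j lev P t) (hK : Fintype.card G ≤ 2 ^ K) :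
    #{b | lev b = j + 1} ≤ K :=
  (Nat.pow_le_pow_iff_right one_lt_two).1 ((h.two_pow_le.trans (card_le_univ _)).trans hK)

/-- The core of the greedy choice: `P` and `P s` are disjoint, so `P` doubles. Domination is
established for a generator in the round in which it first becomes blocked; while it is unblocked,
every chosen generator is at least as heavy. -/
theorem LevelFilling.step [DecidableEq G] (hw : ∀ s ∈ S, 0 ≤ w s) (hK : Fintype.card G ≤ 2 ^ K)
    (h : LevelFilling S w K j lev P t) {s : G} (hs : s ∈ S) (hs0 : lev s = 0)
    (hsm : ¬ Meets P s) (hmax : ∀ u ∈ S, lev u = 0 → ¬ Meets P u → w u ≤ w s) :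
    LevelFilling S w K j (Function.update lev s (j + 1)) (P ∪ P.image (· * s)) (t + 1) := by
  set lev' := Function.update lev s (j + 1) with hlev'
  have hne : ∀ {u}, u ≠ s → lev' u = lev u := fun hu => Function.update_of_ne hu _ _
  have hself : lev' s = j + 1 := Function.update_self _ _ _
  have hold : ∀ i, 1 ≤ i → i ≤ j → ∀ b, lev' b = i ↔ lev b = i := by
    intro i h1 h2 b
    by_cases hb : b = s
    · rw [hb, hself, hs0]; omega
    · rw [hne hb]
  have hnew : (univ.filter fun b => lev' b = j + 1) = insert s (univ.filter fun b => lev b = j + 1) := by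
    ext b
    by_cases hb : b = s
    · simp [hb, hself]
    · simp [hne hb, hb]
  have hsn : s ∉ univ.filter fun b => lev b = j + 1 := by simp [hs0]
  have hcard : #{b | lev' b = j + 1} = #{b | lev b = j + 1} + 1 := by
    rw [hnew, card_insert_of_notMem hsn]
  have hsum : ∀ f : G → ℝ, ∑ b with lev' b = j + 1, f b = f s + ∑ b with lev b = j + 1, f b :=
    fun f => by rw [hnew, sum_insert hsn]
  have hw' : ∀ b, lev b = j + 1 → 0 ≤ w b := fun b hb => hw b (h.filled.mem b (by omega)).1
  have hdisj : Disjoint P (P.image (· * s)) := by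
    refine disjoint_left.2 fun p hp hps => ?_
    obtain ⟨p', hp', rfl⟩ := mem_image.1 hps
    exact hsm ⟨p', hp', hp⟩
  have hcardP : #(P ∪ P.image (· * s)) = 2 * #P := by
    rw [card_union_of_disjoint hdisj, card_image_of_injective _ (mul_left_injective s), two_mul]
  have htwo : 2 ^ #{b | lev' b = j + 1} ≤ #(P ∪ P.image (· * s)) := by
    rw [hcard, hcardP, pow_succ']
    exact Nat.mul_le_mul_left 2 h.two_pow_le
  have hcardK : #{b | lev' b = j + 1} ≤ K :=
    (Nat.pow_le_pow_iff_right one_lt_two).1 ((htwo.trans (card_le_univ _)).trans hK)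
  obtain ⟨g, hg, hbase, -⟩ := h.base
  have hbase' : ∀ ℓ : G → ℝ, IsLengthFunction ℓ → ∀ p ∈ P ∪ P.image (· * s),
      ℓ (g⁻¹ * p) ≤ ∑ b with lev' b = j + 1, ℓ b := by
    intro ℓ hℓ p hp
    rw [hsum]
    rcases mem_union.1 hp with hp | hp
    · linarith [hbase ℓ hℓ p hp, hℓ.nonneg s]
    · obtain ⟨p', hp', rfl⟩ := mem_image.1 hp
      have := hℓ.mul_le (g⁻¹ * p') s
      rw [mul_assoc] at this
      linarith [hbase ℓ hℓ p' hp']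
  have hmono : ∀ {u}, Meets P u → Meets (P ∪ P.image (· * s)) u := fun ⟨p, hp, hpu⟩ =>
    ⟨p, mem_union_left _ hp, mem_union_left _ hpu⟩
  refine ⟨⟨fun u hu => ?_, fun i h1 h2 => ?_, fun i h1 h2 u hu hlu => ?_,
    fun i h1 h2 u hu hu1 hu0 => ?_⟩, fun u => ?_, ⟨g, mem_union_left _ hg, hbase', Or.inl ⟨s, hself⟩⟩,
    htwo, fun u hu hu0 hmu => ?_, fun u hu hu0 hmu b hb => ?_, ?_⟩
  · by_cases hus : u = s
    · exact hus ▸ ⟨hs, h.not_meets_ne_one hsm⟩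
    · exact h.filled.mem u (hne hus ▸ hu)
  · simp only [hold i h1 h2]
    exact h.filled.card_le i h1 h2
  · unfold Dominated
    simp only [hold i h1 h2]
    refine h.filled.dominated i h1 h2 u hu ?_
    by_cases hus : u = s
    · exact Or.inl (hus ▸ hs0)
    · exact hne hus ▸ hlu
  · have hus : u ≠ s := by rintro rfl; omega
    obtain ⟨b, hb⟩ := h.filled.nonempty i h1 h2 u hu hu1 (hne hus ▸ hu0)
    exact ⟨b, (hold i h1 h2 b).2 hb⟩
  · by_cases hus : u = s
    · rw [hus, hself]
    · exact hne hus ▸ h.lev_le u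
  · have hus : u ≠ s := by rintro rfl; omega
    rw [hne hus] at hu0
    -- A generator blocked earlier stays dominated, as the level sum only grows.
    by_cases hmP : Meets P u
    · intro ℓ hℓ
      have := h.of_meets u hu hu0 hmP ℓ hℓ
      rw [hsum]
      have h2 : 0 ≤ 4 * K * (w s * ℓ s ^ 2) := by have := hw s hs; positivity
      linarith
    · intro ℓ hℓ
      obtain ⟨p, hp, hpu⟩ := hmu
      -- Write u as the quotient of two points of the new set and measure both from the base point
      -- `g`.
      have h1 : ℓ u ≤ 2 * ∑ b with lev' b = j + 1, ℓ b := by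
        have h2 := hℓ.mul_le (g⁻¹ * p)⁻¹ (g⁻¹ * (p * u))
        rw [hℓ.inv, show (g⁻¹ * p)⁻¹ * (g⁻¹ * (p * u)) = u by group] at h2
        linarith [hbase' ℓ hℓ p hp, hbase' ℓ hℓ _ hpu]
      have h3 : ℓ u ^ 2 ≤ 4 * (K * ∑ b with lev' b = j + 1, ℓ b ^ 2) := by
        have h4 := sq_sum_le_card_mul_sum_sq (s := univ.filter fun b => lev' b = j + 1) (f := ℓ)
        have h5 : (#{b | lev' b = j + 1} : ℝ) * ∑ b with lev' b = j + 1, ℓ b ^ 2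
            ≤ K * ∑ b with lev' b = j + 1, ℓ b ^ 2 := by
          gcongr
        have h6 := pow_le_pow_left₀ (hℓ.nonneg u) h1 2
        linarith
      calc w u * ℓ u ^ 2 ≤ w u * (4 * (K * ∑ b with lev' b = j + 1, ℓ b ^ 2)) :=
            mul_le_mul_of_nonneg_left h3 (hw u hu)
        _ = 4 * K * ∑ b with lev' b = j + 1, w u * ℓ b ^ 2 := by rw [← mul_sum]; ring
        _ ≤ _ := by
          refine mul_le_mul_of_nonneg_left (sum_le_sum fun b hb => ?_) (by positivity)
          refine mul_le_mul_of_nonneg_right ?_ (sq_nonneg _)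
          rw [hnew, mem_insert] at hb
          rcases hb with rfl | hb
          · exact hmax u hu hu0 hmP
          · exact h.of_not_meets u hu hu0 hmP b (mem_filter.1 hb).2
  · have hus : u ≠ s := by rintro rfl; omega
    rw [hne hus] at hu0
    have hmP := fun hm => hmu (hmono hm)
    by_cases hbs : b = s
    · exact hbs ▸ hmax u hu hu0 hmP
    · exact h.of_not_meets u hu hu0 hmP b (hne hbs ▸ hb)
  · rcases h.progress with hp | hp
    · exact Or.inl (by rw [hcard, hp])
    · exact absurd (hp s hs hs0) hsm

/-- Had each of the |G| rounds added a generator, `P` would have 2^|G| > |G| elements. So the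
filling has stopped and every generator without a level is blocked. -/
theorem LevelFilling.levelsFilled (hK : Fintype.card G ≤ 2 ^ K)
    (h : LevelFilling S w K j lev P (Fintype.card G)) : LevelsFilled S w K (j + 1) lev := by
  have hmeets : ∀ s ∈ S, lev s = 0 → Meets P s := by
    rcases h.progress with hp | hp
    · have := h.two_pow_le.trans (card_le_univ _)
      rw [hp] at this
      exact absurd this (not_le.2 Nat.lt_two_pow_self)
    · exact hp
  refine ⟨h.filled.mem, fun i h1 h2 => ?_, fun i h1 h2 s hs hl => ?_, fun i h1 h2 s hs hs1 hs0 => ?_⟩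
  · rcases h2.eq_or_lt with rfl | h2
    · exact h.card_le hK
    · exact h.filled.card_le i h1 (by omega)
  · rcases h2.eq_or_lt with rfl | h2
    · have h0 : lev s = 0 := by have := h.lev_le s; omega
      exact h.of_meets s hs h0 (hmeets s hs h0)
    · exact h.filled.dominated i h1 (by omega) s hs hl
  · rcases h2.eq_or_lt with rfl | h2
    -- If the new level were empty, the set would still be `{g}`, which blocks only the identity.
    · obtain ⟨g, hg, -, hb | hb⟩ := h.base
      · exact hb
      · obtain ⟨p, hp, hps⟩ := hmeets s hs hs0
        rw [hb, mem_singleton] at hp hps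
        exact absurd (by simpa [hp] using hps) hs1
    · exact h.filled.nonempty i h1 (by omega) s hs hs1 hs0

/-- Otherwise `lev` would take all |G| + 1 values 0, …, |G| on the |G| elements. -/
theorem LevelsFilled.lev_ne_zero (h : LevelsFilled S w K (Fintype.card G) lev) {s : G} (hs : s ∈ S)
    (hs1 : s ≠ 1) : lev s ≠ 0 := by
  intro h0
  have hsub : range (Fintype.card G + 1) ⊆ univ.image lev := by
    intro i hi
    rcases Nat.eq_zero_or_pos i with rfl | hi0
    · exact mem_image.2 ⟨s, mem_univ _, h0⟩
    · obtain ⟨b, hb⟩ := h.nonempty i hi0 (by have := mem_range.1 hi; omega) s hs hs1 h0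
      exact mem_image.2 ⟨b, mem_univ _, hb⟩
  have := (card_le_card hsub).trans card_image_le
  rw [card_range, card_univ] at this
  omega

/-- Sum the domination by the levels 1, …, `lev s` − 1, which are disjoint subsets of `S`. -/
theorem LevelsFilled.sub_one_mul_le (hw : ∀ s ∈ S, 0 ≤ w s)
    (h : LevelsFilled S w K j lev) (hle : ∀ s, lev s ≤ j) {s : G} (hs : s ∈ S) {ℓ : G → ℝ}
    (hℓ : IsLengthFunction ℓ) :
    ((lev s - 1 : ℕ) : ℝ) * (w s * ℓ s ^ 2) ≤ 4 * K * ∑ t ∈ S, w t * ℓ t ^ 2 := by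
  classical
  have h1 : ∀ i ∈ Icc 1 (lev s - 1),
      w s * ℓ s ^ 2 ≤ 4 * K * ∑ b with lev b = i, w b * ℓ b ^ 2 := fun i hi => by
    have hi' := mem_Icc.1 hi
    exact h.dominated i hi'.1 (by have := hle s; omega) s hs (by omega) ℓ hℓ
  have h2 := sum_le_sum h1
  rw [sum_const, Nat.card_Icc, add_tsub_cancel_right, nsmul_eq_mul, ← mul_sum] at h2
  refine h2.trans (mul_le_mul_of_nonneg_left ?_ (by positivity))
  rw [← sum_biUnion fun i _ i' _ hii => disjoint_filter.2 fun b _ hb hb' => hii (hb.symm.trans hb')]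
  refine sum_le_sum_of_subset_of_nonneg (fun b hb => ?_) fun b hb _ =>
    mul_nonneg (hw b hb) (sq_nonneg _)
  obtain ⟨i, hi, hb⟩ := mem_biUnion.1 hb
  have := (mem_Icc.1 hi).1
  exact (h.mem b (by rw [(mem_filter.1 hb).2]; omega)).1

end Levels

/-! ### The sampling probabilities -/

/-- The largest `a ≤ L` with `2 ^ a * θ ≤ j`, or zero. -/
noncomputable def sampleExp (θ : ℝ) (L j : ℕ) : ℕ :=
  open Classical in Nat.findGreatest (fun a => 2 ^ a * θ ≤ j) L

theorem sampleExp_le (θ : ℝ) (L j : ℕ) : sampleExp θ L j ≤ L := Nat.findGreatest_le _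

theorem two_pow_sampleExp_mul_le {θ : ℝ} {L j : ℕ} (h : sampleExp θ L j ≠ 0) :
    2 ^ sampleExp θ L j * θ ≤ j := by
  classical
  exact Nat.findGreatest_of_ne_zero (P := fun a => 2 ^ a * θ ≤ j) (by rfl) h

theorem lt_two_pow_sampleExp_mul {θ : ℝ} {L j l : ℕ} (h : sampleExp θ L j < l) (hl : l ≤ L) :
    j < 2 ^ l * θ := by
  classical
  exact not_le.1 (Nat.findGreatest_is_greatest (P := fun a => 2 ^ a * θ ≤ j) h hl)

/-- Since 2^L > L ≥ j, the cap `L` is never reached. So the next exponent violates the defining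
inequality. -/
theorem half_pow_sampleExp_le {θ : ℝ} (hθ : 1 ≤ θ) {L j : ℕ} (hj : 0 < j) (hjL : j ≤ L) :
    (1 / 2 : ℝ) ^ sampleExp θ L j ≤ 2 * θ / j := by
  have hlt : sampleExp θ L j < L := by
    refine (sampleExp_le θ L j).lt_of_ne fun h => ?_
    have h1 := two_pow_sampleExp_mul_le (θ := θ) (L := L) (j := j) (by omega)
    rw [h] at h1
    have h2 : (L : ℝ) < 2 ^ L := by exact_mod_cast Nat.lt_two_pow_self
    have h3 : (j : ℝ) ≤ L := by exact_mod_cast hjL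
    nlinarith
  have h1 := lt_two_pow_sampleExp_mul (Nat.lt_succ_self (sampleExp θ L j)) hlt
  have hj' : (0 : ℝ) < j := by exact_mod_cast hj
  rw [pow_succ] at h1
  rw [one_div, inv_pow, inv_eq_one_div, div_le_div_iff₀ (by positivity) hj']
  linarith

theorem LevelsFilled.sum_half_pow_le {G : Type*} [Group G] [Fintype G]
    {S : Finset G} {w : G → ℝ} {K : ℕ} {lev : G → ℕ} (h : LevelsFilled S w K (Fintype.card G) lev)
    (hle : ∀ s, lev s ≤ Fintype.card G) {θ : ℝ} (hθ : 1 ≤ θ) :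
    ∑ s with lev s ≠ 0, (1 / 2 : ℝ) ^ sampleExp θ (Fintype.card G) (lev s - 1)
      ≤ K + 2 * K * θ * (1 + Real.log (Fintype.card G)) := by
  set n := Fintype.card G with hn
  have hmaps : ∀ s ∈ univ.filter (fun s => lev s ≠ 0), lev s - 1 ∈ range n := fun s hs => by
    have h1 := (mem_filter.1 hs).2
    have h2 := hle s
    rw [mem_range]; omega
  rw [← sum_fiberwise_of_maps_to hmaps]
  have hfib : ∀ i ∈ range n, ∑ s ∈ univ.filter (fun s => lev s ≠ 0) with lev s - 1 = i,
      (1 / 2 : ℝ) ^ sampleExp θ n (lev s - 1) ≤ K * (1 / 2 : ℝ) ^ sampleExp θ n i := by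
    intro i hi
    rw [sum_congr rfl fun s hs => by rw [(mem_filter.1 hs).2], sum_const, nsmul_eq_mul]
    refine mul_le_mul_of_nonneg_right ?_ (by positivity)
    refine Nat.cast_le.2 (le_trans (card_le_card fun s hs => ?_)
      (h.card_le (i + 1) (by omega) (by have := mem_range.1 hi; omega)))
    simp only [mem_filter, mem_univ, true_and] at hs ⊢
    omega
  refine (sum_le_sum hfib).trans ?_
  obtain ⟨m, hm⟩ : ∃ m, n = m + 1 := Nat.exists_eq_succ_of_ne_zero Fintype.card_ne_zero
  rw [← mul_sum]
  have hsum : ∑ i ∈ range n, (1 / 2 : ℝ) ^ sampleExp θ n i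
      ≤ 1 + 2 * θ * (1 + Real.log n) := by
    -- The first level is split off: its members may be kept with certainty, and 2θ/j is no bound at
    -- j = 0.
    rw [hm, sum_range_succ', ← hm, add_comm]
    refine add_le_add (pow_le_one₀ (by norm_num) (by norm_num)) ?_
    have h1 : ∀ i ∈ range m, (1 / 2 : ℝ) ^ sampleExp θ n (i + 1) ≤ 2 * θ * ((i + 1 : ℕ) : ℝ)⁻¹ := by
      intro i hi
      rw [← div_eq_mul_inv]
      exact half_pow_sampleExp_le hθ (Nat.succ_pos _) (by have := mem_range.1 hi; omega)
    refine (sum_le_sum h1).trans ?_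
    rw [← mul_sum]
    refine mul_le_mul_of_nonneg_left ?_ (by positivity)
    have h2 := harmonic_le_one_add_log m
    simp only [harmonic, Rat.cast_sum, Rat.cast_inv, Rat.cast_natCast] at h2
    refine h2.trans ?_
    rcases Nat.eq_zero_or_pos m with rfl | hm0
    · simp [hm]
    · gcongr
      omega
  calc _ ≤ K * (1 + 2 * θ * (1 + Real.log n)) := by gcongr
    _ = _ := by ring

/-- The constant in the bound on the number of generators. -/
def sparsifierConst (c : ℕ) : ℝ := 110000 * (c + 2)

/-- The scale of the sampling probabilities. -/
noncomputable def sampleScale (c K : ℕ) (ε : ℝ) : ℝ := (160 * (c + 2) : ℕ) * K * K / (ε * ε)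

theorem half_pow_mul_le_inv_pow {n K : ℕ} (hn : 0 < n) (hK : n ≤ 2 ^ K) (m : ℕ) :
    (1 / 2 : ℝ) ^ (m * K) ≤ 1 / (n : ℝ) ^ m := by
  rw [one_div, inv_pow, ← one_div]
  refine one_div_le_one_div_of_le (by positivity) ?_
  rw [mul_comm, pow_mul]
  exact pow_le_pow_left₀ (by positivity) (by exact_mod_cast hK) m

theorem log_bounds {n K : ℕ} (hn : 2 ≤ n) (hK : 2 ^ K < 2 * n) :
    (69 / 100 : ℝ) ≤ Real.log n ∧ (K : ℝ) ≤ 3 * Real.log n := by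
  have h2 : (69 / 100 : ℝ) ≤ Real.log 2 := by have := Real.log_two_gt_d9; linarith
  have hn0 : (0 : ℝ) < n := by positivity
  have h3 : Real.log 2 ≤ Real.log n := Real.log_le_log two_pos (by exact_mod_cast hn)
  have h4 : K * Real.log 2 ≤ Real.log 2 + Real.log n := by
    rw [← Real.log_pow, ← Real.log_mul two_ne_zero hn0.ne']
    exact Real.log_le_log (by positivity) (by exact_mod_cast hK.le)
  refine ⟨h2.trans h3, ?_⟩
  have h5 : (0 : ℝ) ≤ K := by positivity
  nlinarith

/-- The left side is of order log⁴ n/ε². As log n ≥ 0.69, lower powers of log n are at most constant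
multiples of log⁵ n. -/
theorem sample_size_le {n K c : ℕ} (hn : 2 ≤ n) (hK : 2 ^ K < 2 * n) {ε : ℝ} (hε : 0 < ε)
    (hε1 : ε < 1) :
    2 * (K + 2 * K * sampleScale c K ε * (1 + Real.log n)) + ((c + 1) * K : ℕ)
      ≤ sparsifierConst c * Real.log n ^ 5 / ε ^ 2 := by
  obtain ⟨hl, hKl⟩ := log_bounds hn hK
  set l := Real.log n
  have hl0 : 0 < l := by linarith
  have hK0 : (0 : ℝ) ≤ K := by positivity
  have hc : (0 : ℝ) ≤ c := by positivity
  have hK3 : (K : ℝ) ^ 3 ≤ (3 * l) ^ 3 := pow_le_pow_left₀ hK0 hKl 3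
  have h45 : l ^ 4 ≤ 2 * l ^ 5 := by
    have : 0 < l ^ 4 := by positivity
    nlinarith
  have h15 : l ≤ 5 * l ^ 5 := by
    have h2 : (0.476 : ℝ) ≤ l ^ 2 := by nlinarith
    have h4 : (0.2 : ℝ) ≤ l ^ 4 := by nlinarith
    nlinarith
  rw [le_div_iff₀ (by positivity)]
  have hε2 : ε ^ 2 ≤ 1 := pow_le_one₀ hε.le hε1.le
  have hε20 : 0 < ε ^ 2 := by positivity
  have e1 : (2 * (K + 2 * K * sampleScale c K ε * (1 + l)) + ((c + 1) * K : ℕ)) * ε ^ 2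
      = (c + 3) * K * ε ^ 2 + 640 * (c + 2) * K ^ 3 * (1 + l) := by
    unfold sampleScale
    push_cast
    field_simp
    ring
  rw [e1]
  have h1 : (c + 3) * K * ε ^ 2 ≤ (c + 3) * (15 * l ^ 5) := by
    calc (c + 3) * K * ε ^ 2 ≤ (c + 3) * K * 1 := by gcongr
      _ = (c + 3) * K := mul_one _
      _ ≤ _ := by
        refine mul_le_mul_of_nonneg_left ?_ (by positivity)
        linarith
  have h2 : (K : ℝ) ^ 3 * (1 + l) ≤ 162 * l ^ 5 := by
    calc (K : ℝ) ^ 3 * (1 + l) ≤ (3 * l) ^ 3 * (3 * l) := by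
          gcongr
          linarith
      _ = 81 * l ^ 4 := by ring
      _ ≤ _ := by linarith
  have h3 := mul_le_mul_of_nonneg_left h2 (show (0 : ℝ) ≤ 640 * (c + 2) by positivity)
  have h5 : 0 < l ^ 5 := by positivity
  -- 640 · 162 = 103680, and 15 (c + 3) fits into the rest of 110000 (c + 2).
  unfold sparsifierConst
  nlinarith

/-- Sampling the generators according to their levels fails rarely. -/
theorem LevelsFilled.card_not_isSmall_le {G : Type*} [Group G] [Fintype G] [DecidableEq G]
    {S : Finset G} {w : G → ℝ} {K : ℕ} {lev : G → ℕ} (c : ℕ) (hn : 2 ≤ Fintype.card G)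
    (hK : Fintype.card G ≤ 2 ^ K) (hK' : 2 ^ K < 2 * Fintype.card G) (hw : ∀ s ∈ S, 0 ≤ w s)
    (h : LevelsFilled S w K (Fintype.card G) lev) (hle : ∀ s, lev s ≤ Fintype.card G)
    {ε : ℝ} (hε : 0 < ε) (hε1 : ε < 1) {a : G → ℕ}
    (ha : ∀ s, a s = sampleExp (sampleScale c K ε) (Fintype.card G) (lev s - 1))
    {B : Finset (G → Fin (Fintype.card G) → Bool)}
    (hB : ∀ ω ∈ B, ¬ IsSmallCayleyCutSparsifier (sparsifierConst c) ε S w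
      (sampledGens (univ.filter fun s => lev s ≠ 0) a ω) fun s => w s * 2 ^ a s) :
    (B.card : ℝ) ≤ 1 / (Fintype.card G : ℝ) ^ c
      * Fintype.card (G → Fin (Fintype.card G) → Bool) := by
  set U := univ.filter fun s => lev s ≠ 0 with hU
  set θ := sampleScale c K ε with hθ
  set N : ℝ := (Fintype.card (G → Fin (Fintype.card G) → Bool) : ℝ) with hN
  have hN0 : 0 < N := by rw [hN]; exact_mod_cast Fintype.card_pos
  have hUS : U ⊆ S := fun s hs => (h.mem s (mem_filter.1 hs).2).1
  have hSU : ∀ s ∈ S, s ≠ 1 → s ∈ U := fun s hs hs1 =>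
    mem_filter.2 ⟨mem_univ _, h.lev_ne_zero hs hs1⟩
  have haL : ∀ s ∈ U, a s ≤ Fintype.card G := fun s _ => ha s ▸ sampleExp_le _ _ _
  have hK0 : 0 < K := by
    rcases Nat.eq_zero_or_pos K with rfl | h
    · simp at hK; omega
    · exact h
  have hK1 : (1 : ℝ) ≤ K := by exact_mod_cast hK0
  have hc0 : (0 : ℝ) ≤ c := by positivity
  have hεε : ε * ε ≤ 1 := by nlinarith
  have hθ1 : 1 ≤ θ := by
    rw [hθ, sampleScale, le_div_iff₀ (by positivity)]
    push_cast
    nlinarith [mul_le_mul hK1 hK1 zero_le_one (by positivity : (0 : ℝ) ≤ K),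
      mul_nonneg hc0 (mul_self_nonneg (K : ℝ))]
  have hθ0 : 0 < θ := by linarith
  set μ := K + 2 * K * θ * (1 + Real.log (Fintype.card G)) with hμ
  classical
  set B₁ := B.filter fun ω => ¬ WeightedDigraph.IsCutSparsifier ε
    (Cay (sampledGens U a ω) fun s => w s * 2 ^ a s) (Cay S w) with hB₁
  set B₂ := B.filter fun ω => 2 * μ + ((c + 1) * K : ℕ) < ((sampledGens U a ω).card : ℝ) with hB₂
  have hBsub : B ⊆ B₁ ∪ B₂ := by
    intro ω hω
    by_contra hcon
    simp only [hB₁, hB₂, mem_union, mem_filter, hω, true_and, not_or, not_not, not_lt] at hcon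
    refine hB ω hω ⟨(filter_subset _ _).trans hUS, fun s hs => ?_,
      hcon.2.trans (sample_size_le hn hK' hε hε1), hcon.1⟩
    exact mul_nonneg (hw s (hUS (filter_subset _ _ hs))) (by positivity)
  have hsum : ∑ s ∈ U, (1 / 2 : ℝ) ^ a s ≤ μ := by
    simp only [ha]
    exact h.sum_half_pow_le hle hθ1
  have h2 : (B₂.card : ℝ) ≤ 1 / (Fintype.card G : ℝ) ^ (c + 1) * N :=
    (card_sampledGens_gt_le U haL hsum _ fun ω hω => (mem_filter.1 hω).2).trans
      (mul_le_mul_of_nonneg_right (half_pow_mul_le_inv_pow (by omega) hK _) hN0.le)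
  have hlev : ∀ s ∈ U, a s ≠ 0 → ∀ ℓ : G → ℝ, IsLengthFunction ℓ →
      2 ^ a s * (w s * ℓ s ^ 2) ≤ 4 * K / θ * ∑ t ∈ S, w t * ℓ t ^ 2 := by
    intro s hs has ℓ hℓ
    have h3 := h.sub_one_mul_le hw hle (hUS hs) hℓ
    rw [ha] at has
    have h4 := two_pow_sampleExp_mul_le has
    rw [← ha] at h4
    have h5 := mul_le_mul_of_nonneg_right h4 (mul_nonneg (hw s (hUS hs)) (sq_nonneg (ℓ s)))
    rw [div_mul_eq_mul_div, le_div_iff₀ hθ0]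
    linarith
  -- The constant 160 in `sampleScale` is chosen so that, with ρ = 4K/θ and q = (c + 2)K, the base
  -- 20 q ρ/ε² is 1/2. The power q then gives |G|^(−c−2), and one factor |G| is lost to the
  -- dimension.
  have hscale : ((c + 2) * K : ℕ) * (4 * K / θ) = ε ^ 2 / 40 := by
    rw [hθ, sampleScale]
    push_cast
    field_simp
    norm_num
  have h1 : (B₁.card : ℝ) ≤ 1 / (Fintype.card G : ℝ) ^ (c + 1) * N := by
    refine (card_not_isCutSparsifier_le hUS hSU hw haL (ρ := 4 * K / θ) (by positivity) hlev
      (q := (c + 2) * K) (by positivity) ?_ hε fun ω hω => (mem_filter.1 hω).2).trans ?_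
    · rw [hscale]
      nlinarith
    · have h3 : 20 * ((c + 2) * K : ℕ) * (4 * K / θ) / ε ^ 2 = 1 / 2 := by
        rw [mul_assoc, hscale]
        field_simp
        norm_num
      have hn0 : (0 : ℝ) < Fintype.card G := by exact_mod_cast (by omega : 0 < Fintype.card G)
      rw [h3, ← mul_assoc]
      refine mul_le_mul_of_nonneg_right ?_ hN0.le
      calc _ ≤ 1 / (Fintype.card G : ℝ) ^ (c + 2) * Fintype.card G :=
            mul_le_mul_of_nonneg_right (half_pow_mul_le_inv_pow (by omega) hK _) hn0.le
        _ = _ := by field_simp; ring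
  have hn2 : (2 : ℝ) ≤ Fintype.card G := by exact_mod_cast hn
  have h3 : (B.card : ℝ) ≤ B₁.card + B₂.card := by
    exact_mod_cast (card_le_card hBsub).trans (card_union_le _ _)
  -- The two kinds of failure have frequency at most |G|^(−c−1) each, and 2 ≤ |G|.
  calc (B.card : ℝ) ≤ 2 / Fintype.card G * (1 / (Fintype.card G : ℝ) ^ c * N) := by
        refine h3.trans ((add_le_add h1 h2).trans (le_of_eq ?_))
        field_simp
        ring
    _ ≤ 1 * (1 / (Fintype.card G : ℝ) ^ c * N) := by
        refine mul_le_mul_of_nonneg_right ?_ (by positivity)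
        rw [div_le_one (by positivity)]
        exact hn2
    _ = _ := one_mul _

namespace RealRAM

/-! ### Reasoning about programs -/

theorem Memory.setNat_nat (m : Memory) (a i j x a' i' j' : ℕ) :
    (m.setNat a i j x).nat a' i' j' = if a' = a ∧ i' = i ∧ j' = j then x else m.nat a' i' j' := rfl

theorem Memory.setNat_nat_of_ne (m : Memory) {a i j x a' : ℕ} (h : a' ≠ a) :
    (m.setNat a i j x).nat a' = m.nat a' := by
  funext i' j'
  simp [setNat_nat, h]

theorem Memory.setReal_real (m : Memory) (a i j : ℕ) (x : ℝ) (a' i' j' : ℕ) :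
    (m.setReal a i j x).real a' i' j' = if a' = a ∧ i' = i ∧ j' = j then x else m.real a' i' j' := rfl

theorem Memory.setReal_real_of_ne (m : Memory) {a i j a' : ℕ} {x : ℝ} (h : a' ≠ a) :
    (m.setReal a i j x).real a' = m.real a' := by
  funext i' j'
  simp [setReal_real, h]

@[simp] theorem Memory.setNat_real (m : Memory) (a i j x : ℕ) :
    (m.setNat a i j x).real = m.real := rfl

@[simp] theorem Memory.setNat_coins (m : Memory) (a i j x : ℕ) :
    (m.setNat a i j x).coins = m.coins := rfl

@[simp] theorem Memory.setReal_nat (m : Memory) (a i j : ℕ) (x : ℝ) :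
    (m.setReal a i j x).nat = m.nat := rfl

@[simp] theorem Memory.setReal_coins (m : Memory) (a i j : ℕ) (x : ℝ) :
    (m.setReal a i j x).coins = m.coins := rfl

@[simp] theorem Memory.dropCoin_nat (m : Memory) : m.dropCoin.nat = m.nat := rfl

@[simp] theorem Memory.dropCoin_real (m : Memory) : m.dropCoin.real = m.real := rfl

@[simp] theorem Memory.dropCoin_coins (m : Memory) (i : ℕ) : m.dropCoin.coins i = m.coins (i + 1) :=
  rfl

/-- At most the natural-number arrays in `A` and the real arrays in `R` have changed. -/
def Frame (A R : Finset ℕ) (m m' : Memory) : Prop :=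
  (∀ a, a ∉ A → m'.nat a = m.nat a) ∧ ∀ a, a ∉ R → m'.real a = m.real a

theorem Frame.refl (A R : Finset ℕ) (m : Memory) : Frame A R m m := ⟨fun _ _ => rfl, fun _ _ => rfl⟩

theorem Frame.trans {A R : Finset ℕ} {m₁ m₂ m₃ : Memory} (h : Frame A R m₁ m₂)
    (h' : Frame A R m₂ m₃) : Frame A R m₁ m₃ :=
  ⟨fun a ha => (h'.1 a ha).trans (h.1 a ha), fun a ha => (h'.2 a ha).trans (h.2 a ha)⟩

theorem Frame.mono {A A' R R' : Finset ℕ} {m m' : Memory} (h : Frame A R m m') (hA : A ⊆ A')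
    (hR : R ⊆ R') : Frame A' R' m m' :=
  ⟨fun a ha => h.1 a fun h => ha (hA h), fun a ha => h.2 a fun h => ha (hR h)⟩

theorem Frame.setNat {A R : Finset ℕ} {m m' : Memory} (h : Frame A R m m') {a : ℕ} (ha : a ∈ A)
    (i j x : ℕ) : Frame A R m (m'.setNat a i j x) :=
  ⟨fun b hb => (m'.setNat_nat_of_ne (ne_of_mem_of_not_mem ha hb).symm).trans (h.1 b hb), h.2⟩

theorem Frame.setReal {A R : Finset ℕ} {m m' : Memory} (h : Frame A R m m') {a : ℕ} (ha : a ∈ R)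
    (i j : ℕ) (x : ℝ) : Frame A R m (m'.setReal a i j x) :=
  ⟨h.1, fun b hb => (m'.setReal_real_of_ne (ne_of_mem_of_not_mem ha hb).symm).trans (h.2 b hb)⟩

theorem Frame.dropCoin {A R : Finset ℕ} {m m' : Memory} (h : Frame A R m m') :
    Frame A R m m'.dropCoin := h

/-- Started in `m`, the program `P` halts within `T` steps in a memory that satisfies `Q`. -/
def Runs (P : Prog) (m : Memory) (T : ℕ) (Q : Memory → Prop) : Prop :=
  ∃ t ≤ T, ∃ m', Exec P m t m' ∧ Q m'

theorem Runs.mono {P : Prog} {m : Memory} {T T' : ℕ} {Q Q' : Memory → Prop} (h : Runs P m T Q)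
    (hT : T ≤ T') (hQ : ∀ m', Q m' → Q' m') : Runs P m T' Q' := by
  obtain ⟨t, ht, m', h1, h2⟩ := h
  exact ⟨t, ht.trans hT, m', h1, hQ m' h2⟩

theorem Runs.skip {m : Memory} {T : ℕ} {Q : Memory → Prop} (hT : 1 ≤ T) (h : Q m) :
    Runs .skip m T Q := ⟨1, hT, m, .skip m, h⟩

theorem Runs.setNat {m : Memory} {a : ℕ} {i j x : NatExpr} {T : ℕ} {Q : Memory → Prop}
    (hT : i.cost + j.cost + x.cost + 1 ≤ T) (h : Q (m.setNat a (i.eval m) (j.eval m) (x.eval m))) :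
    Runs (.setNat a i j x) m T Q := ⟨_, hT, _, .setNat m a i j x, h⟩

theorem Runs.setReal {m : Memory} {a : ℕ} {i j : NatExpr} {x : RealExpr} {T : ℕ} {Q : Memory → Prop}
    (hT : i.cost + j.cost + x.cost + 1 ≤ T) (h : Q (m.setReal a (i.eval m) (j.eval m) (x.eval m))) :
    Runs (.setReal a i j x) m T Q := ⟨_, hT, _, .setReal m a i j x, h⟩

theorem Runs.flip {m : Memory} {a : ℕ} {i j : NatExpr} {T : ℕ} {Q : Memory → Prop}
    (hT : i.cost + j.cost + 1 ≤ T)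
    (h : Q (m.dropCoin.setNat a (i.eval m) (j.eval m) (m.coins 0).toNat)) :
    Runs (.flip a i j) m T Q := ⟨_, hT, _, .flip m a i j, h⟩

theorem Runs.seq {P P' : Prog} {m : Memory} {T₁ T₂ T : ℕ} {R Q : Memory → Prop}
    (h : Runs P m T₁ R) (h' : ∀ m', R m' → Runs P' m' T₂ Q) (hT : T₁ + T₂ ≤ T) :
    Runs (.seq P P') m T Q := by
  obtain ⟨s, hs, m₁, h1, h2⟩ := h
  obtain ⟨t, ht, m₂, h3, h4⟩ := h' m₁ h2
  exact ⟨s + t, by omega, m₂, .seq h1 h3, h4⟩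

theorem Runs.ite {b : Test} {P P' : Prog} {m : Memory} {T' T : ℕ} {Q : Memory → Prop}
    (h : b.Holds m → Runs P m T' Q) (h' : ¬ b.Holds m → Runs P' m T' Q) (hT : b.cost + 1 + T' ≤ T) :
    Runs (.ite b P P') m T Q := by
  by_cases hb : b.Holds m
  · obtain ⟨t, ht, m', h1, h2⟩ := h hb
    exact ⟨_, by omega, m', .iteTrue hb h1, h2⟩
  · obtain ⟨t, ht, m', h1, h2⟩ := h' hb
    exact ⟨_, by omega, m', .iteFalse hb h1, h2⟩

/-- A scalar variable. -/
abbrev NatExpr.var (a : ℕ) : NatExpr := .get a (.lit 0) (.lit 0)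

/-- A cell of a one-dimensional array. -/
abbrev NatExpr.arr (a : ℕ) (i : NatExpr) : NatExpr := .get a i (.lit 0)

/-- A cell of a one-dimensional real array. -/
abbrev RealExpr.arr (a : ℕ) (i : NatExpr) : RealExpr := .get a i (.lit 0)

/-- Run `P` for the values `0, …, n - 1` of the variable `v`, where `n` is stored in the array `0`. -/
def Prog.forN (v : ℕ) (P : Prog) : Prog :=
  .seq (.setNat v (.lit 0) (.lit 0) (.lit 0))
    (.while (.natLt (.var v) (.var 0)) (.seq P (.setNat v (.lit 0) (.lit 0) (.add (.var v) (.lit 1)))))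

/-- The loop rule raises the exponent of the running time by one. The test and the increment cost 16
per round, and the initialization and the last test cost 12 more, whence 28. The body may change
neither the counter nor the bound, and the invariant ignores the counter cell. -/
theorem Runs.forN {v n a k : ℕ} {A R : Finset ℕ} {m : Memory} {I : ℕ → Memory → Prop} {P : Prog}
    (hn0 : 0 < n) (hn : m.nat 0 0 0 = n) (h0 : 0 ∉ insert v A) (hvA : v ∉ A)
    (hI : ∀ i m' x, I i m' → I i (m'.setNat v 0 0 x)) (hinit : I 0 m)
    (hbody : ∀ i < n, ∀ m', Frame (insert v A) R m m' → m'.nat v 0 0 = i → I i m' →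
      Runs P m' (a * n ^ k) fun m'' => Frame A R m' m'' ∧ I (i + 1) m'') :
    Runs (.forN v P) m ((a + 28) * n ^ (k + 1)) fun m' => Frame (insert v A) R m m' ∧ I n m' := by
  have key : ∀ l i m', i + l = n → Frame (insert v A) R m m' → m'.nat v 0 0 = i → I i m' →
      Runs (.while (.natLt (.var v) (.var 0))
        (.seq P (.setNat v (.lit 0) (.lit 0) (.add (.var v) (.lit 1))))) m' (l * (a * n ^ k + 16) + 8)
        fun m' => Frame (insert v A) R m m' ∧ I n m' := by
    intro l
    induction l with
    | zero =>
      intro i m' hi hF hv hIi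
      obtain rfl : i = n := by omega
      refine ⟨8, by omega, m', .whileFalse ?_, hF, hIi⟩
      simp [Test.Holds, NatExpr.eval, hv, hF.1 0 h0, hn]
    | succ l ih =>
      intro i m' hi hF hv hIi
      obtain ⟨s, hs, m₁, h1, hF1, hI1⟩ := hbody i (by omega) m' hF hv hIi
      have hv1 : m₁.nat v 0 0 = i := by rw [hF1.1 v hvA, hv]
      have hF2 := (hF.trans (hF1.mono (subset_insert v A) subset_rfl)).setNat
        (mem_insert_self v A) 0 0 (i + 1)
      obtain ⟨t, ht, m₂, h2, h3⟩ := ih (i + 1) (m₁.setNat v 0 0 (i + 1)) (by omega) hF2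
        (by simp [Memory.setNat_nat]) (hI _ _ _ hI1)
      refine ⟨8 + (s + 8) + t, by rw [Nat.succ_mul]; omega, m₂, ?_, h3⟩
      refine .whileTrue (m₂ := m₁.setNat v 0 0 (i + 1)) ?_ (.seq h1 ?_) h2
      · simp only [Test.Holds, NatExpr.eval, hv, hF.1 0 h0, hn]
        omega
      · have := Exec.setNat m₁ v (.lit 0) (.lit 0) (.add (.var v) (.lit 1))
        simpa [NatExpr.eval, hv1, NatExpr.cost] using this
  refine Runs.seq (T₁ := 4) (R := fun m' => m' = m.setNat v 0 0 0) (.setNat le_rfl rfl)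
    (fun m' hm' => ?_) ?_ (T₂ := n * (a * n ^ k + 16) + 8)
  · subst hm'
    exact key n 0 _ (zero_add n) ((Frame.refl _ _ _).setNat (mem_insert_self v A) _ _ _)
      (by simp [Memory.setNat_nat]) (hI _ _ _ hinit)
  · have h1 : n ≤ n ^ (k + 1) := Nat.le_self_pow (by omega) n
    have h2 : n * (a * n ^ k + 16) = a * n ^ (k + 1) + 16 * n := by ring
    rw [h2, add_mul]
    omega

/-! ### Programs without coin flips -/

/-- The program flips no coins. -/
def Prog.NoFlip : Prog → Prop
  | .skip | .setNat .. | .setReal .. => True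
  | .flip .. => False
  | .seq P Q | .ite _ P Q => P.NoFlip ∧ Q.NoFlip
  | .while _ P => P.NoFlip

/-- The memory with other coins. -/
def Memory.withCoins (m : Memory) (r : ℕ → Bool) : Memory := { m with coins := r }

theorem NatExpr.eval_withCoins (x : NatExpr) (m : Memory) (r : ℕ → Bool) :
    x.eval (m.withCoins r) = x.eval m := by
  induction x with
  | lit => rfl
  | get a i j hi hj => simp only [NatExpr.eval, hi, hj]; rfl
  | add x y hx hy | sub x y hx hy => simp only [NatExpr.eval, hx, hy]

theorem RealExpr.eval_withCoins (x : RealExpr) (m : Memory) (r : ℕ → Bool) :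
    x.eval (m.withCoins r) = x.eval m := by
  induction x with
  | ofNat x => simp only [RealExpr.eval, NatExpr.eval_withCoins]
  | get a i j => simp only [RealExpr.eval, NatExpr.eval_withCoins]; rfl
  | add x y hx hy | sub x y hx hy | mul x y hx hy | div x y hx hy =>
    simp only [RealExpr.eval, hx, hy]

theorem Test.holds_withCoins (b : Test) (m : Memory) (r : ℕ → Bool) :
    b.Holds (m.withCoins r) ↔ b.Holds m := by
  induction b with
  | natEq | natLt => simp only [Test.Holds, NatExpr.eval_withCoins]
  | realEq | realLt => simp only [Test.Holds, RealExpr.eval_withCoins]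
  | not b hb => simp only [Test.Holds, hb]
  | and b c hb hc => simp only [Test.Holds, hb, hc]

/-- This shows that the computed levels are the same for all coin streams, as independence of the
sample requires. -/
theorem Exec.withCoins {P : Prog} {m m' : Memory} {t : ℕ} (h : Exec P m t m') (hP : P.NoFlip)
    (r : ℕ → Bool) : Exec P (m.withCoins r) t (m'.withCoins r) := by
  induction h with
  | skip => exact .skip _
  | setNat m a i j x =>
    have := Exec.setNat (m.withCoins r) a i j x
    simp only [NatExpr.eval_withCoins] at this
    exact this
  | setReal m a i j x =>
    have := Exec.setReal (m.withCoins r) a i j x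
    simp only [NatExpr.eval_withCoins, RealExpr.eval_withCoins] at this
    exact this
  | flip => exact hP.elim
  | seq _ _ ih₁ ih₂ => exact .seq (ih₁ hP.1) (ih₂ hP.2)
  | iteTrue hb _ ih => exact .iteTrue ((Test.holds_withCoins _ _ r).2 hb) (ih hP.1)
  | iteFalse hb _ ih => exact .iteFalse (mt (Test.holds_withCoins _ _ r).1 hb) (ih hP.2)
  | whileTrue hb _ _ ih₁ ih₂ =>
    exact .whileTrue ((Test.holds_withCoins _ _ r).2 hb) (ih₁ hP) (ih₂ hP)
  | whileFalse hb => exact .whileFalse (mt (Test.holds_withCoins _ _ r).1 hb)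

end RealRAM

namespace RealRAM

/-! ### The sparsification program -/

/-- Set the variable `14` to `1` if right multiplication by the element in the variable `12` does not
move the set in the array `5` off itself, and to `0` otherwise. -/
def meetsProg : Prog :=
  .seq (.setNat 14 (.lit 0) (.lit 0) (.lit 0)) <| .forN 13 <|
    .ite (.and (.natEq (.arr 5 (.var 13)) (.lit 1))
      (.natEq (.arr 5 (.get 1 (.var 13) (.var 12))) (.lit 1)))
      (.setNat 14 (.lit 0) (.lit 0) (.lit 1)) .skip

/-- Find the heaviest generator without a level that moves the set in the array `5` off itself. The
variable `15` tells whether there is one, and the variable `16` holds it. -/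
def selectProg : Prog :=
  .seq (.setNat 15 (.lit 0) (.lit 0) (.lit 0)) <| .forN 12 <|
    .ite (.and (.natEq (.arr 2 (.var 12)) (.lit 1)) (.natEq (.arr 4 (.var 12)) (.lit 0)))
      (.seq meetsProg <|
        .ite (.and (.natEq (.var 14) (.lit 0)) (.not (.and (.natEq (.var 15) (.lit 1))
            (.not (.realLt (.arr 0 (.var 16)) (.arr 0 (.var 12)))))))
          (.seq (.setNat 16 (.lit 0) (.lit 0) (.var 12)) (.setNat 15 (.lit 0) (.lit 0) (.lit 1)))
          .skip)
      .skip

/-- Replace the set `P` in the array `5` by `P ∪ P s`, where the variable `16` holds `s`. -/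
def extendProg : Prog :=
  .seq (.forN 12 (.setNat 6 (.var 12) (.lit 0) (.arr 5 (.var 12)))) <| .forN 12 <|
    .ite (.natEq (.arr 6 (.var 12)) (.lit 1))
      (.setNat 5 (.get 1 (.var 12) (.var 16)) (.lit 0) (.lit 1)) .skip

/-- One round of filling a level. -/
def roundProg : Prog :=
  .seq selectProg <| .ite (.natEq (.var 15) (.lit 1))
    (.seq (.setNat 4 (.var 16) (.lit 0) (.add (.var 10) (.lit 1))) extendProg) .skip

/-- Fill one level. -/
def levelProg : Prog :=
  .seq (.forN 12 (.setNat 5 (.var 12) (.lit 0) (.lit 0))) <|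
    .seq (.setNat 5 (.lit 0) (.lit 0) (.lit 1)) (.forN 11 roundProg)

/-- Store in the variable `17` the rounded binary logarithm of the order of the group. -/
def logProg : Prog :=
  .seq (.setNat 17 (.lit 0) (.lit 0) (.lit 0)) <| .seq (.setNat 18 (.lit 0) (.lit 0) (.lit 1)) <|
    .forN 11 <| .ite (.natLt (.var 18) (.var 0))
      (.seq (.setNat 18 (.lit 0) (.lit 0) (.add (.var 18) (.var 18)))
        (.setNat 17 (.lit 0) (.lit 0) (.add (.var 17) (.lit 1)))) .skip

/-- Compute the levels of all generators. -/
def levelsProg : Prog := .seq logProg (.forN 10 levelProg)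

/-! ### Correctness and running time of the level computation. -/

theorem exists_index {G : Type*} [Fintype G] (e : G ≃ Fin (Fintype.card G)) {i : ℕ} (hi : i < Fintype.card G) :
    ∃ g, (e g : ℕ) = i := ⟨e.symm ⟨i, hi⟩, by simp⟩

theorem index_inj {G : Type*} [Fintype G] {e : G ≃ Fin (Fintype.card G)} {g h : G} : (e g : ℕ) = e h ↔ g = h := by
  rw [Fin.val_inj, e.apply_eq_iff_eq]

theorem index_lt_succ {G : Type*} [Fintype G] {e : G ≃ Fin (Fintype.card G)} {g h : G} : (e g : ℕ) < e h + 1 ↔ (e g : ℕ) < e h ∨ g = h := by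
  rw [Nat.lt_succ_iff_lt_or_eq, index_inj]

section Spec

variable {G : Type*} [Group G] [Fintype G] {e : G ≃ Fin (Fintype.card G)} {S : Finset G}
  {w : G → ℝ} {ε : ℝ} {m : Memory}

/-- The memory holds the input. -/
structure HasInput (e : G ≃ Fin (Fintype.card G)) (S : Finset G) (w : G → ℝ) (ε : ℝ) (m : Memory) :
    Prop where
  card : m.nat 0 0 0 = Fintype.card G
  mul : ∀ g h, m.nat 1 (e g) (e h) = e (g * h)
  mem : ∀ g, m.nat 2 (e g) 0 = 1 ↔ g ∈ S
  weight : ∀ g ∈ S, m.real 0 (e g) 0 = w g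
  eps : m.real 1 0 0 = ε

theorem HasInput.frame {A R : Finset ℕ} {m' : Memory} (h : HasInput e S w ε m) (hF : Frame A R m m')
    (h0 : 0 ∉ A) (h1 : 1 ∉ A) (h2 : 2 ∉ A) (h3 : 0 ∉ R) (h4 : 1 ∉ R) : HasInput e S w ε m' where
  card := by rw [hF.1 0 h0, h.card]
  mul g k := by rw [hF.1 1 h1, h.mul]
  mem g := by rw [hF.1 2 h2, h.mem]
  weight g hg := by rw [hF.2 0 h3, h.weight g hg]
  eps := by rw [hF.2 1 h4, h.eps]

/-- The array `5` is the indicator of `P`. -/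
def HoldsSet (e : G ≃ Fin (Fintype.card G)) (P : Finset G) (m : Memory) : Prop :=
  ∀ g, m.nat 5 (e g) 0 = 1 ↔ g ∈ P

/-- The array `4` holds the levels. -/
def HoldsLevels (e : G ≃ Fin (Fintype.card G)) (lev : G → ℕ) (m : Memory) : Prop :=
  ∀ g, m.nat 4 (e g) 0 = lev g

theorem runs_meetsProg (hm : HasInput e S w ε m) {P : Finset G} (hP : HoldsSet e P m) {s : G}
    (hs : m.nat 12 0 0 = e s) : Runs meetsProg m (100 * Fintype.card G ^ 1) fun m' =>
      Frame {13, 14} ∅ m m' ∧ (m'.nat 14 0 0 = 0 ↔ ¬ Meets P s) := by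
  have hn : 1 ≤ Fintype.card G := Fintype.card_pos
  refine Runs.seq (T₁ := 4) (.setNat le_rfl rfl) (fun m₁ hm₁ => Runs.mono (Runs.forN
    (m := m₁) (A := {14}) (R := ∅) (n := Fintype.card G) (a := 40) (k := 0)
    (I := fun i m' => m'.nat 14 0 0 = 0 ↔ ∀ p, (e p : ℕ) < i → ¬ (p ∈ P ∧ p * s ∈ P))
    hn ?_ (by decide) (by decide) ?_ ?_ ?_) le_rfl ?_) ?_
  · simp [← hm₁, Memory.setNat_nat, hm.card]
  · intro i m' x h
    simpa [Memory.setNat_nat] using h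
  · simp [← hm₁, Memory.setNat_nat, NatExpr.eval]
  · intro i hi m' hF hv hI
    obtain ⟨p, rfl⟩ := exists_index e hi
    have hF' : Frame {13, 14} ∅ m m' := by
      rw [← hm₁] at hF
      exact ((Frame.refl _ _ m).setNat (by decide) _ _ _).trans hF
    have hm' := hm.frame hF' (by decide) (by decide) (by decide) (by decide) (by decide)
    have h5 : ∀ g, m'.nat 5 (e g) 0 = 1 ↔ g ∈ P := by rw [hF'.1 5 (by decide)]; exact hP
    have h12 : m'.nat 12 0 0 = e s := by rw [hF'.1 12 (by decide), hs]
    have hb : (Test.and (.natEq (.arr 5 (.var 13)) (.lit 1))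
        (.natEq (.arr 5 (.get 1 (.var 13) (.var 12))) (.lit 1))).Holds m' ↔ p ∈ P ∧ p * s ∈ P := by
      simp only [Test.Holds, NatExpr.eval, hv, h12, hm'.mul, h5]
    refine .ite (T' := 5) (fun h => .setNat (by simp [NatExpr.cost]) ?_) (fun h => .skip (by simp) ?_)
      (by simp [Test.cost, NatExpr.cost])
    · refine ⟨(Frame.refl _ _ _).setNat (by decide) _ _ _, ?_⟩
      simp only [Memory.setNat_nat, NatExpr.eval]
      simp only [and_self, if_true, one_ne_zero, false_iff, not_forall, not_not]
      exact ⟨p, Nat.lt_succ_self _, hb.1 h⟩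
    · refine ⟨Frame.refl _ _ _, hI.trans ⟨fun H q hq => ?_, fun H q hq => H q (by omega)⟩⟩
      rcases index_lt_succ.1 hq with hq | rfl
      · exact H q hq
      · exact fun h' => h (hb.2 h')
  · rintro m' ⟨hF, hI⟩
    refine ⟨?_, hI.trans ⟨fun H ⟨p, hp⟩ => H p (e p).2 hp, fun H p _ hp => H ⟨p, hp⟩⟩⟩
    rw [← hm₁] at hF
    exact ((Frame.refl _ _ m).setNat (by decide) _ _ _).trans hF
  · simp only [pow_one, zero_add]; omega

theorem runs_selectProg (hm : HasInput e S w ε m) {P : Finset G} (hP : HoldsSet e P m)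
    {lev : G → ℕ} (hlev : HoldsLevels e lev m) :
    Runs selectProg m (200 * Fintype.card G ^ 2) fun m' => Frame {12, 13, 14, 15, 16} ∅ m m' ∧
      ((m'.nat 15 0 0 ≠ 1 ∧ ∀ s ∈ S, lev s = 0 → Meets P s) ∨
        m'.nat 15 0 0 = 1 ∧ ∃ s ∈ S, m'.nat 16 0 0 = e s ∧ lev s = 0 ∧ ¬ Meets P s ∧
          ∀ u ∈ S, lev u = 0 → ¬ Meets P u → w u ≤ w s) := by
  have hn : 1 ≤ Fintype.card G := Fintype.card_pos
  have hn2 : Fintype.card G ≤ Fintype.card G ^ 2 := Nat.le_self_pow (by omega) _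
  refine Runs.seq (T₁ := 4) (.setNat le_rfl rfl) (fun m₁ hm₁ => Runs.mono (Runs.forN
    (m := m₁) (A := {13, 14, 15, 16}) (R := ∅) (n := Fintype.card G) (a := 160) (k := 1)
    (I := fun i m' =>
      (m'.nat 15 0 0 ≠ 1 ∧ ∀ s ∈ S, (e s : ℕ) < i → lev s = 0 → Meets P s) ∨
        m'.nat 15 0 0 = 1 ∧ ∃ s ∈ S, m'.nat 16 0 0 = e s ∧ lev s = 0 ∧ ¬ Meets P s ∧
          ∀ u ∈ S, (e u : ℕ) < i → lev u = 0 → ¬ Meets P u → w u ≤ w s)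
    hn ?_ (by decide) (by decide) ?_ ?_ ?_) le_rfl ?_) ?_
  · simp [← hm₁, Memory.setNat_nat, hm.card]
  · intro i m' x h
    simpa [Memory.setNat_nat] using h
  · simp [← hm₁, Memory.setNat_nat, NatExpr.eval]
  · intro i hi m' hF hv hI
    obtain ⟨s, rfl⟩ := exists_index e hi
    have hF' : Frame {12, 13, 14, 15, 16} ∅ m m' := by
      rw [← hm₁] at hF
      exact ((Frame.refl _ _ m).setNat (by decide) _ _ _).trans hF
    have hm' := hm.frame hF' (by decide) (by decide) (by decide) (by decide) (by decide)
    have h5 : HoldsSet e P m' := by unfold HoldsSet; rw [hF'.1 5 (by decide)]; exact hP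
    have h4 : HoldsLevels e lev m' := by unfold HoldsLevels; rw [hF'.1 4 (by decide)]; exact hlev
    -- Shared by the two branches that leave the current selection alone: `s` is either no candidate
    -- or no heavier than the selected one.
    have hskip : ∀ m'' : Memory, m''.nat 15 = m'.nat 15 → m''.nat 16 = m'.nat 16 →
        (s ∈ S → lev s = 0 → ¬ Meets P s → ∃ b ∈ S, m'.nat 15 0 0 = 1 ∧ m'.nat 16 0 0 = e b ∧
          w s ≤ w b) →
        (m''.nat 15 0 0 ≠ 1 ∧ ∀ s' ∈ S, (e s' : ℕ) < e s + 1 → lev s' = 0 → Meets P s') ∨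
        m''.nat 15 0 0 = 1 ∧ ∃ s' ∈ S, m''.nat 16 0 0 = e s' ∧ lev s' = 0 ∧ ¬ Meets P s' ∧
          ∀ u ∈ S, (e u : ℕ) < e s + 1 → lev u = 0 → ¬ Meets P u → w u ≤ w s' := by
      intro m'' e15 e16 hs
      rw [e15, e16]
      rcases hI with ⟨hf, hI⟩ | ⟨hf, b, hbS, hb, hb0, hbm, hI⟩
      · refine Or.inl ⟨hf, fun u hu hlt hu0 => ?_⟩
        rcases index_lt_succ.1 hlt with hlt | rfl
        · exact hI u hu hlt hu0
        · by_contra hum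
          obtain ⟨b, -, hb, -⟩ := hs hu hu0 hum
          exact hf hb
      · refine Or.inr ⟨hf, b, hbS, hb, hb0, hbm, fun u hu hlt hu0 hum => ?_⟩
        rcases index_lt_succ.1 hlt with hlt | rfl
        · exact hI u hu hlt hu0 hum
        · obtain ⟨b', -, -, hb', hw'⟩ := hs hu hu0 hum
          obtain rfl : b' = b := index_inj.1 (hb'.symm.trans hb)
          exact hw'
    refine .ite (T' := 140 * Fintype.card G) (fun hc => ?_) (fun hc => ?_) ?_
    · simp only [Test.Holds, NatExpr.eval, hv, hm'.mem, h4 s] at hc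
      refine Runs.seq (runs_meetsProg hm' h5 hv) (fun m₂ hm₂ => ?_)
        (T₂ := 40) (by rw [pow_one]; omega)
      obtain ⟨hF₂, h14⟩ := hm₂
      have hv₂ : m₂.nat 12 0 0 = e s := by rw [hF₂.1 12 (by decide), hv]
      have hr₂ : m₂.real 0 = m.real 0 := by rw [hF₂.2 0 (by decide), hF'.2 0 (by decide)]
      have e15 : m₂.nat 15 = m'.nat 15 := hF₂.1 15 (by decide)
      have e16 : m₂.nat 16 = m'.nat 16 := hF₂.1 16 (by decide)
      refine .ite (T' := 12) (fun hb => ?_) (fun hb => ?_) (by simp [Test.cost, NatExpr.cost, RealExpr.cost])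
      · simp only [Test.Holds, NatExpr.eval, RealExpr.eval, hv₂, hr₂, h14, e15, e16, not_and,
          not_not] at hb
        refine .seq (T₁ := 6) (T₂ := 4) (.setNat le_rfl rfl) (fun m₃ hm₃ => .setNat le_rfl ?_) (by norm_num)
        subst hm₃
        refine ⟨(((hF₂.mono (by decide) (by decide)).setNat (by decide) _ _ _).setNat
          (by decide) _ _ _), Or.inr ⟨by simp [Memory.setNat_nat, NatExpr.eval], s, hc.1,
          by simp [Memory.setNat_nat, NatExpr.eval, hv₂], hc.2, hb.1, fun u hu hlt hu0 hum => ?_⟩⟩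
        rcases index_lt_succ.1 hlt with hlt | rfl
        · rcases hI with ⟨hf, hI⟩ | ⟨hf, b, hbS, hb', hb0, hbm, hI⟩
          · exact absurd (hI u hu hlt hu0) hum
          · have := hb.2 hf
            rw [hb', hm.weight b hbS, hm.weight s hc.1] at this
            exact (hI u hu hlt hu0 hum).trans this.le
        · exact le_rfl
      · simp only [Test.Holds, NatExpr.eval, RealExpr.eval, hv₂, hr₂, h14, e15, e16, not_and,
          not_not] at hb
        refine .skip (by norm_num) ⟨hF₂.mono (by decide) (by decide), hskip m₂ e15 e16
          fun hs hs0 hsm => ?_⟩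
        have hb' := hb hsm
        push Not at hb'
        rcases hI with ⟨hf, hI⟩ | ⟨hf, b, hbS, hbe, hb0, hbm, hI⟩
        · exact absurd hb'.1 hf
        · refine ⟨b, hbS, hf, hbe, ?_⟩
          have := hb'.2
          rwa [hbe, hm.weight b hbS, hm.weight s hs] at this
    · simp only [Test.Holds, NatExpr.eval, hv, hm'.mem, h4 s] at hc
      exact .skip (by omega) ⟨Frame.refl _ _ _, hskip m' rfl rfl fun hs hs0 => absurd ⟨hs, hs0⟩ hc⟩
    · simp only [Test.cost, NatExpr.cost, pow_one]; omega
  · rintro m' ⟨hF, hI⟩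
    refine ⟨?_, ?_⟩
    · rw [← hm₁] at hF
      exact ((Frame.refl _ _ m).setNat (by decide) _ _ _).trans hF
    · rcases hI with ⟨hf, hI⟩ | ⟨hf, b, hbS, hb, hb0, hbm, hI⟩
      · exact Or.inl ⟨hf, fun u hu => hI u hu (e u).2⟩
      · exact Or.inr ⟨hf, b, hbS, hb, hb0, hbm, fun u hu => hI u hu (e u).2⟩
  · norm_num; omega

/-- The array `6` keeps a copy of `P`, because the array `5` changes while the translates are added.
-/
theorem runs_extendProg [DecidableEq G] (hm : HasInput e S w ε m) {P : Finset G}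
    (hP : HoldsSet e P m) {s : G} (hs : m.nat 16 0 0 = e s) :
    Runs extendProg m (100 * Fintype.card G ^ 1) fun m' => Frame {5, 6, 12} ∅ m m' ∧
      HoldsSet e (P ∪ P.image (· * s)) m' := by
  have hn : 1 ≤ Fintype.card G := Fintype.card_pos
  refine Runs.seq (Runs.forN (m := m) (A := {6}) (R := ∅) (n := Fintype.card G) (a := 10) (k := 0)
    (I := fun i m' => ∀ g, (e g : ℕ) < i → (m'.nat 6 (e g) 0 = 1 ↔ g ∈ P))
    hn hm.card (by decide) (by decide) ?_ ?_ ?_) (fun m₁ hm₁ => Runs.mono (Runs.forN (m := m₁)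
    (A := {5}) (R := ∅) (n := Fintype.card G) (a := 18) (k := 0)
    (I := fun i m' => ∀ g, m'.nat 5 (e g) 0 = 1 ↔ g ∈ P ∨ ∃ p ∈ P, (e p : ℕ) < i ∧ p * s = g)
    hn ?_ (by decide) (by decide) ?_ ?_ ?_) le_rfl ?_) ?_
  · intro i m' x h
    simpa [Memory.setNat_nat] using h
  · intro g hg; omega
  · intro i hi m' hF hv hI
    obtain ⟨p, rfl⟩ := exists_index e hi
    refine .setNat (by simp [NatExpr.cost]) ⟨(Frame.refl _ _ _).setNat (by decide) _ _ _, ?_⟩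
    intro g hg
    simp only [Memory.setNat_nat, NatExpr.eval, hv, index_inj, hF.1 5 (by decide)]
    rcases index_lt_succ.1 hg with hg | rfl
    · have : g ≠ p := by rintro rfl; omega
      simpa [this] using hI g hg
    · simpa using hP g
  · rw [hm₁.1.1 0 (by decide), hm.card]
  · intro i m' x h
    simpa [Memory.setNat_nat] using h
  · intro g
    rw [hm₁.1.1 5 (by decide), hP g]
    simp
  · intro i hi m' hF hv hI
    obtain ⟨p, rfl⟩ := exists_index e hi
    have hm' := (hm.frame hm₁.1 (by decide) (by decide) (by decide) (by decide) (by decide)).frame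
      hF (by decide) (by decide) (by decide) (by decide) (by decide)
    have h16 : m'.nat 16 0 0 = e s := by rw [hF.1 16 (by decide), hm₁.1.1 16 (by decide), hs]
    have h6 : m'.nat 6 (e p) 0 = 1 ↔ p ∈ P := by
      rw [hF.1 6 (by decide)]; exact hm₁.2 p (e p).2
    refine .ite (T' := 10) (fun hc => ?_) (fun hc => ?_) (by simp [Test.cost, NatExpr.cost])
    · simp only [Test.Holds, NatExpr.eval, hv, h6] at hc
      refine .setNat (by simp [NatExpr.cost]) ⟨(Frame.refl _ _ _).setNat (by decide) _ _ _, ?_⟩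
      intro g
      simp only [Memory.setNat_nat, NatExpr.eval, hv, h16, hm'.mul, index_inj]
      by_cases hg : g = p * s
      · simp only [hg, and_self, if_true, true_iff]
        exact Or.inr ⟨p, hc, Nat.lt_succ_self _, rfl⟩
      · simp only [hg, false_and, and_false, if_false, hI g]
        refine or_congr_right ⟨fun ⟨q, hq, hlt, h⟩ => ⟨q, hq, by omega, h⟩,
          fun ⟨q, hq, hlt, h⟩ => ?_⟩
        rcases index_lt_succ.1 hlt with hlt | rfl
        · exact ⟨q, hq, hlt, h⟩
        · exact absurd h.symm hg
    · simp only [Test.Holds, NatExpr.eval, hv, h6] at hc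
      refine .skip (by norm_num) ⟨Frame.refl _ _ _, fun g => (hI g).trans (or_congr_right
        ⟨fun ⟨q, hq, hlt, h⟩ => ⟨q, hq, by omega, h⟩, fun ⟨q, hq, hlt, h⟩ => ?_⟩)⟩
      rcases index_lt_succ.1 hlt with hlt | rfl
      · exact ⟨q, hq, hlt, h⟩
      · exact absurd hq hc
  · rintro m' ⟨hF, hI⟩
    refine ⟨(hm₁.1.mono (by decide) (by decide)).trans (hF.mono (by decide) (by decide)), fun g => ?_⟩
    rw [hI g, mem_union, mem_image]
    exact or_congr_right ⟨fun ⟨q, hq, _, h⟩ => ⟨q, hq, h⟩, fun ⟨q, hq, h⟩ => ⟨q, hq, (e q).2, h⟩⟩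
  · simp only [pow_one, zero_add]; omega

theorem runs_roundProg [DecidableEq G] (hw : ∀ s ∈ S, 0 ≤ w s) {K j t : ℕ}
    (hK : Fintype.card G ≤ 2 ^ K) (hm : HasInput e S w ε m) (hj : m.nat 10 0 0 = j)
    {P : Finset G} (hP : HoldsSet e P m) {lev : G → ℕ} (hlev : HoldsLevels e lev m)
    (h : LevelFilling S w K j lev P t) :
    Runs roundProg m (400 * Fintype.card G ^ 2) fun m' =>
      Frame {4, 5, 6, 12, 13, 14, 15, 16} ∅ m m' ∧ ∃ lev' P', HoldsLevels e lev' m' ∧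
        HoldsSet e P' m' ∧ LevelFilling S w K j lev' P' (t + 1) := by
  have hn : 1 ≤ Fintype.card G := Fintype.card_pos
  have hn2 : Fintype.card G ≤ Fintype.card G ^ 2 := Nat.le_self_pow (by omega) _
  refine Runs.seq (runs_selectProg hm hP hlev) (fun m₁ ⟨hF, hsel⟩ => Runs.ite
    (T' := 10 + 100 * Fintype.card G) (T := 200 * Fintype.card G ^ 2)
    (fun hc => ?_) (fun hc => ?_) ?_) (by omega)
  · simp only [Test.Holds, NatExpr.eval] at hc
    obtain ⟨-, s, hsS, hs, hs0, hsm, hmax⟩ := hsel.resolve_left fun h => h.1 hc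
    refine Runs.seq (T₁ := 10) (T₂ := 100 * Fintype.card G ^ 1) (.setNat le_rfl rfl)
      (fun m₂ hm₂ => ?_) (by rw [pow_one])
    have hF₂ : Frame {4, 5, 6, 12, 13, 14, 15, 16} ∅ m m₂ := by
      subst hm₂
      exact (hF.mono (by decide) (by decide)).setNat (by decide) _ _ _
    have hP₂ : HoldsSet e P m₂ := by
      subst hm₂
      unfold HoldsSet
      rw [Memory.setNat_nat_of_ne _ (by decide), hF.1 5 (by decide)]
      exact hP
    have hlev₂ : HoldsLevels e (Function.update lev s (j + 1)) m₂ := by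
      subst hm₂
      intro g
      have := hlev g
      simp only [Memory.setNat_nat, NatExpr.eval, hs, index_inj, Function.update_apply,
        hF.1 4 (by decide), hF.1 10 (by decide), hj, this]
      simp
    have hs₂ : m₂.nat 16 0 0 = e s := by
      subst hm₂
      rw [Memory.setNat_nat_of_ne _ (by decide), hs]
    refine (runs_extendProg (hm.frame hF₂ (by decide) (by decide) (by decide) (by decide)
      (by decide)) hP₂ hs₂).mono le_rfl fun m' ⟨hF', hP'⟩ =>
        ⟨hF₂.trans (hF'.mono (by decide) (by decide)), _, _, ?_, hP',
        h.step hw hK hsS hs0 hsm hmax⟩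
    unfold HoldsLevels
    rw [hF'.1 4 (by decide)]
    exact hlev₂
  · simp only [Test.Holds, NatExpr.eval] at hc
    obtain ⟨-, hfin⟩ := hsel.resolve_right fun h => hc h.1
    refine .skip (by omega) ⟨hF.mono (by decide) (by decide), lev, P, ?_, ?_, h.of_finished hfin⟩
    · unfold HoldsLevels
      rw [hF.1 4 (by decide)]
      exact hlev
    · unfold HoldsSet
      rw [hF.1 5 (by decide)]
      exact hP
  · simp only [Test.cost, NatExpr.cost]; omega

theorem runs_levelProg (hw : ∀ s ∈ S, 0 ≤ w s) {K j : ℕ}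
    (hK : Fintype.card G ≤ 2 ^ K) (hm : HasInput e S w ε m) (hj : m.nat 10 0 0 = j)
    {lev : G → ℕ} (hlev : HoldsLevels e lev m)
    (h : LevelsFilled S w K j lev) (hle : ∀ s, lev s ≤ j) :
    Runs levelProg m (500 * Fintype.card G ^ 3) fun m' =>
      Frame {4, 5, 6, 11, 12, 13, 14, 15, 16} ∅ m m' ∧ ∃ lev', HoldsLevels e lev' m' ∧
        LevelsFilled S w K (j + 1) lev' ∧ ∀ s, lev' s ≤ j + 1 := by
  classical
  have hn : 1 ≤ Fintype.card G := Fintype.card_pos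
  have hn3 : Fintype.card G ≤ Fintype.card G ^ 3 := Nat.le_self_pow (by omega) _
  -- The program starts every level from the element with the index 0, whichever it is.
  obtain ⟨g₀, hg₀⟩ := exists_index e hn
  refine Runs.seq (Runs.forN (m := m) (A := {5}) (R := ∅) (n := Fintype.card G) (a := 6) (k := 0)
    (I := fun i m' => ∀ g, (e g : ℕ) < i → m'.nat 5 (e g) 0 = 0)
    hn hm.card (by decide) (by decide) ?_ ?_ ?_) (fun m₁ ⟨hF₁, hm₁⟩ => Runs.seq (T₁ := 4)
    (.setNat le_rfl rfl) (fun m₂ hm₂ => Runs.mono (Runs.forN (m := m₂)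
    (A := {4, 5, 6, 12, 13, 14, 15, 16}) (R := ∅) (n := Fintype.card G) (a := 400) (k := 2)
    (I := fun t m' => ∃ lev' P', HoldsLevels e lev' m' ∧
        HoldsSet e P' m' ∧ LevelFilling S w K j lev' P' t)
    hn ?_ (by decide) (by decide) ?_ ?_ ?_) le_rfl ?_) le_rfl) ?_
  · intro i m' x h
    simpa [Memory.setNat_nat] using h
  · intro g hg; omega
  · intro i hi m' hF hv hI
    obtain ⟨p, rfl⟩ := exists_index e hi
    refine .setNat (by simp [NatExpr.cost]) ⟨(Frame.refl _ _ _).setNat (by decide) _ _ _, ?_⟩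
    intro g hg
    simp only [Memory.setNat_nat, NatExpr.eval, hv, index_inj]
    rcases index_lt_succ.1 hg with hg | rfl
    · have : g ≠ p := by rintro rfl; omega
      simpa [this] using hI g hg
    · simp
  · rw [← hm₂, Memory.setNat_nat_of_ne _ (by decide), hF₁.1 0 (by decide), hm.card]
  · rintro i m' x ⟨lev', P', h1, h2, h3⟩
    refine ⟨lev', P', ?_, ?_, h3⟩
    · unfold HoldsLevels
      rw [Memory.setNat_nat_of_ne _ (by decide)]
      exact h1
    · unfold HoldsSet
      rw [Memory.setNat_nat_of_ne _ (by decide)]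
      exact h2
  · refine ⟨lev, {g₀}, ?_, ?_, h.levelFilling hle g₀⟩
    · unfold HoldsLevels
      rw [← hm₂, Memory.setNat_nat_of_ne _ (by decide), hF₁.1 4 (by decide)]
      exact hlev
    · intro g
      have h0 : ((e g : ℕ) = 0) ↔ g = g₀ := by rw [← hg₀, index_inj]
      rw [← hm₂, mem_singleton]
      simp only [Memory.setNat_nat, NatExpr.eval, h0, hm₁ g (e g).2]
      simp
  · rintro t ht m' hF hv ⟨lev', P', h1, h2, h3⟩
    have hF' : Frame {4, 5, 6, 11, 12, 13, 14, 15, 16} ∅ m m' := by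
      subst hm₂
      exact ((hF₁.mono (by decide) (by decide)).setNat (by decide) _ _ _).trans
        (hF.mono (by decide) (by decide))
    exact runs_roundProg hw hK (hm.frame hF' (by decide) (by decide) (by decide) (by decide)
      (by decide)) (by rw [hF'.1 10 (by decide), hj]) h2 h1 h3
  · rintro m' ⟨hF, lev', P', h1, h2, h3⟩
    subst hm₂
    exact ⟨((hF₁.mono (by decide) (by decide)).setNat (by decide) _ _ _).trans
      (hF.mono (by decide) (by decide)), lev', h1, h3.levelsFilled hK, h3.lev_le⟩
  · norm_num; omega

/-- The power in the variable `18` is doubled only while it is below |G|, so it ends below 2|G|; |G|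
rounds are enough since 2^i > i. -/
theorem runs_logProg (hm : m.nat 0 0 0 = Fintype.card G) :
    Runs logProg m (70 * Fintype.card G) fun m' => Frame {11, 17, 18} ∅ m m' ∧
      Fintype.card G ≤ 2 ^ m'.nat 17 0 0 ∧ 2 ^ m'.nat 17 0 0 < 2 * Fintype.card G := by
  have hn : 1 ≤ Fintype.card G := Fintype.card_pos
  refine Runs.seq (T₁ := 4) (.setNat le_rfl rfl) (fun m₁ hm₁ => Runs.seq (T₁ := 4)
    (.setNat le_rfl rfl) (fun m₂ hm₂ => Runs.mono (Runs.forN (m := m₂)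
    (A := {17, 18}) (R := ∅) (n := Fintype.card G) (a := 30) (k := 0)
    (I := fun i m' => m'.nat 18 0 0 = 2 ^ m'.nat 17 0 0 ∧
      (Fintype.card G ≤ m'.nat 18 0 0 ∨ i < m'.nat 18 0 0) ∧
      2 ^ m'.nat 17 0 0 < 2 * Fintype.card G)
    hn ?_ (by decide) (by decide) ?_ ?_ ?_) le_rfl ?_) le_rfl) ?_
  · rw [← hm₂, ← hm₁, Memory.setNat_nat_of_ne _ (by decide), Memory.setNat_nat_of_ne _ (by decide),
      hm]
  · intro i m' x h
    simpa [Memory.setNat_nat] using h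
  · simp only [← hm₂, ← hm₁, Memory.setNat_nat, NatExpr.eval]
    norm_num
    omega
  · rintro i hi m' hF hv ⟨h1, h2, h3⟩
    have h0 : m'.nat 0 0 0 = Fintype.card G := by
      rw [hF.1 0 (by decide), ← hm₂, ← hm₁, Memory.setNat_nat_of_ne _ (by decide),
        Memory.setNat_nat_of_ne _ (by decide), hm]
    refine .ite (T' := 18) (fun hc => ?_) (fun hc => ?_) (by simp [Test.cost, NatExpr.cost])
    · simp only [Test.Holds, NatExpr.eval, h0] at hc
      refine .seq (T₁ := 10) (T₂ := 8) (.setNat le_rfl rfl) (fun m₃ hm₃ => .setNat le_rfl ?_)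
        (by norm_num)
      subst hm₃
      refine ⟨((Frame.refl _ _ _).setNat (by decide) _ _ _).setNat (by decide) _ _ _, ?_⟩
      simp only [Memory.setNat_nat, NatExpr.eval]
      norm_num
      rw [pow_succ, ← h1]
      omega
    · simp only [Test.Holds, NatExpr.eval, h0] at hc
      exact .skip (by norm_num) ⟨Frame.refl _ _ _, h1, Or.inl (by omega), h3⟩
  · rintro m' ⟨hF, h1, h2, h3⟩
    subst hm₂ hm₁
    refine ⟨(((Frame.refl _ _ _).setNat (by decide) _ _ _).setNat (by decide) _ _ _).trans hF,
      by omega, h3⟩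
  · norm_num; omega

theorem runs_levelsProg (hw : ∀ s ∈ S, 0 ≤ w s) (hm : HasInput e S w ε m)
    (h4 : m.nat 4 = 0) :
    Runs levelsProg m (600 * Fintype.card G ^ 4) fun m' =>
      Frame {4, 5, 6, 10, 11, 12, 13, 14, 15, 16, 17, 18} ∅ m m' ∧
      Fintype.card G ≤ 2 ^ m'.nat 17 0 0 ∧ 2 ^ m'.nat 17 0 0 < 2 * Fintype.card G ∧
      ∃ lev, HoldsLevels e lev m' ∧
        LevelsFilled S w (m'.nat 17 0 0) (Fintype.card G) lev ∧ ∀ s, lev s ≤ Fintype.card G := by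
  have hn : 1 ≤ Fintype.card G := Fintype.card_pos
  have hn4 : Fintype.card G ≤ Fintype.card G ^ 4 := Nat.le_self_pow (by omega) _
  refine Runs.seq (runs_logProg hm.card) (fun m₁ ⟨hF₁, hK, hK'⟩ => Runs.mono (Runs.forN (m := m₁)
    (A := {4, 5, 6, 11, 12, 13, 14, 15, 16}) (R := ∅) (n := Fintype.card G) (a := 500) (k := 3)
    (I := fun j m' => ∃ lev, HoldsLevels e lev m' ∧
        LevelsFilled S w (m₁.nat 17 0 0) j lev ∧ ∀ s, lev s ≤ j)
    hn ?_ (by decide) (by decide) ?_ ?_ ?_) le_rfl ?_) ?_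
  · rw [hF₁.1 0 (by decide), hm.card]
  · rintro i m' x ⟨lev, h1, h2⟩
    refine ⟨lev, ?_, h2⟩
    unfold HoldsLevels
    rw [Memory.setNat_nat_of_ne _ (by decide)]
    exact h1
  · refine ⟨fun _ => 0, fun g => ?_, levelsFilled_zero, fun _ => le_rfl⟩
    rw [hF₁.1 4 (by decide), h4]
    rfl
  · rintro j hj m' hF hv ⟨lev, h1, h2, h3⟩
    exact runs_levelProg hw hK ((hm.frame hF₁ (by decide) (by decide) (by decide) (by decide)
      (by decide)).frame hF (by decide) (by decide) (by decide) (by decide) (by decide)) hv h1 h2 h3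
  · rintro m' ⟨hF, lev, h⟩
    have h17 : m'.nat 17 = m₁.nat 17 := hF.1 17 (by decide)
    rw [h17]
    exact ⟨(hF₁.mono (by decide) (by decide)).trans (hF.mono (by decide) (by decide)), hK, hK', lev, h⟩
  · norm_num; omega

end Spec

end RealRAM

namespace RealRAM

/-! ### Sampling with fair coins. -/

/-- The expression for `sampleScale`. -/
def scaleExpr (c : ℕ) : RealExpr :=
  .div (.mul (.mul (.ofNat (.lit (160 * (c + 2)))) (.ofNat (.var 17))) (.ofNat (.var 17)))
    (.mul (.arr 1 (.lit 0)) (.arr 1 (.lit 0)))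

/-- Flip the coins for the element in the variable `12`. The variable `19` tells whether the element
is kept, and the real variable `3` holds the inverse of the probability of this event. -/
def coinProg (c : ℕ) : Prog :=
  .forN 20 <| .seq (.flip 21 (.lit 0) (.lit 0)) <|
    .ite (.not (.realLt (.ofNat (.sub (.arr 4 (.var 12)) (.lit 1)))
        (.mul (.add (.arr 3 (.lit 0)) (.arr 3 (.lit 0))) (scaleExpr c))))
      (.seq (.setReal 3 (.lit 0) (.lit 0) (.add (.arr 3 (.lit 0)) (.arr 3 (.lit 0)))) <|
        .ite (.natEq (.var 21) (.lit 1)) (.setNat 19 (.lit 0) (.lit 0) (.lit 0)) .skip)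
      .skip

/-- Sample the generators according to their levels. -/
def sampleProg (c : ℕ) : Prog :=
  .forN 12 <| .seq (.setReal 3 (.lit 0) (.lit 0) (.ofNat (.lit 1))) <|
    .seq (.setNat 19 (.lit 0) (.lit 0) (.lit 1)) <| .seq (coinProg c) <|
    .ite (.and (.natEq (.var 19) (.lit 1)) (.not (.natEq (.arr 4 (.var 12)) (.lit 0))))
      (.seq (.setNat 3 (.var 12) (.lit 0) (.lit 1))
        (.setReal 2 (.var 12) (.lit 0) (.mul (.arr 0 (.var 12)) (.arr 3 (.lit 0)))))
      .skip

section Spec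

variable {G : Type*} [Group G] [Fintype G] {e : G ≃ Fin (Fintype.card G)} {S : Finset G}
  {w : G → ℝ} {ε : ℝ} {m : Memory}

/-- The exponent is found while flipping: after l flips the real variable holds 2^min(l, a). Exactly
|G| coins are consumed whatever the exponent is, so the blocks of coins of different elements have
fixed positions. -/
theorem runs_coinProg (c : ℕ) (hm : HasInput e S w ε m) {s : G} (hs : m.nat 12 0 0 = e s) {a : ℕ}
    (ha : a = sampleExp (sampleScale c (m.nat 17 0 0) ε) (Fintype.card G) (m.nat 4 (e s) 0 - 1))
    (h3 : m.real 3 0 0 = 1) (h19 : m.nat 19 0 0 = 1) :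
    Runs (coinProg c) m (100 * Fintype.card G ^ 1) fun m' => Frame {19, 20, 21} {3} m m' ∧
      m'.real 3 0 0 = 2 ^ a ∧ (m'.nat 19 0 0 = 1 ↔ ∀ l < a, m.coins l = false) ∧
      ∀ x, m'.coins x = m.coins (x + Fintype.card G) := by
  have hn : 1 ≤ Fintype.card G := Fintype.card_pos
  have han : a ≤ Fintype.card G := ha ▸ sampleExp_le _ _ _
  refine Runs.mono (Runs.forN (m := m) (A := {19, 21}) (R := {3}) (n := Fintype.card G) (a := 70)
    (k := 0) (I := fun l m' => m'.real 3 0 0 = 2 ^ min l a ∧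
      (m'.nat 19 0 0 = 1 ↔ ∀ l' < l, l' < a → m.coins l' = false) ∧
      ∀ x, m'.coins x = m.coins (x + l))
    hn hm.card (by decide) (by decide) ?_ ?_ ?_) ?_ ?_
  · intro i m' x h
    simpa [Memory.setNat_nat] using h
  · simp [h3, h19]
  · rintro l hl m' hF hv ⟨h1, h2, h4⟩
    have hm' := hm.frame hF (by decide) (by decide) (by decide) (by decide) (by decide)
    have e12 : m'.nat 12 0 0 = e s := by rw [hF.1 12 (by decide), hs]
    have e17 : m'.nat 17 = m.nat 17 := hF.1 17 (by decide)
    have e4 : m'.nat 4 = m.nat 4 := hF.1 4 (by decide)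
    refine .seq (T₁ := 3) (T₂ := 60) (.flip le_rfl rfl) (fun m₁ hm₁ => ?_) (by norm_num)
    have n1 : ∀ b, b ≠ 21 → m₁.nat b = m'.nat b := fun b hb => by
      rw [← hm₁, Memory.setNat_nat_of_ne _ hb, Memory.dropCoin_nat]
    have r1 : m₁.real = m'.real := by rw [← hm₁]; rfl
    have n21 : m₁.nat 21 0 0 = (m.coins l).toNat := by
      rw [← hm₁]
      simp [Memory.setNat_nat, NatExpr.eval, h4]
    have c1 : ∀ x, m₁.coins x = m.coins (x + (l + 1)) := fun x => by
      rw [← hm₁]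
      simp only [Memory.setNat_coins, Memory.dropCoin_coins, h4]
      congr 1
      ring
    have hF₁ : Frame {19, 21} {3} m' m₁ := by
      rw [← hm₁]
      exact (Frame.refl _ _ m').dropCoin.setNat (by decide) _ _ _
    set θ := sampleScale c (m.nat 17 0 0) ε with hθ
    have hθ0 : 0 ≤ θ := by
      rw [hθ, sampleScale]
      have := mul_self_nonneg ε
      positivity
    have hscale : (scaleExpr c).eval m₁ = θ := by
      simp only [scaleExpr, RealExpr.eval, NatExpr.eval, r1, n1 17 (by decide), e17, hm'.eps]
      rfl
    -- The test asks whether one more doubling keeps 2^l θ within the bound. By monotonicity it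
    -- succeeds exactly a times; afterwards the variable stays at 2^a and the maximality of a makes
    -- it fail.
    have htest : (Test.not (.realLt (.ofNat (.sub (.arr 4 (.var 12)) (.lit 1)))
        (.mul (.add (.arr 3 (.lit 0)) (.arr 3 (.lit 0))) (scaleExpr c)))).Holds m₁ ↔ l < a := by
      simp only [Test.Holds, RealExpr.eval, NatExpr.eval, hscale, r1, h1, n1 4 (by decide),
        n1 12 (by decide), e12, e4, ← two_mul, ← pow_succ', not_lt]
      constructor
      · intro h
        by_contra hla
        rw [min_eq_right (not_lt.1 hla)] at h
        have := lt_two_pow_sampleExp_mul (θ := θ) (L := Fintype.card G)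
          (j := m.nat 4 (e s) 0 - 1) (l := a + 1) (by omega) (by omega)
        exact absurd h (not_le.2 this)
      · intro hla
        rw [min_eq_left hla.le]
        have h5 : 2 ^ a * θ ≤ ((m.nat 4 (e s) 0 - 1 : ℕ) : ℝ) := by
          have := two_pow_sampleExp_mul_le (θ := θ) (L := Fintype.card G)
            (j := m.nat 4 (e s) 0 - 1) (by omega)
          rwa [← ha] at this
        refine le_trans (mul_le_mul_of_nonneg_right ?_ hθ0) h5
        exact pow_le_pow_right₀ one_le_two hla
    refine .ite (T' := 20) (fun hc => ?_) (fun hc => ?_)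
      (by simp [Test.cost, NatExpr.cost, RealExpr.cost, scaleExpr])
    · have hla := htest.1 hc
      refine .seq (T₁ := 10) (T₂ := 10) (.setReal (by simp [NatExpr.cost, RealExpr.cost]) rfl)
        (fun m₂ hm₂ => ?_) (by norm_num)
      have hF₂ : Frame {19, 21} {3} m' m₂ := hm₂ ▸ hF₁.setReal (by decide) _ _ _
      have r2 : m₂.real 3 0 0 = 2 ^ min (l + 1) a := by
        rw [← hm₂, min_eq_left hla]
        simp only [Memory.setReal_real, NatExpr.eval, RealExpr.eval, r1, h1, min_eq_left hla.le]
        norm_num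
        ring
      have n2 : m₂.nat = m₁.nat := by rw [← hm₂]; rfl
      have c2 : m₂.coins = m₁.coins := by rw [← hm₂]; rfl
      refine .ite (T' := 4) (fun hb => .setNat le_rfl ⟨hF₂.setNat (by decide) _ _ _, r2, ?_, ?_⟩)
        (fun hb => .skip (by norm_num) ⟨hF₂, r2, ?_, ?_⟩) (by simp [Test.cost, NatExpr.cost])
      · simp only [Test.Holds, NatExpr.eval, n2, n21] at hb
        simp only [Memory.setNat_nat, NatExpr.eval]
        norm_num
        refine ⟨l, le_rfl, hla, ?_⟩
        cases h : m.coins l <;> simp [h] at hb ⊢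
      · simpa [c2] using c1
      · simp only [Test.Holds, NatExpr.eval, n2, n21] at hb
        have hl0 : m.coins l = false := by
          cases h : m.coins l <;> simp [h] at hb ⊢
        rw [n2, n1 19 (by decide), h2]
        refine ⟨fun H l' hl' hla' => ?_, fun H l' hl' hla' => H l' (by omega) hla'⟩
        rcases Nat.lt_succ_iff_lt_or_eq.1 hl' with h | rfl
        · exact H l' h hla'
        · exact hl0
      · simpa [c2] using c1
    · have hla : a ≤ l := not_lt.1 (mt htest.2 hc)
      refine .skip (by norm_num) ⟨hF₁, ?_, ?_, c1⟩
      · rw [r1, h1, min_eq_right hla, min_eq_right (by omega)]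
      · rw [n1 19 (by decide), h2]
        exact ⟨fun H l' hl' hla' => H l' (by omega) hla', fun H l' hl' hla' => H l' (by omega) hla'⟩
  · simp only [pow_one, zero_add]; omega
  · rintro m' ⟨hF, h1, h2, h4⟩
    refine ⟨hF.mono (by decide) (by decide), ?_, ?_, h4⟩
    · rw [h1, min_eq_right han]
    · exact h2.trans ⟨fun H l hl => H l (by omega) hl, fun H l _ hl => H l hl⟩

theorem runs_sampleProg (c : ℕ) (hm : HasInput e S w ε m) {lev : G → ℕ}
    (hlev : HoldsLevels e lev m) (hS : ∀ s, lev s ≠ 0 → s ∈ S) (h3 : m.nat 3 = 0) {a : G → ℕ}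
    (ha : ∀ s, a s = sampleExp (sampleScale c (m.nat 17 0 0) ε) (Fintype.card G) (lev s - 1)) :
    Runs (sampleProg c) m (200 * Fintype.card G ^ 2) fun m' =>
      ∀ g, (m'.nat 3 (e g) 0 = 1 ↔
          lev g ≠ 0 ∧ ∀ l < a g, m.coins (l + e g * Fintype.card G) = false) ∧
        (m'.nat 3 (e g) 0 = 1 → m'.real 2 (e g) 0 = w g * 2 ^ a g) := by
  have hn : 1 ≤ Fintype.card G := Fintype.card_pos
  refine Runs.mono (Runs.forN (m := m) (A := {3, 19, 20, 21}) (R := {2, 3}) (n := Fintype.card G)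
    (a := 160) (k := 1) (I := fun i m' => (∀ x, m'.coins x = m.coins (x + i * Fintype.card G)) ∧
      ∀ g, (m'.nat 3 (e g) 0 = 1 ↔ (e g : ℕ) < i ∧
          lev g ≠ 0 ∧ ∀ l < a g, m.coins (l + e g * Fintype.card G) = false) ∧
        (m'.nat 3 (e g) 0 = 1 → m'.real 2 (e g) 0 = w g * 2 ^ a g))
    hn hm.card (by decide) (by decide) ?_ ?_ ?_) ?_ ?_
  · intro i m' x h
    simpa [Memory.setNat_nat] using h
  · simp [h3]
  · rintro i hi m' hF hv ⟨h1, h2⟩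
    obtain ⟨s, rfl⟩ := exists_index e hi
    have hm' := hm.frame hF (by decide) (by decide) (by decide) (by decide) (by decide)
    have e17 : m'.nat 17 = m.nat 17 := hF.1 17 (by decide)
    have e4 : ∀ g, m'.nat 4 (e g) 0 = lev g := by rw [hF.1 4 (by decide)]; exact hlev
    refine .seq (T₁ := 10) (T₂ := 150 * Fintype.card G)
      (.setReal (by simp [NatExpr.cost, RealExpr.cost]) rfl)
      (fun m₁ hm₁ => .seq (T₁ := 4) (T₂ := 140 * Fintype.card G) (.setNat le_rfl rfl)
      (fun m₂ hm₂ => ?_) (by omega)) (by rw [pow_one]; omega)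
    have hF₂ : Frame {3, 19, 20, 21} {2, 3} m' m₂ := by
      subst hm₂ hm₁
      exact ((Frame.refl _ _ _).setReal (by decide) _ _ _).setNat (by decide) _ _ _
    have hm₂' := hm'.frame hF₂ (by decide) (by decide) (by decide) (by decide) (by decide)
    have n2 : ∀ b, b ≠ 19 → m₂.nat b = m'.nat b := fun b hb => by
      subst hm₂ hm₁
      rw [Memory.setNat_nat_of_ne _ hb, Memory.setReal_nat]
    have r2 : m₂.real 2 = m'.real 2 := by
      subst hm₂ hm₁
      rw [Memory.setNat_real, Memory.setReal_real_of_ne _ (by decide)]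
    have hcoin := runs_coinProg c hm₂' (s := s) (a := a s) (by rw [n2 12 (by decide), hv])
      (by rw [n2 17 (by decide), n2 4 (by decide), e4, e17]; exact ha s)
      (by subst hm₂ hm₁; simp [Memory.setReal_real, NatExpr.eval, RealExpr.eval])
      (by subst hm₂ hm₁; simp [Memory.setNat_nat, NatExpr.eval])
    have c2 : m₂.coins = m'.coins := by subst hm₂ hm₁; rfl
    refine .seq hcoin (T₂ := 40) (fun m₃ ⟨hF₃, h3r, h3k, h3c⟩ => ?_) (by rw [pow_one]; omega)
    have hF₃' : Frame {3, 19, 20, 21} {2, 3} m' m₃ :=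
      hF₂.trans (hF₃.mono (by decide) (by decide))
    have e12 : m₃.nat 12 0 0 = e s := by rw [hF₃'.1 12 (by decide), hv]
    have e43 : m₃.nat 4 (e s) 0 = lev s := by rw [hF₃'.1 4 (by decide), e4]
    have e3 : m₃.nat 3 = m'.nat 3 := by rw [hF₃.1 3 (by decide), n2 3 (by decide)]
    have r3 : m₃.real 2 = m'.real 2 := by rw [hF₃.2 2 (by decide), r2]
    have hcoins : ∀ x, m₃.coins x = m.coins (x + (e s + 1) * Fintype.card G) := fun x => by
      rw [h3c, c2, h1]
      congr 1
      ring
    have hkeep : m₃.nat 19 0 0 = 1 ↔ ∀ l < a s, m.coins (l + e s * Fintype.card G) = false := by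
      rw [h3k, c2]
      simp only [h1]
    have hothers : ∀ g, g ≠ s → ((m'.nat 3 (e g) 0 = 1 ↔ (e g : ℕ) < e s + 1 ∧
          lev g ≠ 0 ∧ ∀ l < a g, m.coins (l + e g * Fintype.card G) = false) ∧
        (m'.nat 3 (e g) 0 = 1 → m'.real 2 (e g) 0 = w g * 2 ^ a g)) := fun g hg => by
      rw [index_lt_succ, or_iff_left hg]
      exact h2 g
    refine .ite (T' := 20) (fun hc => ?_) (fun hc => ?_) (by simp [Test.cost, NatExpr.cost])
    · simp only [Test.Holds, NatExpr.eval, e12, e43, hkeep] at hc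
      refine .seq (T₁ := 6) (T₂ := 14) (.setNat le_rfl rfl) (fun m₄ hm₄ => .setReal ?_ ?_)
        (by norm_num)
      · simp [NatExpr.cost, RealExpr.cost]
      subst hm₄
      refine ⟨(hF₃'.setNat (by decide) _ _ _).setReal (by decide) _ _ _, hcoins, fun g => ?_⟩
      simp only [Memory.setNat_nat, Memory.setReal_real, Memory.setReal_nat, Memory.setNat_real,
        NatExpr.eval, RealExpr.eval, e12, index_inj]
      by_cases hg : g = s
      · subst hg
        have hw3 : m₃.real 0 (e g) 0 = w g := by
          rw [hF₃'.2 0 (by decide)]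
          exact hm'.weight g (hS g hc.2)
        simpa [hc.2, h3r, hw3] using hc.1
      · have hne : ¬ (e g : ℕ) = e s := index_inj.not.2 hg
        have := hothers g hg
        simpa [hg, hne, e3, r3] using this
    · simp only [Test.Holds, NatExpr.eval, e12, e43, hkeep] at hc
      refine .skip (by norm_num) ⟨hF₃', hcoins, fun g => ?_⟩
      rw [e3, r3]
      by_cases hg : g = s
      · subst hg
        have h0 : ¬ m'.nat 3 (e g) 0 = 1 := fun h => by
          have := ((h2 g).1.1 h).1
          omega
        exact ⟨⟨fun h => absurd h h0, fun h => absurd ⟨h.2.2, h.2.1⟩ hc⟩, fun h => absurd h h0⟩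
      · exact hothers g hg
  · norm_num; omega
  · rintro m' ⟨hF, h1, h2⟩ g
    refine ⟨(h2 g).1.trans (and_iff_right (e g).2), (h2 g).2⟩

end Spec

end RealRAM

namespace RealRAM

/-! ### The whole algorithm and its success probability. -/

theorem hasInput_sparsifyInput {G : Type*} [Group G] [Fintype G] (e : G ≃ Fin (Fintype.card G))
    (S : Finset G) (w : G → ℝ) (ε : ℝ) (r : ℕ → Bool) :
    HasInput e S w ε (sparsifyInput e S w ε r) where
  card := by simp [sparsifyInput]
  mul g h := by simp [sparsifyInput]
  mem g := by simp [sparsifyInput]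
  weight g hg := by simp [sparsifyInput, hg]
  eps := by simp [sparsifyInput]

/-- What the whole algorithm computes: the levels do not depend on the coins. -/
theorem exists_exec_sparsify {G : Type*} [Group G] [Fintype G] (c : ℕ)
    (e : G ≃ Fin (Fintype.card G)) {S : Finset G} {w : G → ℝ} (hw : ∀ s ∈ S, 0 ≤ w s) (ε : ℝ) :
    ∃ (K : ℕ) (lev : G → ℕ), Fintype.card G ≤ 2 ^ K ∧ 2 ^ K < 2 * Fintype.card G ∧
      LevelsFilled S w K (Fintype.card G) lev ∧ (∀ s, lev s ≤ Fintype.card G) ∧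
      ∀ a : G → ℕ,
        (∀ s, a s = sampleExp (sampleScale c K ε) (Fintype.card G) (lev s - 1)) → ∀ r : ℕ → Bool,
        Runs (.seq levelsProg (sampleProg c)) (sparsifyInput e S w ε r)
          (800 * Fintype.card G ^ 4) fun m' => ∀ g,
            (m'.nat 3 (e g) 0 = 1 ↔
              lev g ≠ 0 ∧ ∀ l < a g, r (l + e g * Fintype.card G) = false) ∧
            (m'.nat 3 (e g) 0 = 1 → m'.real 2 (e g) 0 = w g * 2 ^ a g) := by
  -- The levels are computed once with a dummy coin stream, and the run is then transferred to an
  -- arbitrary one.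
  have hin := hasInput_sparsifyInput e S w ε fun _ => false
  obtain ⟨t, ht, m₁, hexec, hF, hK, hK', lev, hlev, hfill, hle⟩ :=
    runs_levelsProg hw hin (by funext i j; simp [sparsifyInput])
  refine ⟨m₁.nat 17 0 0, lev, hK, hK', hfill, hle, fun a ha r => ?_⟩
  have hexec' := hexec.withCoins (by simp [levelsProg, logProg, levelProg, roundProg, selectProg,
    meetsProg, extendProg, Prog.forN, Prog.NoFlip]) r
  have hin₁ : HasInput e S w ε (m₁.withCoins r) :=
    (hasInput_sparsifyInput e S w ε r).frame (m := sparsifyInput e S w ε r) (m' := m₁.withCoins r)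
      ⟨hF.1, hF.2⟩ (by decide) (by decide) (by decide) (by decide) (by decide)
  have h3 : (m₁.withCoins r).nat 3 = 0 := by
    refine (hF.1 3 (by decide)).trans ?_
    funext i j
    simp [sparsifyInput]
  refine Runs.seq (T₁ := 600 * Fintype.card G ^ 4) (R := fun m' => m' = m₁.withCoins r)
    ⟨t, ht, _, hexec', rfl⟩ (fun m' hm' => ?_) (T₂ := 200 * Fintype.card G ^ 2) ?_
  · subst hm'
    exact runs_sampleProg c hin₁ hlev (fun s hs => (hfill.mem s hs).1) h3 ha
  · have : Fintype.card G ^ 2 ≤ Fintype.card G ^ 4 :=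
      Nat.pow_le_pow_right Fintype.card_pos (by norm_num)
    omega

end RealRAM

/-- The output weights are known only on the kept generators, and cuts depend on nothing else. -/
theorem IsSmallCayleyCutSparsifier.congr {G : Type*} [Group G] [Fintype G] {C ε : ℝ} {S S' : Finset G}
    {w w₁ w₂ : G → ℝ} (h : IsSmallCayleyCutSparsifier C ε S w S' w₁) (hw : ∀ s ∈ S', w₂ s = w₁ s) :
    IsSmallCayleyCutSparsifier C ε S w S' w₂ := by
  refine ⟨h.1, fun s hs => (hw s hs).symm ▸ h.2.1 s hs, h.2.2.1, fun T => ?_⟩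
  have h1 := h.2.2.2 T
  have h2 : (Cay S' w₂).cutSize T = (Cay S' w₁).cutSize T := by
    rw [cutSize_Cay, cutSize_Cay, sum_congr rfl fun s hs => by rw [hw s hs]]
  rwa [h2]

/-- For the trivial group log|G| = 0, so only the empty set is small enough; all cuts vanish. -/
theorem isSmallCayleyCutSparsifier_empty {G : Type*} [Group G] [Fintype G]
    (hG : Fintype.card G = 1) {C ε : ℝ} (S : Finset G) (w w' : G → ℝ) :
    IsSmallCayleyCutSparsifier C ε S w ∅ w' := by
  have : Subsingleton G := Fintype.card_le_one_iff_subsingleton.1 hG.le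
  have hcut : ∀ (S : Finset G) (w : G → ℝ) (T : Set G), (Cay S w).cutSize T = 0 := fun S w T => by
    rw [cutSize_Cay, sum_eq_zero, zero_div]
    intro s _
    rw [Subsingleton.elim s 1, (isLengthFunction_translationLength _).one]
    ring
  exact ⟨empty_subset S, by simp, by simp [hG], fun T => by simp [hcut]⟩

/-- Restricting a uniformly random bit string to some of its positions gives a uniformly random bit
string. -/
theorem card_filter_comp_mem {α β : Type*} [Fintype α] [Fintype β] [DecidableEq α] [DecidableEq β]
    {j : α → β} (hj : Function.Injective j) (B : Finset (α → Bool)) :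
    #{f : β → Bool | f ∘ j ∈ B} * Fintype.card (α → Bool) = #B * Fintype.card (β → Bool) := by
  classical
  let E : (β → Bool) ≃ (α → Bool) × ({b // b ∉ Set.range j} → Bool) :=
    (Equiv.piEquivPiSubtypeProd (· ∈ Set.range j) fun _ => Bool).trans
      ((Equiv.arrowCongr (Equiv.ofInjective j hj).symm (Equiv.refl _)).prodCongr (Equiv.refl _))
  have hE : ∀ f, (E f).1 = f ∘ j := fun f => by
    funext x
    simp [E, Equiv.arrowCongr, Equiv.piEquivPiSubtypeProd]
  have h1 : #{f : β → Bool | f ∘ j ∈ B} = #(B ×ˢ (univ : Finset ({b // b ∉ Set.range j} → Bool))) := by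
    refine card_bij (fun f _ => E f) (fun f hf => ?_) (fun f _ g _ h => E.injective h) fun p hp => ?_
    · rw [mem_product, hE]
      exact ⟨(mem_filter.1 hf).2, mem_univ _⟩
    · refine ⟨E.symm p, ?_, by simp⟩
      rw [mem_filter, ← hE, E.apply_symm_apply]
      exact ⟨mem_univ _, (mem_product.1 hp).1⟩
  rw [h1, card_product, card_univ, Fintype.card_congr E, Fintype.card_prod]
  ring

/-- The bits at the distinct positions `j x` form a uniform sample, so the coin strings that
restrict to a bad sample have the same frequency as `B`. -/
theorem le_coinProb {α : Type*} [Fintype α] [DecidableEq α] {N : ℕ} {j : α → ℕ}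
    (hj : Function.Injective j) (hjN : ∀ x, j x < N) {δ : ℝ} {B : Finset (α → Bool)}
    (hB : (#B : ℝ) ≤ δ * Fintype.card (α → Bool)) {E : (ℕ → Bool) → Prop}
    (hE : ∀ r : ℕ → Bool, r ∘ j ∉ B → E r) : 1 - δ ≤ RealRAM.coinProb N E := by
  classical
  have h1 := card_filter_comp_mem (j := fun x => (⟨j x, hjN x⟩ : Fin N))
    (fun x y h => hj (Fin.mk.inj_iff.1 h)) B
  set A := univ.filter fun f : Fin N → Bool => (f ∘ fun x => (⟨j x, hjN x⟩ : Fin N)) ∈ B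
  have h2 : (#A : ℝ) ≤ δ * 2 ^ N := by
    have h3 : (#A : ℝ) * Fintype.card (α → Bool) = #B * 2 ^ N := by
      have : Fintype.card (Fin N → Bool) = 2 ^ N := by simp
      rw [this] at h1
      exact_mod_cast h1
    have h4 : (0 : ℝ) < Fintype.card (α → Bool) := by exact_mod_cast Fintype.card_pos
    refine le_of_mul_le_mul_right ?_ h4
    rw [h3]
    have h5 : (0 : ℝ) < 2 ^ N := by positivity
    nlinarith
  have h3 : Aᶜ ⊆ univ.filter fun r : Fin N → Bool =>
      E fun i => if h : i < N then r ⟨i, h⟩ else false := by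
    intro r hr
    refine mem_filter.2 ⟨mem_univ _, hE _ fun h => ?_⟩
    refine (mem_compl.1 hr) (mem_filter.2 ⟨mem_univ _, ?_⟩)
    convert h using 1
    funext x
    simp [hjN x]
  have h4 := card_le_card h3
  rw [card_compl] at h4
  have h5 : Fintype.card (Fin N → Bool) = 2 ^ N := by simp
  rw [h5] at h4
  have h6 : (2 : ℝ) ^ N ≤ #(univ.filter fun r : Fin N → Bool =>
      E fun i => if h : i < N then r ⟨i, h⟩ else false) + #A := by
    have : 2 ^ N ≤ #(univ.filter fun r : Fin N → Bool =>
      E fun i => if h : i < N then r ⟨i, h⟩ else false) + #A := by omega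
    exact_mod_cast this
  unfold RealRAM.coinProb
  rw [le_div_iff₀ (by positivity)]
  linarith

theorem RealRAM.coinProb_nonneg (N : ℕ) (E : (ℕ → Bool) → Prop) : 0 ≤ RealRAM.coinProb N E := by
  unfold coinProb
  positivity

theorem mainTheorem3 (d c : ℕ) :
    ∃ C : ℝ, 0 < C ∧ ∃ (P : RealRAM.Prog) (A k : ℕ),
      ∀ (G : Type*) [Group G] [Fintype G] (S : Finset G) (w : G → ℝ) (ε : ℝ),
        PolyBoundedWeights d S w → 0 < ε → ε < 1 →
          (∃ (S' : Finset G) (w' : G → ℝ), IsSmallCayleyCutSparsifier C ε S w S' w') ∧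
          ∀ e : G ≃ Fin (Fintype.card G),
            (∀ r : ℕ → Bool, ∃ t ≤ A * Fintype.card G ^ k, ∃ m : RealRAM.Memory,
              RealRAM.Exec P (sparsifyInput e S w ε r) t m) ∧
            1 - 1 / (Fintype.card G : ℝ) ^ c ≤
              RealRAM.coinProb (A * Fintype.card G ^ k) (fun r =>
                ∃ (t : ℕ) (m : RealRAM.Memory), RealRAM.Exec P (sparsifyInput e S w ε r) t m ∧
                  IsSmallCayleyCutSparsifier C ε S w (outputGens e m) (outputWeight e m)) := by
  classical
  -- The exponent c + 1 makes the failure frequency strictly less than 1 even for c = 0, so that a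
  -- good sample exists.
  refine ⟨sparsifierConst (c + 1), by unfold sparsifierConst; positivity,
    .seq RealRAM.levelsProg (RealRAM.sampleProg (c + 1)), 800, 4, ?_⟩
  intro G _ _ S w ε hw hε hε1
  have hn : 1 ≤ Fintype.card G := Fintype.card_pos
  -- the sampled subsets that fail are rare
  have key : 2 ≤ Fintype.card G → ∀ e : G ≃ Fin (Fintype.card G),
      ∃ B : Finset (G → Fin (Fintype.card G) → Bool),
        (#B : ℝ) ≤ 1 / (Fintype.card G : ℝ) ^ (c + 1)
          * Fintype.card (G → Fin (Fintype.card G) → Bool) ∧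
        (∀ ω ∉ B, ∃ (S' : Finset G) (w' : G → ℝ),
          IsSmallCayleyCutSparsifier (sparsifierConst (c + 1)) ε S w S' w') ∧
        ∀ r : ℕ → Bool, (fun g (l : Fin (Fintype.card G)) => r (l + e g * Fintype.card G)) ∉ B →
          ∃ (t : ℕ) (m : RealRAM.Memory), RealRAM.Exec
            (.seq RealRAM.levelsProg (RealRAM.sampleProg (c + 1))) (sparsifyInput e S w ε r) t m ∧
            IsSmallCayleyCutSparsifier (sparsifierConst (c + 1)) ε S w (outputGens e m)
              (outputWeight e m) := by
    intro hn2 e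
    obtain ⟨K, lev, hK, hK', hfill, hle, hrun⟩ :=
      RealRAM.exists_exec_sparsify (c + 1) e hw.1 ε
    set a : G → ℕ := fun s => sampleExp (sampleScale (c + 1) K ε) (Fintype.card G) (lev s - 1)
      with ha
    refine ⟨univ.filter fun ω => ¬ IsSmallCayleyCutSparsifier (sparsifierConst (c + 1)) ε S w
      (sampledGens (univ.filter fun s => lev s ≠ 0) a ω) fun s => w s * 2 ^ a s,
      hfill.card_not_isSmall_le (c + 1) hn2 hK hK' hw.1 hle hε hε1 (a := a) (fun s => rfl)
        fun ω hω => (mem_filter.1 hω).2, fun ω hω => ?_, fun r hr => ?_⟩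
    · exact ⟨_, _, by simpa using hω⟩
    · obtain ⟨t, -, m, hexec, hm⟩ := hrun a (fun s => rfl) r
      refine ⟨t, m, hexec, ?_⟩
      simp only [mem_filter, mem_univ, true_and, not_not] at hr
      have hgens : outputGens e m = sampledGens (univ.filter fun s => lev s ≠ 0) a
          fun g (l : Fin (Fintype.card G)) => r (l + e g * Fintype.card G) := by
        ext g
        simp only [outputGens, sampledGens, mem_filter, mem_univ, true_and, (hm g).1]
        refine and_congr_right fun _ => ⟨fun H l hl => H l hl, fun H l hl => ?_⟩
        exact H ⟨l, hl.trans_le (sampleExp_le _ _ _)⟩ hl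
      rw [hgens]
      refine hr.congr fun s hs => (hm s).2 ?_
      rw [← hgens] at hs
      exact (mem_filter.1 hs).2
  refine ⟨?_, fun e => ⟨fun r => ?_, ?_⟩⟩
  · rcases hn.eq_or_lt with h1 | h2
    · exact ⟨∅, w, isSmallCayleyCutSparsifier_empty h1.symm S w w⟩
    · obtain ⟨B, hB, hgood, -⟩ := key h2 (Fintype.equivFin G)
      have hlt : #B < #(univ : Finset (G → Fin (Fintype.card G) → Bool)) := by
        have h3 : (1 : ℝ) < (Fintype.card G : ℝ) ^ (c + 1) :=
          one_lt_pow₀ (by exact_mod_cast h2) (Nat.succ_ne_zero c)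
        have h4 : (0 : ℝ) < Fintype.card (G → Fin (Fintype.card G) → Bool) := by
          exact_mod_cast Fintype.card_pos
        have h5 : 1 / (Fintype.card G : ℝ) ^ (c + 1) < 1 := (div_lt_one (by linarith)).2 h3
        have h6 : (#B : ℝ) < Fintype.card (G → Fin (Fintype.card G) → Bool) := by nlinarith
        rw [card_univ]
        exact_mod_cast h6
      obtain ⟨ω, -, hω⟩ := exists_mem_notMem_of_card_lt_card hlt
      exact hgood ω hω
  · obtain ⟨K, lev, -, -, -, -, hrun⟩ := RealRAM.exists_exec_sparsify (c + 1) e hw.1 ε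
    obtain ⟨t, ht, m, hexec, -⟩ := hrun _ (fun s => rfl) r
    exact ⟨t, ht, m, hexec⟩
  · rcases hn.eq_or_lt with h1 | h2
    -- For the trivial group the required probability is 1 − 1 = 0.
    · rw [← h1]
      simpa using RealRAM.coinProb_nonneg _ _
    · obtain ⟨B, hB, -, hgood⟩ := key h2 e
      have hn0 : (0 : ℝ) < Fintype.card G := by exact_mod_cast hn
      have hle : 1 - 1 / (Fintype.card G : ℝ) ^ c ≤ 1 - 1 / (Fintype.card G : ℝ) ^ (c + 1) := by
        refine sub_le_sub_left (one_div_le_one_div_of_le (by positivity) ?_) 1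
        exact pow_le_pow_right₀ (by exact_mod_cast hn) (Nat.le_succ c)
      refine hle.trans (le_coinProb (α := G × Fin (Fintype.card G))
        (j := fun p => p.2 + e p.1 * Fintype.card G) (fun p q hpq => ?_) (fun p => ?_)
        (B := B.map (Equiv.curry G (Fin (Fintype.card G)) Bool).symm.toEmbedding) ?_ fun r hr => ?_)
      -- Division by |G| with remainder recovers the element and the number of the coin from the
      -- position.
      · have hmod : (p.2 : ℕ) = q.2 := by
          have := congrArg (· % Fintype.card G) hpq
          simpa [Nat.add_mul_mod_self_right, Nat.mod_eq_of_lt] using this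
        have hdiv : (e p.1 : ℕ) = e q.1 := by
          have : (p.2 : ℕ) + e p.1 * Fintype.card G = q.2 + e q.1 * Fintype.card G := hpq
          rw [hmod, Nat.add_left_cancel_iff] at this
          exact Nat.eq_of_mul_eq_mul_right hn this
        exact Prod.ext (RealRAM.index_inj.1 hdiv) (Fin.ext hmod)
      · have h3 : (e p.1 + 1) * Fintype.card G ≤ Fintype.card G * Fintype.card G :=
          Nat.mul_le_mul_right _ (e p.1).2
        have h4 : Fintype.card G ^ 2 ≤ Fintype.card G ^ 4 := Nat.pow_le_pow_right hn (by norm_num)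
        have h5 := p.2.2
        rw [sq] at h4
        rw [add_mul, one_mul] at h3
        show (p.2 : ℕ) + e p.1 * Fintype.card G < _
        omega
      · rw [card_map]
        refine hB.trans (le_of_eq ?_)
        rw [Fintype.card_congr (Equiv.curry G (Fin (Fintype.card G)) Bool)]
      · refine hgood r fun hmem => hr ?_
        rw [mem_map_equiv]
        exact hmem
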